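/- Let $\tau_0>0$, $T>0$, $\Gamma=\langle z\mapsto e^{\tau_0}z\rangle$ acting on $\mathbb H=\{\operatorname{Im} z>0\}$, let $R=\mathbb H/\Gamma$ (an annulus) with border $\partial R=(\mathbb R\setminus\{0\})/\Gamma$, and let $\pi:\overline{\mathbb H}\setminus\{0,\infty\}\to R\cup\partial R$ be the quotient map. Let $\gamma:[0,T]\to R\cup\partial R$ be a simple curve with $\gamma(0)\in\partial R$ and $\gamma(0,T]\subset R$, let $\widetilde\gamma$ be a continuous lift of $\gamma$ under $\pi$, and put $H_t=\mathbb H\setminus\pi^{-1}(\gamma(0,t])$. Let $\{f_t\}_{t\in[0,T]}$ be a Loewner chain for $\gamma$, i.e. each $f_t$ is a conformal map of $\mathbb H$ onto $H_t$ and there is a null set $E\subset(0,T)$ such that $t\mapsto f_t(z)$ is differentiable at every $t\in(0,T)\setminus E$ for every $z\in\mathbb H$. Assume the normalization $f_t(0)=0$, $f_t(\infty)=\infty$ in the sense of boundary values: $f_t(z)\to0$ as $z\to0$ and $f_t(z)\to\infty$ as $z\to\infty$ in $\mathbb H$. Then there are a strictly increasing function $\tau:[0,T]\to(0,\infty)$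 and a function $\xi:[0,T]\to\mathbb R$ such that, for every $t\in[0,T]$, $$f_t(e^{\tau(t)}z)=e^{\tau_0}f_t(z)\quad(z\in\mathbb H),\qquad \Gamma_t:=f_t^{-1}\circ\Gamma\circ f_t=\langle z\mapsto e^{\tau(t)}z\rangle,$$ and $\xi(t)=f_t^{-1}(\widetilde\gamma(t))$, in the sense that $f_t^{-1}(w)\to\xi(t)$ as $w\to\widetilde\gamma(t)$ in $H_t$. Moreover, there is a real $c\neq0$ with $e^{k\tau(t)}c\ne\xi(t)$ for all $t\in[0,T]$ and $k\in\mathbb Z$; and for every such $c$ there is a function $\lambda$ with real values such that for almost every $t\in(0,T)$ the function $\tau$ is differentiable at $t$ and, for all $z\in\mathbb H$, $$\dot f_t(z)=f_t'(z)\,P(z,t),\qquad P(z,t)=\lambda(t)z-\sum_{k\in\mathbb Z}\left(\frac{\dot\tau(t)\xi(t)z}{e^{k\tau(t)}z-\xi(t)}-\frac{\dot\tau(t)\xi(t)z}{e^{k\tau(t)}c-\xi(t)}\right),$$ where the series converges absolutely. -/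

import Mathlib

open Set Filter Topology MeasureTheory
open scoped UpperHalfPlane

namespace AnnulusLoewner

noncomputable section

/-- The upper half-plane `ℍ`, as an open subset of `ℂ`. -/
abbrev upperHalf : Set ℂ := UpperHalfPlane.upperHalfPlaneSet

/-- The closed upper half-plane without the two limit points `0` and `∞` of the group generated
by a dilation, i.e. `ℍ` together with the free boundary `ℝ \ {0}`. -/
abbrev BorderedCover : Type := {z : ℂ // 0 ≤ z.im ∧ z ≠ 0}

/-- Two points are identified when they lie in one orbit of `Γ = ⟨z ↦ e^{τ₀} z⟩`. -/
def dilationSetoid (τ₀ : ℝ) : Setoid BorderedCover where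
  r z w := ∃ k : ℤ, (w : ℂ) = (Real.exp (k * τ₀) : ℂ) * (z : ℂ)
  iseqv := by
    refine ⟨fun z => ⟨0, by simp⟩, ?_, ?_⟩
    · rintro z w ⟨k, hk⟩
      refine ⟨-k, ?_⟩
      rw [hk, ← mul_assoc, ← Complex.ofReal_mul, ← Real.exp_add]
      simp
    · rintro x y z ⟨k, hk⟩ ⟨l, hl⟩
      refine ⟨l + k, ?_⟩
      rw [hl, hk, ← mul_assoc, ← Complex.ofReal_mul, ← Real.exp_add]
      push_cast
      ring_nf

/-- The bordered Riemann surface `R ∪ ∂R`, where `R = ℍ / Γ` is the annulus and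
`∂R = (ℝ \ {0}) / Γ`, with the quotient topology. -/
abbrev BorderedAnnulus (τ₀ : ℝ) : Type := Quotient (dilationSetoid τ₀)

/-- The quotient map `π`, extended to the free boundary. -/
def proj (τ₀ : ℝ) : BorderedCover → BorderedAnnulus τ₀ := Quotient.mk (dilationSetoid τ₀)

/-- The interior `R = ℍ / Γ`. -/
def annulusInterior (τ₀ : ℝ) : Set (BorderedAnnulus τ₀) :=
  proj τ₀ '' {z | 0 < (z : ℂ).im}

/-- The border `∂R = (ℝ \ {0}) / Γ`. -/
def annulusBorder (τ₀ : ℝ) : Set (BorderedAnnulus τ₀) :=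
  proj τ₀ '' {z | (z : ℂ).im = 0}

/-- `γ : [0,T] → R ∪ ∂R` is a simple curve with `γ(0) ∈ ∂R` and `γ(0,T] ⊆ R`. -/
structure IsSimpleSlit (τ₀ T : ℝ) (γ : ℝ → BorderedAnnulus τ₀) : Prop where
  continuousOn : ContinuousOn γ (Icc 0 T)
  injOn : InjOn γ (Icc 0 T)
  start_mem : γ 0 ∈ annulusBorder τ₀
  mem_interior : ∀ t ∈ Ioc 0 T, γ t ∈ annulusInterior τ₀

/-- `γ' : [0,T] → ℍ ∪ (ℝ \ {0})` is a lift of `γ` (a continuous curve with `π ∘ γ' = γ`). -/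
structure IsLift (τ₀ T : ℝ) (γ : ℝ → BorderedAnnulus τ₀) (γ' : ℝ → BorderedCover) : Prop where
  continuousOn : ContinuousOn γ' (Icc 0 T)
  proj_eq : ∀ t ∈ Icc 0 T, proj τ₀ (γ' t) = γ t

/-- The domain `H_t = ℍ \ π⁻¹(γ(0,t])`. -/
def slitDomain (τ₀ : ℝ) (γ : ℝ → BorderedAnnulus τ₀) (t : ℝ) : Set ℂ :=
  Subtype.val '' {z : BorderedCover | 0 < (z : ℂ).im ∧ proj τ₀ z ∉ γ '' Ioc 0 t}

/-- `(f_t)` is a Loewner chain for `γ`: every `f_t` is a conformal map of `ℍ` onto `H_t`, and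
for all `t ∈ (0,T)` outside a null set `f_t(z)` is differentiable in `t` for every `z ∈ ℍ`. -/
structure IsLoewnerChain (τ₀ T : ℝ) (γ : ℝ → BorderedAnnulus τ₀) (f : ℝ → ℂ → ℂ) : Prop where
  differentiableOn : ∀ t ∈ Icc 0 T, DifferentiableOn ℂ (f t) upperHalf
  injOn : ∀ t ∈ Icc 0 T, InjOn (f t) upperHalf
  image_eq : ∀ t ∈ Icc 0 T, f t '' upperHalf = slitDomain τ₀ γ t
  ae_differentiableAt : ∀ᵐ t ∂(volume.restrict (Ioo 0 T)), ∀ z ∈ upperHalf,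
    DifferentiableAt ℝ (fun s : ℝ => f s z) t

/-- The normalization `f_t(0) = 0`, `f_t(∞) = ∞`, in the sense of boundary values. -/
structure IsNormalized (T : ℝ) (f : ℝ → ℂ → ℂ) : Prop where
  tendsto_zero : ∀ t ∈ Icc 0 T, Tendsto (f t) (𝓝[upperHalf] 0) (𝓝 0)
  tendsto_infty : ∀ t ∈ Icc 0 T,
    Tendsto (f t) (Bornology.cobounded ℂ ⊓ 𝓟 upperHalf) (Bornology.cobounded ℂ)

/-- The map `z ↦ e^a z` of the upper half-plane onto itself. -/
def dilation (a : ℝ) : Equiv.Perm ℍ :=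
  MulAction.toPerm (⟨Real.exp a, Real.exp_pos a⟩ : {x : ℝ // 0 < x})

/-- The group `⟨z ↦ e^a z⟩`. -/
def dilationGroup (a : ℝ) : Subgroup (Equiv.Perm ℍ) := Subgroup.zpowers (dilation a)

/-- The set `F⁻¹ ∘ G ∘ F = {F⁻¹ ∘ φ ∘ F : φ ∈ G}`, for `F` injective on `ℍ` with values in `ℍ`
and with `G`-invariant image: `ψ = F⁻¹ ∘ φ ∘ F` is expressed as `F ∘ ψ = φ ∘ F`. -/
def conjugateGroup (F : ℂ → ℂ) (G : Subgroup (Equiv.Perm ℍ)) : Set (Equiv.Perm ℍ) :=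
  {ψ | ∃ φ ∈ G, ∀ z w : ℍ, F (z : ℂ) = (w : ℂ) → F (ψ z : ℂ) = (φ w : ℂ)}

/-- The conformal inverse `F⁻¹ : F(ℍ) → ℍ` of a map `F` injective on `ℍ`. -/
def inverseMap (F : ℂ → ℂ) : ℂ → ℂ := Function.invFunOn F upperHalf

/-- The `k`-th term `τ'ξz/(e^{kτ}z - ξ) - τ'ξz/(e^{kτ}c - ξ)`; here `τ'` is the value of the
time derivative of `τ`. -/
def fieldTerm (τ τ' ξ c : ℝ) (z : ℂ) (k : ℤ) : ℂ :=
  (τ' : ℂ) * ξ * z / ((Real.exp (k * τ) : ℂ) * z - ξ)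
    - (τ' : ℂ) * ξ * z / ((Real.exp (k * τ) : ℂ) * c - ξ)

/-- `P(z) = lam z - ∑_{k ∈ ℤ} (τ'ξz/(e^{kτ}z - ξ) - τ'ξz/(e^{kτ}c - ξ))`. -/
def field (lam τ τ' ξ c : ℝ) (z : ℂ) : ℂ :=
  (lam : ℂ) * z - ∑' k : ℤ, fieldTerm τ τ' ξ c z k

/-- `c` is a nonzero real number which for no `t ∈ [0,T]` lies in the `Γ_t`-orbit of `ξ(t)`, so
that no denominator `e^{kτ(t)}c - ξ(t)` vanishes. -/
def IsAdmissible (T : ℝ) (τ ξ : ℝ → ℝ) (c : ℝ) : Prop :=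
  c ≠ 0 ∧ ∀ t ∈ Icc 0 T, ∀ k : ℤ, Real.exp (k * τ t) * c ≠ ξ t

end

end AnnulusLoewner

/-!
The evolution equation is proved in the logarithmic coordinate of the strip `{0 < Im < π}`, where
the deck group acts by translations. A slit that starts on the negative axis is first reflected in
the imaginary axis (`SatisfiesEvolution.reflect`), so that the slit starts on the positive axis,
which is the bottom side of the strip.

*Boundary behaviour of `f_t⁻¹`.* Instead of prime ends, the proof uses Koebe's lemma
(`exists_pos_forall_path_not_small`): a bounded zero-free function is not small along paths that
leave the neighbourhood of a boundary point. It applies to `1 / (f + i)`, `f / (f + i)` and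
`(f - p) / (f + i)`, because nearby points of the slit domain at `∞`, at `0` and at the tip `p` can be
joined by short paths. The last fact is plane topology: attaching disjoint arcs to a compact set
does not create separation, by Eilenberg's criterion (`mem_connectedComponentIn_of_log`,
`exists_log_attach_arc`). Hence `f_t⁻¹` tends to `0`, to `∞` and to a nonzero real `ξ(t)` there,
and `f_t⁻¹ ∘ (e^{τ₀} ·) ∘ f_t` is an automorphism of the half-plane fixing `0` and `∞`, that is, a
dilation by some `e^{τ(t)}` (`IsSlitMap.exists_dilation`).

*Monotonicity of `τ`.* For `s < t` the transition map `K = F_s⁻¹ ∘ F_t` of the strip satisfies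
`K (ζ + τ(t)) = K ζ + τ(s)`. The function `Q = K - id` has nonnegative imaginary part at the bottom,
nonpositive imaginary part at the top, and drops by `b τ(t)` over a period, with
`b = 1 - τ(s) / τ(t)`. Its Fourier coefficients give `b ≥ 0`, with equality only for a translation
(`nonneg_and_eq_const_of_boundary`). So `τ` is strictly increasing (`IsStripMap.period_lt`), and
differentiable almost everywhere.

*The equation.* As `s` increases to `t`, the map `Q` has boundary values zero except near the
prime end of the tip, at `log ξ(t)` (`IsStripMap.transition_near_boundary`,
`hasStripBoundary_sub_id`). Its imaginary part is therefore almost the Poisson integral of a point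
mass of size `b π` there. Comparing Fourier coefficients with those of the explicit kernel
`stripKernel`, which is the sum of the statement, gives `Q = b τ(t) E + λ_s + O(b η)` with real
`λ_s`, where `η` is the width of the concentration (`HasStripBoundary.exists_norm_sub_le`).
Division by `t - s` shows that the velocity of the transition maps is `τ' E` plus a real constant
(`eq_const_add_stripKernel_of_tendsto`). Where `t ↦ f_t(z)` is differentiable for all `z`, this
velocity is `ḟ_t / f_t'` in logarithmic coordinates (`tendsto_slope_of_comp_eq`); there pointwise
convergence of univalent maps is upgraded to locally uniform convergence of derivatives by
Cauchy's formula (`tendsto_deriv_of_tendsto`).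
-/

/-! ### Plane topology: logarithms and separation -/

namespace AnnulusLoewner

/-- A continuous zero-free function on a normed space has a continuous logarithm. -/
theorem exists_continuous_log {E : Type*} [NormedAddCommGroup E] [NormedSpace ℝ E] {h : E → ℂ}
    (hc : Continuous h) (h0 : ∀ x, h x ≠ 0) :
    ∃ L : E → ℂ, Continuous L ∧ ∀ x, Complex.exp (L x) = h x := by
  rcases Complex.isCoveringMapOn_exp.existsUnique_continuousMap_lifts
    ⟨h, hc⟩ (Complex.exp_log (h0 0)) (fun x ↦ h0 x) with ⟨f, ⟨-, hf⟩, -⟩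
  exact ⟨f, f.continuous, fun x => congr($hf x)⟩

/-- Two continuous logarithms of the same function on a preconnected set differ by a constant. -/
theorem exists_sub_eq_of_exp_eq {X : Type*} [TopologicalSpace X] {S : Set X}
    (hS : IsPreconnected S) {u v : X → ℂ} (hu : ContinuousOn u S) (hv : ContinuousOn v S)
    (h : ∀ x ∈ S, Complex.exp (u x) = Complex.exp (v x)) :
    ∃ c : ℂ, Complex.exp c = 1 ∧ ∀ x ∈ S, u x = v x + c := by
  rcases S.eq_empty_or_nonempty with rfl | ⟨x₀, hx₀⟩
  · exact ⟨0, by simp, by simp⟩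
  have key : ∀ x ∈ S, ∃ n : ℤ, u x - v x = n * (2 * Real.pi * Complex.I) := by
    intro x hx
    obtain ⟨n, hn⟩ := Complex.exp_eq_exp_iff_exists_int.1 (h x hx)
    exact ⟨n, by rw [hn]; ring⟩
  have hcon : ∀ x ∈ S, u x - v x = u x₀ - v x₀ := by
    have hmaps : MapsTo (fun x => u x - v x) S
        (AddSubgroup.zmultiples (2 * Real.pi * Complex.I) : Set ℂ) := by
      intro x hx
      obtain ⟨n, hn⟩ := key x hx
      exact AddSubgroup.mem_zmultiples_iff.2 ⟨n, by simp [hn]⟩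
    have : DiscreteTopology (AddSubgroup.zmultiples (2 * Real.pi * Complex.I)) :=
      NormedSpace.discreteTopology_zmultiples _
    have hd : IsDiscrete (AddSubgroup.zmultiples (2 * Real.pi * Complex.I) : Set ℂ) := ⟨this⟩
    intro x hx
    exact hS.constant_of_mapsTo hd (hu.sub hv) hmaps hx hx₀
  refine ⟨u x₀ - v x₀, ?_, fun x hx => by rw [← hcon x hx]; ring⟩
  rw [Complex.exp_sub, h x₀ hx₀, div_self (Complex.exp_ne_zero _)]

/-- There is no continuous logarithm of `z - a` on a circle about `a`. -/
theorem not_exists_log_sub_on_circle {a : ℂ} {R : ℝ} (hR : 0 < R) {L : ℂ → ℂ}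
    (hL : ContinuousOn L (Metric.sphere a R))
    (h : ∀ z ∈ Metric.sphere a R, Complex.exp (L z) = z - a) : False := by
  have hmem : ∀ θ : ℝ, circleMap a R θ ∈ Metric.sphere a R := fun θ =>
    circleMap_mem_sphere a hR.le θ
  have hc : Continuous fun θ : ℝ => L (circleMap a R θ) :=
    hL.comp_continuous (continuous_circleMap a R) hmem
  obtain ⟨c, -, hcc⟩ := exists_sub_eq_of_exp_eq (S := (univ : Set ℝ)) isPreconnected_univ
    (u := fun θ : ℝ => L (circleMap a R θ)) (v := fun θ : ℝ => Real.log R + θ * Complex.I)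
    hc.continuousOn (by fun_prop) (by
      intro θ _
      rw [h _ (hmem θ), Complex.exp_add, ← Complex.ofReal_exp, Real.exp_log hR]
      simp [circleMap])
  have h0 := hcc 0 (mem_univ _)
  have h1 := hcc (2 * Real.pi) (mem_univ _)
  have : circleMap a R (2 * Real.pi) = circleMap a R 0 := by
    simpa using periodic_circleMap a R 0
  simp only [this, h0, Complex.ofReal_zero] at h1
  have h2 : ((2 * Real.pi : ℝ) : ℂ) * Complex.I = 0 := by
    linear_combination (-1 : ℂ) * h1
  simp [Real.pi_ne_zero] at h2

/-- **Eilenberg's criterion**, one direction: if `(z - a) / (z - b)` has a continuous logarithm on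
the compact set `K`, then `K` does not separate `a` from `b`. -/
theorem mem_connectedComponentIn_of_log {K : Set ℂ} (hK : IsCompact K) {a b : ℂ} (ha : a ∉ K)
    (hb : b ∉ K) (hbd : Bornology.IsBounded (connectedComponentIn Kᶜ a)) {g : ℂ → ℂ}
    (hg : ContinuousOn g K) (hexp : ∀ z ∈ K, Complex.exp (g z) = (z - a) / (z - b)) :
    b ∈ connectedComponentIn Kᶜ a := by
  classical
  -- otherwise `z - a` off the component and `(z - b) exp g` on it fit together to a continuous
  -- zero-free function on the plane, whose logarithm is one of `z - a` on a large circle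
  by_contra hbU
  set U := connectedComponentIn Kᶜ a with hU
  have hUo : IsOpen U := hK.isClosed.isOpen_compl.connectedComponentIn
  have haU : a ∈ U := mem_connectedComponentIn ha
  have hfr : ∀ z ∈ frontier U, z ∈ K := by
    intro z hz
    by_contra hzK
    have hzc : z ∈ closure U := hz.1
    have hzU : z ∈ U := by
      have ho : IsOpen (connectedComponentIn Kᶜ z) := hK.isClosed.isOpen_compl.connectedComponentIn
      obtain ⟨w, hw1, hw2⟩ := mem_closure_iff.1 hzc _ ho (mem_connectedComponentIn hzK)
      rw [hU, connectedComponentIn_eq hw2, ← connectedComponentIn_eq hw1]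
      exact mem_connectedComponentIn hzK
    exact hz.2 (by rwa [hUo.interior_eq])
  obtain ⟨G, hG⟩ := ContinuousMap.exists_restrict_eq hK.isClosed
    (⟨K.domRestrict g, continuousOn_iff_continuous_domRestrict.1 hg⟩ : C(K, ℂ))
  have hG' : ∀ z ∈ K, G z = g z := fun z hz => congr($hG ⟨z, hz⟩)
  set h : ℂ → ℂ := (closure U).piecewise (fun z => Complex.exp (G z) * (z - b)) (fun z => z - a)
    with hh
  have hcont : Continuous h := by
    apply continuous_piecewise
    · intro z hz
      have hzK : z ∈ K := hfr z (frontier_closure_subset hz)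
      have hzb : z - b ≠ 0 := sub_ne_zero.2 (fun h => hb (h ▸ hzK))
      rw [hG' z hzK, hexp z hzK, div_mul_cancel₀ _ hzb]
    · fun_prop
    · fun_prop
  have hne : ∀ z, h z ≠ 0 := by
    intro z
    by_cases hz : z ∈ closure U
    · rw [hh, piecewise_eq_of_mem _ _ _ hz]
      refine mul_ne_zero (Complex.exp_ne_zero _) (sub_ne_zero.2 ?_)
      rintro rfl
      by_cases hzU : z ∈ U
      · exact hbU hzU
      · exact hb (hfr z ⟨hz, by rwa [hUo.interior_eq]⟩)
    · rw [hh, piecewise_eq_of_notMem _ _ _ hz]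
      refine sub_ne_zero.2 ?_
      rintro rfl
      exact hz (subset_closure haU)
  obtain ⟨L, hL, hLe⟩ := exists_continuous_log hcont hne
  obtain ⟨R, hR0, hR⟩ := hbd.closure.subset_ball_lt 0 a
  refine not_exists_log_sub_on_circle hR0 hL.continuousOn (a := a) ?_
  intro z hz
  rw [hLe, hh, piecewise_eq_of_notMem]
  intro hz'
  have h1 := hR hz'
  simp only [Metric.mem_ball, Metric.mem_sphere] at h1 hz
  linarith

/-- `(z - a) / (z - b)` has a logarithm on every set that misses the segment `[a, b]`. -/
theorem exists_log_of_disjoint_segment {K : Set ℂ} {a b : ℂ} (h : Disjoint K (segment ℝ a b)) :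
    ∃ g : ℂ → ℂ, ContinuousOn g K ∧ ∀ z ∈ K, Complex.exp (g z) = (z - a) / (z - b) := by
  have hb : ∀ z ∈ K, z - b ≠ 0 := by
    intro z hz h0
    rw [sub_eq_zero.1 h0] at hz
    exact disjoint_left.1 h hz (right_mem_segment ℝ a b)
  have ha : ∀ z ∈ K, z - a ≠ 0 := by
    intro z hz h0
    rw [sub_eq_zero.1 h0] at hz
    exact disjoint_left.1 h hz (left_mem_segment ℝ a b)
  refine ⟨fun z => Complex.log ((z - a) / (z - b)), ?_, fun z hz =>
    Complex.exp_log (div_ne_zero (ha z hz) (hb z hz))⟩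
  refine ContinuousOn.clog (ContinuousOn.div (by fun_prop) (by fun_prop) hb) ?_
  intro z hz
  by_contra hs
  rw [Complex.mem_slitPlane_iff, not_or, not_lt, not_not] at hs
  obtain ⟨hre, him⟩ := hs
  -- a nonpositive ratio `-r` puts `z` at the point `(a + r b) / (1 + r)` of the segment
  set r : ℝ := -((z - a) / (z - b)).re with hr
  have hr0 : 0 ≤ r := by linarith
  have hq : (z - a) / (z - b) = ((-r : ℝ) : ℂ) := by
    apply Complex.ext <;> simp [hr, him]
  have hz1 : z - a = -r * (z - b) := by
    rw [div_eq_iff (hb z hz)] at hq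
    rw [hq]; push_cast; ring
  have h1r : (1 + (r : ℂ)) ≠ 0 := by
    have : (1 + r : ℝ) ≠ 0 := by positivity
    exact_mod_cast this
  refine disjoint_left.1 h hz ⟨1 / (1 + r), r / (1 + r), by positivity, by positivity, ?_, ?_⟩
  · field_simp
  · simp only [Complex.real_smul]
    push_cast
    field_simp
    linear_combination -hz1

/-- A logarithm of `(z - a) / (z - b)` on a compact set extends to an arc which is attached to that
set at one end. -/
theorem exists_log_attach_arc {K : Set ℂ} (hK : IsCompact K) {a b : ℂ} {g : ℂ → ℂ}
    (hg : ContinuousOn g K) (hexp : ∀ z ∈ K, Complex.exp (g z) = (z - a) / (z - b))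
    {σ : ℝ → ℂ} {t₀ t₁ : ℝ} (ht : t₀ ≤ t₁) (hσ : ContinuousOn σ (Icc t₀ t₁))
    (hinj : InjOn σ (Icc t₀ t₁)) (h0 : σ t₀ ∈ K) (hσK : ∀ t ∈ Ioc t₀ t₁, σ t ∉ K)
    (ha : ∀ t ∈ Icc t₀ t₁, σ t ≠ a) (hb : ∀ t ∈ Icc t₀ t₁, σ t ≠ b) :
    ∃ g' : ℂ → ℂ, ContinuousOn g' (K ∪ σ '' Icc t₀ t₁) ∧
      ∀ z ∈ K ∪ σ '' Icc t₀ t₁, Complex.exp (g' z) = (z - a) / (z - b) := by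
  classical
  set σ' : ℝ → ℂ := IccExtend ht ((Icc t₀ t₁).domRestrict σ) with hσ'
  have hσ'c : Continuous σ' := (continuousOn_iff_continuous_domRestrict.1 hσ).Icc_extend'
  have hσ'e : ∀ t ∈ Icc t₀ t₁, σ' t = σ t := fun t ht' => by
    rw [hσ', IccExtend_of_mem _ _ ht']; rfl
  have hσ'r : ∀ t, ∃ s ∈ Icc t₀ t₁, σ' t = σ s := fun t =>
    ⟨projIcc t₀ t₁ ht t, (projIcc t₀ t₁ ht t).2, rfl⟩
  have hne : ∀ t, σ' t - a ≠ 0 ∧ σ' t - b ≠ 0 := by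
    intro t
    obtain ⟨s, hs, he⟩ := hσ'r t
    rw [he]
    exact ⟨sub_ne_zero.2 (ha s hs), sub_ne_zero.2 (hb s hs)⟩
  obtain ⟨L, hL, hLe⟩ := exists_continuous_log (h := fun t => (σ' t - a) / (σ' t - b))
    (Continuous.div (by fun_prop) (by fun_prop) fun t => (hne t).2)
    (fun t => div_ne_zero (hne t).1 (hne t).2)
  -- shift the logarithm along the arc so that it agrees with `g` at the foot
  set L' : ℝ → ℂ := fun t => L t + (g (σ t₀) - L t₀) with hL'
  have ht₀ : t₀ ∈ Icc t₀ t₁ := left_mem_Icc.2 ht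
  have hL'e : ∀ t ∈ Icc t₀ t₁, Complex.exp (L' t) = (σ t - a) / (σ t - b) := by
    intro t ht'
    rw [hL', Complex.exp_add, hLe, Complex.exp_sub, hexp _ h0, hLe, hσ'e t ht', hσ'e t₀ ht₀,
      div_self, mul_one]
    have := hne t₀
    rw [hσ'e t₀ ht₀] at this
    exact div_ne_zero this.1 this.2
  have hAc : IsCompact (σ '' Icc t₀ t₁) := isCompact_Icc.image_of_continuousOn hσ
  have hinv : ∀ t ∈ Icc t₀ t₁, Function.invFunOn σ (Icc t₀ t₁) (σ t) = t :=
    fun t ht' => hinj.leftInvOn_invFunOn ht'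
  -- the arc is a homeomorphic image of the interval, so its logarithm descends to the plane
  set gA : ℂ → ℂ := fun z => L' (Function.invFunOn σ (Icc t₀ t₁) z) with hgA
  have hgAσ : ∀ t ∈ Icc t₀ t₁, gA (σ t) = L' t := fun t ht' => by rw [hgA]; simp only [hinv t ht']
  have hgAc : ContinuousOn gA (σ '' Icc t₀ t₁) := by
    have : ContinuousOn (Function.invFunOn σ (Icc t₀ t₁)) (σ '' Icc t₀ t₁) := by
      rw [continuousOn_iff_isClosed]
      intro F hF
      refine ⟨σ '' (Icc t₀ t₁ ∩ F), ?_, ?_⟩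
      · exact ((isCompact_Icc.inter_right hF).image_of_continuousOn
          (hσ.mono inter_subset_left)).isClosed
      · ext z
        constructor
        · rintro ⟨hz, t, ht', rfl⟩
          exact ⟨⟨t, ⟨ht', by simpa [hinv t ht'] using hz⟩, rfl⟩, ⟨t, ht', rfl⟩⟩
        · rintro ⟨⟨t, ht', rfl⟩, -⟩
          exact ⟨by simpa [hinv t ht'.1] using ht'.2, ⟨t, ht'.1, rfl⟩⟩
    exact (by fun_prop : Continuous L').comp_continuousOn this
  set g' : ℂ → ℂ := K.piecewise g gA with hg'
  have hg'K : EqOn g' g K := piecewise_eqOn _ _ _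
  have hg'A : EqOn g' gA (σ '' Icc t₀ t₁) := by
    rintro _ ⟨t, ht', rfl⟩
    rcases eq_or_lt_of_le ht'.1 with rfl | hlt
    · rw [hg'K h0, hgAσ _ ht']; simp [hL']
    · exact piecewise_eq_of_notMem _ _ _ (hσK t ⟨hlt, ht'.2⟩)
  refine ⟨g', ?_, ?_⟩
  · exact (hg.congr hg'K).union_of_isClosed (hgAc.congr hg'A) hK.isClosed hAc.isClosed
  · rintro z (hz | hz)
    · rw [hg'K hz, hexp z hz]
    · obtain ⟨t, ht', rfl⟩ := hz
      rw [hg'A ⟨t, ht', rfl⟩, hgAσ t ht', hL'e t ht']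

/-- A path crossing a region from left to right meets every path crossing it from bottom to top. -/
theorem exists_eq_of_crossing {α β : ℝ → ℂ} (hα : ContinuousOn α (Icc 0 1))
    (hβ : ContinuousOn β (Icc 0 1))
    (hl : ∀ s ∈ Icc (0 : ℝ) 1, (β 0).re ≤ (α s).re) (hr : ∀ s ∈ Icc (0 : ℝ) 1, (α s).re ≤ (β 1).re)
    (hb : ∀ s ∈ Icc (0 : ℝ) 1, (α 0).im ≤ (β s).im)
    (ht : ∀ s ∈ Icc (0 : ℝ) 1, (β s).im ≤ (α 1).im) :
    ∃ s ∈ Icc (0 : ℝ) 1, ∃ t ∈ Icc (0 : ℝ) 1, α s = β t := by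
  -- otherwise `α s - β t` has a continuous logarithm on the square, although its argument grows by
  -- `2 π` along the boundary
  by_contra! hne
  set p : ℝ → ℝ := fun s => projIcc (0 : ℝ) 1 zero_le_one s with hp
  have hpc : Continuous p := continuous_subtype_val.comp continuous_projIcc
  have hpm : ∀ s, p s ∈ Icc (0 : ℝ) 1 := fun s => (projIcc (0 : ℝ) 1 zero_le_one s).2
  have hpe : ∀ s ∈ Icc (0 : ℝ) 1, p s = s := fun s hs => by
    rw [hp]; simp only [projIcc_of_mem _ hs]
  have hα' : Continuous fun x : ℝ × ℝ => α (p x.1) :=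
    hα.comp_continuous (hpc.comp continuous_fst) fun x => hpm _
  have hβ' : Continuous fun x : ℝ × ℝ => β (p x.2) :=
    hβ.comp_continuous (hpc.comp continuous_snd) fun x => hpm _
  obtain ⟨L, hL, hLe⟩ := exists_continuous_log (h := fun x : ℝ × ℝ => α (p x.1) - β (p x.2))
    (hα'.sub hβ') (fun x => sub_ne_zero.2 (hne _ (hpm _) _ (hpm _)))
  have h0 : (0 : ℝ) ∈ Icc (0 : ℝ) 1 := by simp
  have h1 : (1 : ℝ) ∈ Icc (0 : ℝ) 1 := by simp
  have hval : ∀ s ∈ Icc (0 : ℝ) 1, ∀ t ∈ Icc (0 : ℝ) 1, Complex.exp (L (s, t)) = α s - β t := by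
    intro s hs t ht'
    rw [hLe]; simp only [hpe s hs, hpe t ht']
  -- on each side of the square the difference stays in a half-plane, where a rotated principal
  -- branch is available; `w` is a unit rotating this half-plane onto the right half-plane
  have side : ∀ (w : ℂ) (u : ℝ → ℝ × ℝ), w ≠ 0 → Continuous u →
      (∀ s ∈ Icc (0 : ℝ) 1, Complex.exp (L (u s)) * w ∈ Complex.slitPlane) →
      L (u 1) - L (u 0) = Complex.log (Complex.exp (L (u 1)) * w)
        - Complex.log (Complex.exp (L (u 0)) * w) := by
    intro w u hw hu hs
    obtain ⟨c, -, hc⟩ := exists_sub_eq_of_exp_eq (S := Icc (0 : ℝ) 1) isPreconnected_Icc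
      (u := fun s => L (u s) + Complex.log w)
      (v := fun s => Complex.log (Complex.exp (L (u s)) * w))
      (by fun_prop) (ContinuousOn.clog (by fun_prop) hs) (by
        intro s _
        rw [Complex.exp_add, Complex.exp_log hw,
          Complex.exp_log (mul_ne_zero (Complex.exp_ne_zero _) hw)])
    have e0 := hc 0 h0
    have e1 := hc 1 h1
    linear_combination e1 - e0
  have slit : ∀ z : ℂ, z ≠ 0 → 0 ≤ z.re → z ∈ Complex.slitPlane := by
    intro z hz hre
    rw [Complex.mem_slitPlane_iff]
    rcases hre.lt_or_eq with h | h
    · exact Or.inl h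
    · exact Or.inr fun him => hz (Complex.ext h.symm him)
  have hsub : ∀ s ∈ Icc (0 : ℝ) 1, ∀ t ∈ Icc (0 : ℝ) 1, α s - β t ≠ 0 := fun s hs t ht' =>
    sub_ne_zero.2 (hne s hs t ht')
  have sl : ∀ s ∈ Icc (0 : ℝ) 1, ∀ t ∈ Icc (0 : ℝ) 1, ∀ w : ℂ, w ≠ 0 →
      0 ≤ ((α s - β t) * w).re → Complex.exp (L (s, t)) * w ∈ Complex.slitPlane := by
    intro s hs t ht' w hw h
    rw [hval s hs t ht']
    exact slit _ (mul_ne_zero (hsub s hs t ht') hw) h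
  have eb := side Complex.I (fun t => (0, t)) Complex.I_ne_zero (by fun_prop) (by
    intro t ht'
    refine sl 0 h0 t ht' _ Complex.I_ne_zero ?_
    have := hb t ht'
    simp; linarith)
  have et := side (-Complex.I) (fun t => (1, t)) (by simp) (by fun_prop) (by
    intro t ht'
    refine sl 1 h1 t ht' _ (by simp) ?_
    have := ht t ht'
    simp; linarith)
  have el := side 1 (fun s => (s, 0)) one_ne_zero (by fun_prop) (by
    intro s hs
    refine sl s hs 0 h0 _ (by simp) ?_
    have := hl s hs
    simp; linarith)
  have er := side (-1) (fun s => (s, 1)) (by simp) (by fun_prop) (by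
    intro s hs
    refine sl s hs 1 h1 _ (by simp) ?_
    have := hr s hs
    simp; linarith)
  simp only [hval 0 h0 0 h0, hval 0 h0 1 h1, hval 1 h1 0 h0, hval 1 h1 1 h1] at eb et el er
  -- the corners: the argument of each corner value, computed by the two adjacent branches
  have corner : ∀ z : ℂ, z ≠ 0 → 0 ≤ z.re → 0 ≤ z.im →
      Complex.log z = Complex.log (z * -Complex.I) + Real.pi / 2 * Complex.I := by
    intro z hz hre him
    have harg : Complex.arg (z * -Complex.I) = Complex.arg z - Real.pi / 2 := by
      have h1 := Complex.arg_nonneg_iff.2 him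
      have h2 := Complex.abs_arg_le_pi_div_two_iff.2 hre
      have h3 := abs_le.1 h2
      have : z * -Complex.I = ‖z‖ * (Complex.cos ((Complex.arg z - Real.pi / 2 : ℝ))
          + Complex.sin ((Complex.arg z - Real.pi / 2 : ℝ)) * Complex.I) := by
        have e : (‖z‖ : ℂ) * Complex.exp (Complex.arg z * Complex.I) = z :=
          Complex.norm_mul_exp_arg_mul_I z
        rw [← Complex.exp_mul_I]
        push_cast
        rw [sub_mul, Complex.exp_sub, mul_div_assoc', e, Complex.exp_pi_div_two_mul_I]
        field_simp
        simp
      rw [this, Complex.arg_mul_cos_add_sin_mul_I (norm_pos_iff.2 hz)]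
      constructor <;> linarith [Real.pi_pos]
    rw [Complex.log, Complex.log, harg]
    simp
    ring
  have c00 := corner ((α 0 - β 0) * Complex.I) (mul_ne_zero (hsub 0 h0 0 h0) Complex.I_ne_zero)
    (by have := hb 0 h0; simp; linarith) (by have := hl 0 h0; simp; linarith)
  have c10 := corner (α 1 - β 0) (hsub 1 h1 0 h0)
    (by have := hl 1 h1; simp; linarith) (by have := ht 0 h0; simp; linarith)
  have c11 := corner ((α 1 - β 1) * -Complex.I) (mul_ne_zero (hsub 1 h1 1 h1) (by simp))
    (by have := ht 1 h1; simp; linarith) (by have := hr 1 h1; simp; linarith)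
  have c01 := corner ((α 0 - β 1) * -1) (mul_ne_zero (hsub 0 h0 1 h1) (by simp))
    (by have := hr 0 h0; simp; linarith) (by have := hb 1 h1; simp; linarith)
  simp only [mul_assoc, mul_neg, Complex.I_mul_I, neg_neg, neg_mul, mul_one] at c00 c10 c11 c01 eb et el er
  have : (2 * Real.pi : ℂ) * Complex.I = 0 := by
    linear_combination -(c00 + c10 + c11 + c01 + el + et - er - eb)
  simp [Real.pi_ne_zero] at this

end AnnulusLoewner

/-! ### Slits of the strip -/

namespace AnnulusLoewner

/-- The strip `{0 < Im w < π}`, the image of the upper half-plane under the logarithm. -/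
def strip : Set ℂ := {w | 0 < w.im ∧ w.im < Real.pi}

/-- A simple slit of the annulus, written in the logarithmic coordinate of the strip: a curve that
starts on the real axis (that is, on the positive part of the border), stays in the strip
afterwards, and is injective modulo the period `τ₀`. -/
structure IsLogSlit (τ₀ T : ℝ) (l : ℝ → ℂ) : Prop where
  continuousOn : ContinuousOn l (Icc 0 T)
  start_im : (l 0).im = 0
  mem_strip : ∀ u ∈ Ioc 0 T, l u ∈ strip
  inj : ∀ u ∈ Icc 0 T, ∀ v ∈ Icc 0 T, ∀ k : ℤ, l u = l v + k * τ₀ → u = v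

/-- The strip minus all translates of the slit `l (0, t]` by multiples of the period. -/
def logDomain (τ₀ : ℝ) (l : ℝ → ℂ) (t : ℝ) : Set ℂ :=
  {w | w ∈ strip ∧ ∀ k : ℤ, ∀ u ∈ Ioc 0 t, w ≠ l u + k * τ₀}

theorem isOpen_strip : IsOpen strip :=
  (isOpen_lt continuous_const Complex.continuous_im).inter
    (isOpen_lt Complex.continuous_im continuous_const)

theorem convex_strip : Convex ℝ strip := by
  have h1 : Convex ℝ {w : ℂ | 0 < w.im} := convex_halfSpace_im_gt 0
  have h2 : Convex ℝ {w : ℂ | w.im < Real.pi} := convex_halfSpace_im_lt _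
  exact h1.inter h2

theorem logDomain_subset_strip {τ₀ : ℝ} {l : ℝ → ℂ} {t : ℝ} : logDomain τ₀ l t ⊆ strip :=
  fun _ h => h.1

theorem logDomain_anti {τ₀ : ℝ} {l : ℝ → ℂ} {s t : ℝ} (h : s ≤ t) :
    logDomain τ₀ l t ⊆ logDomain τ₀ l s :=
  fun _ hw => ⟨hw.1, fun k u hu => hw.2 k u ⟨hu.1, hu.2.trans h⟩⟩

theorem add_mem_logDomain {τ₀ : ℝ} {l : ℝ → ℂ} {t : ℝ} {w : ℂ} (hw : w ∈ logDomain τ₀ l t)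
    (n : ℤ) : w + n * τ₀ ∈ logDomain τ₀ l t := by
  have him : ∀ n : ℤ, (w + n * τ₀).im = w.im := by
    intro n; simp
  refine ⟨by simpa [strip, him] using hw.1, fun k u hu h => hw.2 (k - n) u hu ?_⟩
  push_cast
  linear_combination h

namespace IsLogSlit

variable {τ₀ T : ℝ} {l : ℝ → ℂ}

theorem injOn (hl : IsLogSlit τ₀ T l) : InjOn l (Icc 0 T) :=
  fun u hu v hv h => hl.inj u hu v hv 0 (by simpa using h)

theorem im_nonneg (hl : IsLogSlit τ₀ T l) {u : ℝ} (hu : u ∈ Icc 0 T) : 0 ≤ (l u).im := by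
  rcases hu.1.eq_or_lt with rfl | h
  · exact hl.start_im.ge
  · exact (hl.mem_strip u ⟨h, hu.2⟩).1.le

theorem exists_abs_re_le (hl : IsLogSlit τ₀ T l) : ∃ m, 0 ≤ m ∧ ∀ u ∈ Icc 0 T, |(l u).re| ≤ m := by
  obtain ⟨m, hm⟩ := (isCompact_Icc.image_of_continuousOn hl.continuousOn).isBounded.exists_norm_le
  refine ⟨max m 0, le_max_right _ _, fun u hu => ?_⟩
  exact ((Complex.abs_re_le_norm _).trans (hm _ ⟨u, hu, rfl⟩)).trans (le_max_left _ _)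

theorem exists_im_le (hl : IsLogSlit τ₀ T l) (hT : 0 ≤ T) :
    ∃ h, 0 ≤ h ∧ h < Real.pi ∧ ∀ u ∈ Icc 0 T, (l u).im ≤ h := by
  obtain ⟨u, hu, hmax⟩ := isCompact_Icc.exists_isMaxOn (nonempty_Icc.2 hT)
    (Complex.continuous_im.comp_continuousOn hl.continuousOn)
  refine ⟨(l u).im, hl.im_nonneg hu, ?_, fun v hv => hmax hv⟩
  rcases hu.1.eq_or_lt with rfl | h
  · rw [hl.start_im]; exact Real.pi_pos
  · exact (hl.mem_strip u ⟨h, hu.2⟩).2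

/-- Any family of integer translates of the slit is closed, since it is locally finite. -/
theorem isClosed_translates (hl : IsLogSlit τ₀ T l) (hτ : 0 < τ₀) {t : ℝ} (ht : t ≤ T)
    (I : Set ℤ) : IsClosed {w | ∃ k ∈ I, ∃ u ∈ Icc 0 t, w = l u + k * τ₀} := by
  have hlt : ContinuousOn l (Icc 0 t) := hl.continuousOn.mono (Icc_subset_Icc_right ht)
  have he : {w | ∃ k ∈ I, ∃ u ∈ Icc 0 t, w = l u + k * τ₀} =
      ⋃ k : I, (fun u => l u + ((k : ℤ) : ℂ) * τ₀) '' Icc 0 t := by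
    ext w
    simp [eq_comm]
  rw [he]
  refine LocallyFinite.isClosed_iUnion ?_ fun k =>
    (isCompact_Icc.image_of_continuousOn (hlt.add continuousOn_const)).isClosed
  obtain ⟨m, -, hm⟩ := hl.exists_abs_re_le
  intro x
  refine ⟨Metric.ball x 1, Metric.ball_mem_nhds x one_pos, ?_⟩
  have hfin : (Icc (⌊(x.re - 1 - m) / τ₀⌋) (⌈(x.re + 1 + m) / τ₀⌉) : Set ℤ).Finite :=
    Set.finite_Icc _ _
  refine (hfin.preimage Subtype.val_injective.injOn).subset ?_
  rintro ⟨k, hk⟩ ⟨_, ⟨u, hu, rfl⟩, hux⟩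
  have h1 : |(l u + k * τ₀ - x).re| < 1 :=
    (Complex.abs_re_le_norm _).trans_lt (by simpa [dist_eq_norm] using hux)
  have h2 := abs_le.1 (hm u ⟨hu.1, hu.2.trans ht⟩)
  have h3 := abs_lt.1 h1
  simp at h3
  constructor
  · refine Int.cast_le (R := ℝ).1 ((Int.floor_le _).trans ?_)
    rw [div_le_iff₀ hτ]; linarith
  · refine Int.cast_le (R := ℝ).1 (le_trans ?_ (Int.le_ceil _))
    rw [le_div_iff₀ hτ]; linarith

/-- Adding the foot of the slit, which lies on the boundary of the strip, to the deleted set does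
not change the domain. -/
theorem logDomain_eq (hl : IsLogSlit τ₀ T l) {t : ℝ} :
    logDomain τ₀ l t = strip ∩ {w | ∃ k ∈ (univ : Set ℤ), ∃ u ∈ Icc 0 t, w = l u + k * τ₀}ᶜ := by
  ext w
  constructor
  · rintro ⟨h1, h2⟩
    refine ⟨h1, ?_⟩
    rintro ⟨k, -, u, hu, rfl⟩
    rcases hu.1.eq_or_lt with rfl | h
    · have := h1.1
      simp [hl.start_im] at this
    · exact h2 k u ⟨h, hu.2⟩ rfl
  · rintro ⟨h1, h2⟩
    exact ⟨h1, fun k u hu h => h2 ⟨k, mem_univ _, u, Ioc_subset_Icc_self hu, h⟩⟩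

theorem ne_of_mem_logDomain (hl : IsLogSlit τ₀ T l) {t : ℝ} {w : ℂ} (hw : w ∈ logDomain τ₀ l t)
    {u : ℝ} (hu : u ∈ Icc 0 t) (k : ℤ) : l u + k * τ₀ ≠ w := by
  rw [hl.logDomain_eq] at hw
  exact fun h => hw.2 ⟨k, mem_univ _, u, hu, h.symm⟩

theorem isOpen_logDomain (hl : IsLogSlit τ₀ T l) (hτ : 0 < τ₀) {t : ℝ} (ht : t ≤ T) :
    IsOpen (logDomain τ₀ l t) := by
  rw [hl.logDomain_eq]
  exact isOpen_strip.inter (hl.isClosed_translates hτ ht univ).isOpen_compl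

/-- The slit domain is locally connected at the tip of the slit: an arc does not separate nearby
points close to its tip. -/
theorem joinedIn_near_tip (hl : IsLogSlit τ₀ T l) (hτ : 0 < τ₀) {t : ℝ} (ht : t ∈ Ioc 0 T)
    {r : ℝ} (hr : 0 < r) :
    ∃ δ > 0, ∀ a ∈ logDomain τ₀ l t ∩ Metric.ball (l t) δ,
      ∀ b ∈ logDomain τ₀ l t ∩ Metric.ball (l t) δ,
        JoinedIn (logDomain τ₀ l t ∩ Metric.ball (l t) r) a b := by
  set p := l t with hp
  have htI : t ∈ Icc 0 T := Ioc_subset_Icc_self ht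
  have hsub : Icc 0 t ⊆ Icc 0 T := Icc_subset_Icc_right ht.2
  have hlt : ContinuousOn l (Icc 0 t) := hl.continuousOn.mono hsub
  -- a small ball about the tip lies in the strip and misses all other translates of the slit
  have hO : IsOpen (strip ∩ {w | ∃ k ∈ ({0}ᶜ : Set ℤ), ∃ u ∈ Icc 0 t, w = l u + k * τ₀}ᶜ) :=
    isOpen_strip.inter (hl.isClosed_translates hτ ht.2 _).isOpen_compl
  have hpO : p ∈ strip ∩ {w | ∃ k ∈ ({0}ᶜ : Set ℤ), ∃ u ∈ Icc 0 t, w = l u + k * τ₀}ᶜ := by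
    refine ⟨hl.mem_strip t ht, ?_⟩
    rintro ⟨k, hk, u, hu, h⟩
    have hut := hl.inj t htI u (hsub hu) k h
    subst hut
    have : (k : ℂ) * τ₀ = 0 := by linear_combination -h
    simp [hτ.ne'] at this
    exact hk this
  obtain ⟨r₁, hr₁, hball⟩ := Metric.isOpen_iff.1 hO p hpO
  set r' := min r r₁ with hr'
  have hr'0 : 0 < r' := lt_min hr hr₁
  obtain ⟨t', ht'0, ht't, ht'b⟩ : ∃ t', 0 ≤ t' ∧ t' < t ∧ ∀ u ∈ Icc t' t, l u ∈ Metric.ball p r' := by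
    have hc := (hlt t (right_mem_Icc.2 ht.1.le)) (Metric.ball_mem_nhds p hr'0)
    rw [mem_map, mem_nhdsWithin] at hc
    obtain ⟨V, hV, htV, hVs⟩ := hc
    obtain ⟨ε, hε, hεV⟩ := Metric.isOpen_iff.1 hV t htV
    refine ⟨max 0 (t - ε / 2), le_max_left _ _, max_lt ht.1 (by linarith), fun u hu => ?_⟩
    refine hVs ⟨hεV ?_, (le_max_left _ _).trans hu.1, hu.2⟩
    rw [Metric.mem_ball, Real.dist_eq, abs_lt]
    have := (le_max_right 0 (t - ε / 2)).trans hu.1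
    constructor <;> linarith [hu.2]
  -- the last part of the arc, which stays in the ball, is attached to the rest and the sphere; the
  -- segment `[a, b]` is too short to meet the latter
  set K₁ := l '' Icc 0 t' ∪ Metric.sphere p r' with hK₁
  have hK₁c : IsCompact K₁ := (isCompact_Icc.image_of_continuousOn
    (hlt.mono (Icc_subset_Icc_right ht't.le))).union (isCompact_sphere _ _)
  have hout : ∀ u ∈ Ioc t' t, l u ∉ K₁ := by
    rintro u hu (⟨v, hv, hvu⟩ | hs)
    · have := hl.injOn ⟨hv.1, by linarith [hv.2, ht.2]⟩ ⟨by linarith [hu.1], hu.2.trans ht.2⟩ hvu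
      linarith [hv.2, hu.1]
    · have := ht'b u (Ioc_subset_Icc_self hu)
      rw [Metric.mem_ball] at this
      exact this.ne hs
  obtain ⟨δ₁, hδ₁, hδK⟩ := Metric.isOpen_iff.1 hK₁c.isClosed.isOpen_compl p
    (hout t ⟨ht't, le_rfl⟩)
  refine ⟨min δ₁ r', lt_min hδ₁ hr'0, ?_⟩
  rintro a ⟨haD, hab⟩ b ⟨hbD, hbb⟩
  have hseg : Disjoint K₁ (segment ℝ a b) := by
    rw [disjoint_comm, disjoint_left]
    intro z hz
    exact hδK (Metric.ball_subset_ball (min_le_left _ _)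
      ((convex_ball p (min δ₁ r')).segment_subset hab hbb hz))
  obtain ⟨g, hg, hge⟩ := exists_log_of_disjoint_segment hseg
  have hne : ∀ w ∈ logDomain τ₀ l t, ∀ u ∈ Icc 0 t, l u ≠ w := by
    intro w hw u hu
    simpa using hl.ne_of_mem_logDomain hw hu 0
  have hsub' : Icc t' t ⊆ Icc 0 t := Icc_subset_Icc_left ht'0
  obtain ⟨g', hg', hge'⟩ := exists_log_attach_arc hK₁c hg hge ht't.le (hlt.mono hsub')
    (hl.injOn.mono (hsub'.trans hsub)) (Or.inl ⟨t', ⟨ht'0, le_rfl⟩, rfl⟩) hout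
    (fun u hu => hne a haD u (hsub' hu)) (fun u hu => hne b hbD u (hsub' hu))
  set K := K₁ ∪ l '' Icc t' t with hK
  have hKc : IsCompact K := hK₁c.union (isCompact_Icc.image_of_continuousOn (hlt.mono hsub'))
  have hKsub : K ⊆ l '' Icc 0 t ∪ Metric.sphere p r' := by
    rintro z ((⟨u, hu, rfl⟩ | hs) | ⟨u, hu, rfl⟩)
    · exact Or.inl ⟨u, ⟨hu.1, hu.2.trans ht't.le⟩, rfl⟩
    · exact Or.inr hs
    · exact Or.inl ⟨u, hsub' hu, rfl⟩
  have hnotK : ∀ w ∈ logDomain τ₀ l t, w ∈ Metric.ball p (min δ₁ r') → w ∉ K := by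
    intro w hw hwb hwK
    rcases hKsub hwK with ⟨u, hu, rfl⟩ | hs
    · exact hne _ hw u hu rfl
    · have := Metric.ball_subset_ball (min_le_right δ₁ r') hwb
      rw [Metric.mem_ball] at this
      exact this.ne hs
  set V := connectedComponentIn Kᶜ a with hV
  have haK := hnotK a haD hab
  have haV : a ∈ V := mem_connectedComponentIn haK
  -- the sphere confines the component to the ball
  have hVball : V ⊆ Metric.ball p r' := by
    refine isPreconnected_connectedComponentIn.subset_left_of_subset_union Metric.isOpen_ball
      (Metric.isClosed_closedBall (x := p) (ε := r')).isOpen_compl ?_ ?_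
      ⟨a, haV, Metric.ball_subset_ball (min_le_right _ _) hab⟩
    · exact disjoint_left.2 fun z hz hz' => hz' (Metric.ball_subset_closedBall hz)
    · intro z hz
      have hzK : z ∉ K := connectedComponentIn_subset _ _ hz
      by_cases h : z ∈ Metric.ball p r'
      · exact Or.inl h
      · refine Or.inr fun h' => hzK (Or.inl (Or.inr ?_))
        rw [Metric.mem_ball, not_lt] at h
        exact le_antisymm h' h
  have hbV : b ∈ V := mem_connectedComponentIn_of_log hKc haK (hnotK b hbD hbb)
    (Metric.isBounded_ball.subset hVball) hg' hge'
  have hVo : IsOpen V := hKc.isClosed.isOpen_compl.connectedComponentIn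
  have hVpc : IsPathConnected V :=
    hVo.isConnected_iff_isPathConnected.1 (isConnected_connectedComponentIn_iff.2 haK)
  refine (hVpc.joinedIn a haV b hbV).mono fun z hz => ⟨?_, ?_⟩
  · have hz1 := hball (Metric.ball_subset_ball (min_le_right r r₁) (hVball hz))
    refine ⟨hz1.1, fun k u hu h => ?_⟩
    by_cases hk : k = 0
    · subst hk
      have hzK : z ∉ K := connectedComponentIn_subset _ _ hz
      simp only [Int.cast_zero, zero_mul, add_zero] at h
      rcases le_total u t' with hu' | hu'
      · exact hzK (Or.inl (Or.inl ⟨u, ⟨hu.1.le, hu'⟩, h.symm⟩))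
      · exact hzK (Or.inr ⟨u, ⟨hu', hu.2⟩, h.symm⟩)
    · exact hz1.2 ⟨k, hk, u, Ioc_subset_Icc_self hu, h⟩
  · exact Metric.ball_subset_ball (min_le_left r r₁) (hVball hz)

/-- Every point of the slit domain can be joined, over a bounded horizontal range, to the part of
the strip above all slits: finitely many disjoint arcs attached to the boundary of a rectangle do
not separate points of the rectangle. -/
theorem joinedIn_vertical (hl : IsLogSlit τ₀ T l) (hτ : 0 < τ₀) {h : ℝ}
    (hh : ∀ u ∈ Icc 0 T, (l u).im ≤ h) {m : ℝ} (hm0 : 0 ≤ m) (hm : ∀ u ∈ Icc 0 T, |(l u).re| ≤ m)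
    {t : ℝ} (ht : t ∈ Icc 0 T) {a b : ℂ} (ha : a ∈ logDomain τ₀ l t) (hab : b.re = a.re)
    (hb : h < b.im) (hb0 : 0 < b.im) (hbπ : b.im < Real.pi) :
    JoinedIn (logDomain τ₀ l t ∩ {w | |w.re - a.re| < 2 * m + 2}) a b := by
  classical
  set x := a.re with hx
  set L := 2 * m + 2 with hL
  have hsub : Icc 0 t ⊆ Icc 0 T := Icc_subset_Icc_right ht.2
  have hlt : ContinuousOn l (Icc 0 t) := hl.continuousOn.mono hsub
  have hbD : b ∈ logDomain τ₀ l t := by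
    refine ⟨⟨hb0, hbπ⟩, fun k u hu he => ?_⟩
    have := hh u (hsub (Ioc_subset_Icc_self hu))
    rw [he] at hb
    simp at hb
    linarith
  set Bd : Set ℂ := {z | (|z.re - x| ≤ L ∧ 0 ≤ z.im ∧ z.im ≤ Real.pi) ∧
    (|z.re - x| = L ∨ z.im = 0 ∨ z.im = Real.pi)} with hBd
  set Rect : Set ℂ := {z | |z.re - x| ≤ L ∧ 0 ≤ z.im ∧ z.im ≤ Real.pi} with hRect
  have hcre : Continuous fun z : ℂ => |z.re - x| :=
    (Complex.continuous_re.sub continuous_const).abs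
  have hRectClosed : IsClosed Rect :=
    (isClosed_le hcre continuous_const).inter
      ((isClosed_le continuous_const Complex.continuous_im).inter
        (isClosed_le Complex.continuous_im continuous_const))
  have hRectB : Bornology.IsBounded Rect := by
    refine (Metric.isBounded_closedBall (x := (0 : ℂ)) (r := |x| + L + Real.pi)).subset ?_
    rintro z ⟨h1, h2, h3⟩
    rw [mem_closedBall_zero_iff]
    refine (Complex.norm_le_abs_re_add_abs_im z).trans ?_
    rw [abs_of_nonneg h2]
    have : |z.re| ≤ |z.re - x| + |x| := by
      simpa using abs_add_le (z.re - x) x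
    linarith
  have hRectC : IsCompact Rect := Metric.isCompact_of_isClosed_isBounded hRectClosed hRectB
  have hBdC : IsCompact Bd := by
    refine hRectC.inter_right ?_
    exact (isClosed_eq hcre continuous_const).union
      ((isClosed_eq Complex.continuous_im continuous_const).union
        (isClosed_eq Complex.continuous_im continuous_const))
  -- the slits that are far from the vertical line `Re = x`, and the boundary of the rectangle, do
  -- not meet the segment `[a, b]`
  set far : Set ℤ := {k | m + 1 < |k * τ₀ - x|} with hfar
  set K₁ := Bd ∪ Rect ∩ {w | ∃ k ∈ far, ∃ u ∈ Icc 0 t, w = l u + k * τ₀} with hK₁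
  have hK₁c : IsCompact K₁ :=
    hBdC.union (hRectC.inter_right (hl.isClosed_translates hτ ht.2 far))
  have hfarRe : ∀ k ∈ far, ∀ u ∈ Icc 0 t, 1 < |(l u + k * τ₀).re - x| := by
    intro k hk u hu
    have h1 := hm u (hsub hu)
    have h2 : |k * τ₀ - x| ≤ |(l u + k * τ₀).re - x| + |(l u).re| := by
      have := abs_sub ((l u + k * τ₀).re - x) (l u).re
      refine le_trans (le_of_eq ?_) this
      simp
      ring_nf
    have h3 : m + 1 < |k * τ₀ - x| := hk
    linarith
  have hseg : Disjoint K₁ (segment ℝ a b) := by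
    rw [disjoint_comm, disjoint_left]
    intro z hz hzK
    have hzre : z.re = x := by
      obtain ⟨c, d, -, -, hcd, rfl⟩ := hz
      simp only [Complex.add_re, Complex.smul_re, smul_eq_mul, hab, ← hx]
      rw [← add_mul, hcd, one_mul]
    have hzs : z ∈ strip := convex_strip.segment_subset ha.1 hbD.1 hz
    rcases hzK with ⟨-, h1 | h1 | h1⟩ | ⟨-, k, hk, u, hu, rfl⟩
    · rw [hzre, sub_self, abs_zero] at h1; linarith
    · exact hzs.1.ne' h1
    · exact hzs.2.ne h1
    · have := hfarRe k hk u hu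
      rw [hzre, sub_self, abs_zero] at this
      linarith
  have hmove : ∀ w ∈ logDomain τ₀ l t, ∀ k : ℤ, ∀ u ∈ Icc 0 t, l u + k * τ₀ ≠ w :=
    fun w hw k u hu => hl.ne_of_mem_logDomain hw hu k
  -- attach the near slits one after the other
  have step : ∀ F : Finset ℤ, (∀ k ∈ F, k ∉ far) → ∃ g : ℂ → ℂ,
      ContinuousOn g (K₁ ∪ {w | ∃ k ∈ F, ∃ u ∈ Icc 0 t, w = l u + k * τ₀}) ∧
      ∀ z ∈ K₁ ∪ {w | ∃ k ∈ F, ∃ u ∈ Icc 0 t, w = l u + k * τ₀},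
        Complex.exp (g z) = (z - a) / (z - b) := by
    intro F
    induction F using Finset.induction_on with
    | empty =>
      intro _
      simpa using exists_log_of_disjoint_segment hseg
    | insert n F hn ih =>
      intro hF
      obtain ⟨g, hg, hge⟩ := ih fun k hk => hF k (Finset.mem_insert_of_mem hk)
      have hKc : IsCompact (K₁ ∪ {w | ∃ k ∈ F, ∃ u ∈ Icc 0 t, w = l u + k * τ₀}) := by
        refine hK₁c.union ?_
        have he : {w | ∃ k ∈ F, ∃ u ∈ Icc 0 t, w = l u + k * τ₀} =
            ⋃ k ∈ F, (fun u => l u + (k : ℂ) * τ₀) '' Icc 0 t := by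
          ext w
          simp [eq_comm]
        rw [he]
        exact F.isCompact_biUnion fun k _ =>
          isCompact_Icc.image_of_continuousOn (hlt.add continuousOn_const)
      have hnear : |n * τ₀ - x| ≤ m + 1 := not_lt.1 (hF n (Finset.mem_insert_self _ _))
      have hnRe : ∀ u ∈ Icc 0 t, |(l u + n * τ₀).re - x| < L := by
        intro u hu
        have h1 := hm u (hsub hu)
        have h2 : (l u + n * τ₀).re - x = (l u).re + (n * τ₀ - x) := by simp; ring
        rw [h2]
        have := abs_add_le (l u).re (n * τ₀ - x)
        linarith
      have hsame : ∀ u ∈ Icc 0 t, ∀ v ∈ Icc 0 t, ∀ k : ℤ,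
          l u + n * τ₀ = l v + k * τ₀ → k = n := by
        intro u hu v hv k he
        have := hl.inj u (hsub hu) v (hsub hv) (k - n) (by push_cast; linear_combination he)
        subst this
        have h0 : ((k : ℂ) - n) * τ₀ = 0 := by linear_combination -he
        rw [mul_eq_zero] at h0
        rcases h0 with h0 | h0
        · exact_mod_cast sub_eq_zero.1 h0
        · exact absurd (by exact_mod_cast h0) hτ.ne'
      obtain ⟨g', hg', hge'⟩ := exists_log_attach_arc hKc hg hge ht.1
        (σ := fun u => l u + n * τ₀) (hlt.add continuousOn_const)
        (fun u hu v hv he => hl.injOn (hsub hu) (hsub hv) (add_right_cancel he))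
        (Or.inl (Or.inl ⟨⟨(hnRe 0 (left_mem_Icc.2 ht.1)).le, by simp [hl.start_im],
          by simp [hl.start_im, Real.pi_pos.le]⟩, Or.inr (Or.inl (by simp [hl.start_im]))⟩))
        (by
          intro u hu hmem
          have huI : u ∈ Icc 0 t := Ioc_subset_Icc_self hu
          have hus := hl.mem_strip u ⟨hu.1, hu.2.trans ht.2⟩
          have him : (l u + n * τ₀).im = (l u).im := by simp
          rcases hmem with (⟨-, h1 | h1 | h1⟩ | ⟨-, k, hk, v, hv, he⟩) | ⟨k, hk, v, hv, he⟩
          · exact (hnRe u huI).ne h1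
          · rw [him] at h1; exact hus.1.ne' h1
          · rw [him] at h1; exact hus.2.ne h1
          · rw [hsame u huI v hv k he] at hk
            exact hF n (Finset.mem_insert_self _ _) hk
          · rw [hsame u huI v hv k he] at hk
            exact hn hk)
        (fun u hu => hmove a ha n u hu) (fun u hu => hmove b hbD n u hu)
      have hunion : K₁ ∪ {w | ∃ k ∈ insert n F, ∃ u ∈ Icc 0 t, w = l u + k * τ₀} ⊆
          K₁ ∪ {w | ∃ k ∈ F, ∃ u ∈ Icc 0 t, w = l u + k * τ₀} ∪
            (fun u => l u + (n : ℂ) * τ₀) '' Icc 0 t := by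
        rintro z (hz | ⟨k, hk, u, hu, rfl⟩)
        · exact Or.inl (Or.inl hz)
        · rcases Finset.mem_insert.1 hk with rfl | hk
          · exact Or.inr ⟨u, hu, rfl⟩
          · exact Or.inl (Or.inr ⟨k, hk, u, hu, rfl⟩)
      exact ⟨g', hg'.mono hunion, fun z hz => hge' z (hunion hz)⟩
  have hnearfin : (farᶜ).Finite := by
    refine (Set.finite_Icc (⌊(x - (m + 1)) / τ₀⌋) (⌈(x + (m + 1)) / τ₀⌉)).subset ?_
    intro k hk
    have hk' : |k * τ₀ - x| ≤ m + 1 := not_lt.1 hk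
    have h3 := abs_le.1 hk'
    constructor
    · refine Int.cast_le (R := ℝ).1 ((Int.floor_le _).trans ?_)
      rw [div_le_iff₀ hτ]; linarith
    · refine Int.cast_le (R := ℝ).1 (le_trans ?_ (Int.le_ceil _))
      rw [le_div_iff₀ hτ]; linarith
  obtain ⟨g, hg, hge⟩ := step hnearfin.toFinset (by simp)
  set K := K₁ ∪ {w | ∃ k ∈ hnearfin.toFinset, ∃ u ∈ Icc 0 t, w = l u + k * τ₀} with hK
  have hKc : IsCompact K := by
    refine hK₁c.union ?_
    have he : {w | ∃ k ∈ hnearfin.toFinset, ∃ u ∈ Icc 0 t, w = l u + k * τ₀} =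
        ⋃ k ∈ hnearfin.toFinset, (fun u => l u + (k : ℂ) * τ₀) '' Icc 0 t := by
      ext w
      simp [eq_comm]
    rw [he]
    exact hnearfin.toFinset.isCompact_biUnion fun k _ =>
      isCompact_Icc.image_of_continuousOn (hlt.add continuousOn_const)
  have hnotK : ∀ w ∈ logDomain τ₀ l t, w.re = x → w ∉ K := by
    rintro w hw hwx ((⟨-, h1 | h1 | h1⟩ | ⟨-, k, -, u, hu, he⟩) | ⟨k, -, u, hu, he⟩)
    · rw [hwx, sub_self, abs_zero] at h1; linarith
    · exact hw.1.1.ne' h1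
    · exact hw.1.2.ne h1
    · exact hmove w hw k u hu he.symm
    · exact hmove w hw k u hu he.symm
  set V := connectedComponentIn Kᶜ a with hV
  have haK := hnotK a ha rfl
  have haV : a ∈ V := mem_connectedComponentIn haK
  have hopen : IsOpen {z : ℂ | |z.re - x| < L ∧ z ∈ strip} :=
    (isOpen_lt hcre continuous_const).inter isOpen_strip
  have hVrect : V ⊆ {z : ℂ | |z.re - x| < L ∧ z ∈ strip} := by
    refine isPreconnected_connectedComponentIn.subset_left_of_subset_union hopen
      hRectClosed.isOpen_compl ?_ ?_ ⟨a, haV, by rw [← hx, sub_self, abs_zero]; linarith, ha.1⟩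
    · exact disjoint_left.2 fun z hz hz' => hz' ⟨hz.1.le, hz.2.1.le, hz.2.2.le⟩
    · intro z hz
      have hzK : z ∉ K := connectedComponentIn_subset _ _ hz
      by_cases hzR : z ∈ Rect
      · refine Or.inl ⟨lt_of_le_of_ne hzR.1 fun h1 => ?_, lt_of_le_of_ne hzR.2.1 fun h1 => ?_,
          lt_of_le_of_ne hzR.2.2 fun h1 => ?_⟩
        · exact hzK (Or.inl (Or.inl ⟨hzR, Or.inl h1⟩))
        · exact hzK (Or.inl (Or.inl ⟨hzR, Or.inr (Or.inl h1.symm)⟩))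
        · exact hzK (Or.inl (Or.inl ⟨hzR, Or.inr (Or.inr h1)⟩))
      · exact Or.inr hzR
  have hVR : V ⊆ Rect := fun z hz =>
    ⟨(hVrect hz).1.le, (hVrect hz).2.1.le, (hVrect hz).2.2.le⟩
  have hbV : b ∈ V := mem_connectedComponentIn_of_log hKc haK (hnotK b hbD hab)
    (hRectB.subset hVR) hg hge
  have hVo : IsOpen V := hKc.isClosed.isOpen_compl.connectedComponentIn
  have hVpc : IsPathConnected V :=
    hVo.isConnected_iff_isPathConnected.1 (isConnected_connectedComponentIn_iff.2 haK)
  refine (hVpc.joinedIn a haV b hbV).mono fun z hz => ⟨⟨(hVrect hz).2, ?_⟩, (hVrect hz).1⟩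
  intro k u hu he
  have hzK : z ∉ K := connectedComponentIn_subset _ _ hz
  by_cases hk : k ∈ far
  · exact hzK (Or.inl (Or.inr ⟨hVR hz, k, hk, u, Ioc_subset_Icc_self hu, he⟩))
  · exact hzK (Or.inr ⟨k, by simpa using hk, u, Ioc_subset_Icc_self hu, he⟩)

/-- Two points of the slit domain can be joined without moving far out of the range of their real
parts. In particular the slit domain is locally connected at its two ends. -/
theorem exists_joinedIn_re (hl : IsLogSlit τ₀ T l) (hτ : 0 < τ₀) (hT : 0 ≤ T) :
    ∃ L > 0, ∀ t ∈ Icc 0 T, ∀ a ∈ logDomain τ₀ l t, ∀ b ∈ logDomain τ₀ l t,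
      JoinedIn (logDomain τ₀ l t ∩ {w | min a.re b.re - L < w.re ∧ w.re < max a.re b.re + L})
        a b := by
  obtain ⟨m, hm0, hm⟩ := hl.exists_abs_re_le
  obtain ⟨h, h0, hπ, hh⟩ := hl.exists_im_le hT
  refine ⟨2 * m + 2, by positivity, fun t ht a ha b hb => ?_⟩
  set y := (h + Real.pi) / 2 with hy
  set W := logDomain τ₀ l t ∩
    {w | min a.re b.re - (2 * m + 2) < w.re ∧ w.re < max a.re b.re + (2 * m + 2)} with hW
  have hup : ∀ c ∈ logDomain τ₀ l t, (min a.re b.re ≤ c.re ∧ c.re ≤ max a.re b.re) →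
      JoinedIn W c ⟨c.re, y⟩ := by
    intro c hc hcre
    refine (hl.joinedIn_vertical hτ hh hm0 hm ht hc (b := ⟨c.re, y⟩) rfl ?_ ?_ ?_).mono ?_
    · simp only; linarith
    · simp only; linarith
    · simp only; linarith
    · rintro z ⟨hz, hz'⟩
      have := abs_lt.1 (show |z.re - c.re| < 2 * m + 2 from hz')
      exact ⟨hz, by linarith, by linarith⟩
  have hmid : JoinedIn W ⟨a.re, y⟩ ⟨b.re, y⟩ := by
    refine JoinedIn.of_segment_subset ?_
    rintro z ⟨c, d, hc, hd, hcd, rfl⟩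
    have him : (c • (⟨a.re, y⟩ : ℂ) + d • (⟨b.re, y⟩ : ℂ)).im = y := by
      simp only [Complex.add_im, Complex.smul_im, smul_eq_mul]
      rw [← add_mul, hcd, one_mul]
    have hre : (c • (⟨a.re, y⟩ : ℂ) + d • (⟨b.re, y⟩ : ℂ)).re = c * a.re + d * b.re := by simp
    refine ⟨⟨⟨by rw [him]; linarith, by rw [him]; linarith⟩, fun k u hu he => ?_⟩, ?_⟩
    · have := hh u ⟨hu.1.le, hu.2.trans ht.2⟩
      rw [he] at him
      simp at him
      linarith
    · have h1 : min a.re b.re ≤ c * a.re + d * b.re := by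
        have e1 := mul_le_mul_of_nonneg_left (min_le_left a.re b.re) hc
        have e2 := mul_le_mul_of_nonneg_left (min_le_right a.re b.re) hd
        calc min a.re b.re = c * min a.re b.re + d * min a.re b.re := by rw [← add_mul, hcd, one_mul]
          _ ≤ _ := add_le_add e1 e2
      have h2 : c * a.re + d * b.re ≤ max a.re b.re := by
        have e1 := mul_le_mul_of_nonneg_left (le_max_left a.re b.re) hc
        have e2 := mul_le_mul_of_nonneg_left (le_max_right a.re b.re) hd
        calc _ ≤ c * max a.re b.re + d * max a.re b.re := add_le_add e1 e2
          _ = _ := by rw [← add_mul, hcd, one_mul]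
      rw [mem_ofPred_eq, hre]
      constructor <;> linarith
  exact ((hup a ha ⟨min_le_left _ _, le_max_left _ _⟩).trans hmid).trans
    (hup b hb ⟨min_le_right _ _, le_max_right _ _⟩).symm

end IsLogSlit
end AnnulusLoewner

/-! ### A two-constants estimate and Koebe's lemma -/

namespace AnnulusLoewner

/-- The frontier of a component of an open set lies outside this open set. -/
theorem disjoint_frontier_connectedComponentIn {O : Set ℂ} (hO : IsOpen O) (a : ℂ) :
    Disjoint (frontier (connectedComponentIn O a)) O := by
  rw [disjoint_left]
  intro z hz hzO
  have hUo : IsOpen (connectedComponentIn O a) := hO.connectedComponentIn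
  obtain ⟨w, hw1, hw2⟩ :=
    mem_closure_iff.1 hz.1 _ hO.connectedComponentIn (mem_connectedComponentIn hzO)
  refine hz.2 ?_
  rw [hUo.interior_eq, connectedComponentIn_eq hw2, ← connectedComponentIn_eq hw1]
  exact mem_connectedComponentIn hzO

/-- A two-constants estimate. If a bounded holomorphic function is small on a path that crosses a
box near its bottom side, then it is small at the centre of the box. The barrier is the harmonic
function `sin (c (x - a)) sinh (c (h - y))`, which vanishes on the two vertical sides and on top. -/
theorem norm_le_of_small_on_crossing {φ : ℂ → ℂ} (hφ : DifferentiableOn ℂ φ upperHalf) {M ε : ℝ}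
    (hM : ∀ z ∈ upperHalf, ‖φ z‖ ≤ M) (hε : 0 < ε) (hεM : ε ≤ M) {a b h : ℝ} (hab : a < b)
    (hh : 0 < h) {β : ℝ → ℂ} (hβ : ContinuousOn β (Icc 0 1))
    (hβim : ∀ s ∈ Icc (0 : ℝ) 1, 0 < (β s).im) (hβh : ∀ s ∈ Icc (0 : ℝ) 1, (β s).im ≤ h / 4)
    (hβε : ∀ s ∈ Icc (0 : ℝ) 1, ‖φ (β s)‖ ≤ ε) (hβ0 : (β 0).re ≤ a) (hβ1 : b ≤ (β 1).re) :
    ‖φ ⟨(a + b) / 2, h / 2⟩‖ ≤ M * (ε / M) ^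
      (Real.sinh (Real.pi / (b - a) * (h / 2)) / Real.sinh (Real.pi / (b - a) * h)) := by
  set c := Real.pi / (b - a) with hc
  have hba : 0 < b - a := sub_pos.2 hab
  have hc0 : 0 < c := div_pos Real.pi_pos hba
  have hM0 : 0 < M := hε.trans_le hεM
  have hsh : 0 < Real.sinh (c * h) := Real.sinh_pos_iff.2 (by positivity)
  -- this multiple of the barrier compensates the factor `M / ε` on the path
  set N := Real.log (M / ε) / Real.sinh (c * h) with hN
  have hN0 : 0 ≤ N := div_nonneg (Real.log_nonneg ((one_le_div hε).2 hεM)) hsh.le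
  set Ω : ℂ → ℂ := fun z => -Complex.I * Complex.cos (c * (z - (a + h * Complex.I))) with hΩ
  have hΩre : ∀ z : ℂ, (Ω z).re = Real.sin (c * (z.re - a)) * Real.sinh (c * (h - z.im)) := by
    intro z
    have e : (c : ℂ) * (z - (a + h * Complex.I)) =
        ((c * (z.re - a) : ℝ) : ℂ) + ((c * (z.im - h) : ℝ) : ℂ) * Complex.I := by
      apply Complex.ext <;> simp
    have e2 : c * (h - z.im) = -(c * (z.im - h)) := by ring
    rw [hΩ]
    simp only []
    rw [e, Complex.cos_add_mul_I, e2, Real.sinh_neg, ← Complex.ofReal_cos, ← Complex.ofReal_sin,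
      ← Complex.ofReal_cosh, ← Complex.ofReal_sinh]
    simp [-Complex.ofReal_mul, -Complex.ofReal_sub, -Complex.ofReal_cos, -Complex.ofReal_sin,
      -Complex.ofReal_cosh, -Complex.ofReal_sinh]
  set Φ : ℂ → ℂ := fun z => φ z * Complex.exp (N * Ω z) with hΦ
  have hΦn : ∀ z, ‖Φ z‖ = ‖φ z‖ * Real.exp (N * (Ω z).re) := by
    intro z
    rw [hΦ, norm_mul, Complex.norm_exp]
    simp
  set Q : Set ℂ := {z | (a < z.re ∧ z.re < b) ∧ 0 < z.im ∧ z.im < h} with hQ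
  have hQo : IsOpen Q :=
    ((isOpen_lt continuous_const Complex.continuous_re).inter
      (isOpen_lt Complex.continuous_re continuous_const)).inter
    ((isOpen_lt continuous_const Complex.continuous_im).inter
      (isOpen_lt Complex.continuous_im continuous_const))
  have hQcl : closure Q ⊆ {z | (a ≤ z.re ∧ z.re ≤ b) ∧ 0 ≤ z.im ∧ z.im ≤ h} := by
    refine closure_minimal (fun z hz => ⟨⟨hz.1.1.le, hz.1.2.le⟩, hz.2.1.le, hz.2.2.le⟩) ?_
    exact ((isClosed_le continuous_const Complex.continuous_re).inter
      (isClosed_le Complex.continuous_re continuous_const)).inter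
      ((isClosed_le continuous_const Complex.continuous_im).inter
      (isClosed_le Complex.continuous_im continuous_const))
  have hβc : IsCompact (β '' Icc 0 1) := isCompact_Icc.image_of_continuousOn hβ
  set O := Q ∩ (β '' Icc 0 1)ᶜ with hO
  have hOo : IsOpen O := hQo.inter hβc.isClosed.isOpen_compl
  set z₁ : ℂ := ⟨(a + b) / 2, h / 2⟩ with hz₁
  have hz₁O : z₁ ∈ O := by
    refine ⟨⟨⟨?_, ?_⟩, ?_, ?_⟩, ?_⟩
    · simp only [hz₁]; linarith
    · simp only [hz₁]; linarith
    · simp only [hz₁]; linarith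
    · simp only [hz₁]; linarith
    · rintro ⟨s, hs, he⟩
      have := hβh s hs
      rw [he] at this
      simp only [hz₁] at this
      linarith
  set V := connectedComponentIn O z₁ with hV
  have hVo : IsOpen V := hOo.connectedComponentIn
  have hVO : V ⊆ O := connectedComponentIn_subset _ _
  have hz₁V : z₁ ∈ V := mem_connectedComponentIn hz₁O
  have hVpc : IsPathConnected V :=
    hVo.isConnected_iff_isPathConnected.1 (isConnected_connectedComponentIn_iff.2 hz₁O)
  obtain ⟨s₀, hs₀, hmin⟩ := isCompact_Icc.exists_isMinOn (nonempty_Icc.2 zero_le_one)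
    (Complex.continuous_im.comp_continuousOn hβ)
  set η := (β s₀).im with hη
  have hη0 : 0 < η := hβim s₀ hs₀
  -- the path shields the component of the centre from the bottom side
  have hVη : ∀ z ∈ V, η ≤ z.im := by
    intro z hz
    by_contra! hlt
    obtain ⟨α, hα⟩ := hVpc.joinedIn z hz z₁ hz₁V
    have hαV : ∀ s ∈ Icc (0 : ℝ) 1, α.extend s ∈ V := fun s hs => by
      rw [α.extend_apply hs]
      exact hα _
    obtain ⟨s, hs, u, hu, he⟩ := exists_eq_of_crossing (α := α.extend) (β := β)
      α.continuous_extend.continuousOn hβ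
      (fun s hs => hβ0.trans (hVO (hαV s hs)).1.1.1.le)
      (fun s hs => (hVO (hαV s hs)).1.1.2.le.trans hβ1)
      (fun s hs => by rw [α.extend_zero]; exact hlt.le.trans (hmin hs))
      (fun s hs => by rw [α.extend_one]; exact (hβh s hs).trans (by simp only [hz₁]; linarith))
    exact (hVO (hαV s hs)).2 ⟨u, hu, he.symm⟩
  have hVcl : closure V ⊆ {z | η ≤ z.im} :=
    closure_minimal hVη (isClosed_le continuous_const Complex.continuous_im)
  have hVclQ : closure V ⊆ closure Q := closure_mono (hVO.trans inter_subset_left)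
  have hVb : Bornology.IsBounded V := by
    refine (Metric.isBounded_closedBall (x := (0 : ℂ)) (r := |a| + |b| + h)).subset ?_
    intro z hz
    obtain ⟨⟨h1, h2⟩, h3, h4⟩ := (hVO hz).1
    rw [mem_closedBall_zero_iff]
    refine (Complex.norm_le_abs_re_add_abs_im z).trans ?_
    rw [abs_of_nonneg h3.le]
    have : |z.re| ≤ |a| + |b| := by
      rw [abs_le]
      constructor
      · linarith [neg_abs_le a, abs_nonneg b]
      · linarith [le_abs_self b, abs_nonneg a]
    linarith
  have hΦd : DifferentiableOn ℂ Φ upperHalf := by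
    refine hφ.mul (DifferentiableOn.cexp ?_)
    have : Differentiable ℂ fun z => (N : ℂ) * Ω z := by
      rw [hΩ]
      fun_prop
    exact this.differentiableOn
  have hVH : closure V ⊆ upperHalf := fun z hz => hη0.trans_le (hVcl hz)
  have hbd : ∀ z ∈ frontier V, ‖Φ z‖ ≤ M := by
    intro z hz
    have hzcl : z ∈ closure V := frontier_subset_closure hz
    have hzM := hM z (hVH hzcl)
    obtain ⟨⟨h1, h2⟩, h3, h4⟩ := hQcl (hVclQ hzcl)
    have hzO : z ∉ O := disjoint_left.1 (disjoint_frontier_connectedComponentIn hOo z₁) hz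
    rw [hΦn, hΩre]
    by_cases hzβ : z ∈ β '' Icc 0 1
    · obtain ⟨s, hs, rfl⟩ := hzβ
      have hle : N * (Real.sin (c * ((β s).re - a)) * Real.sinh (c * (h - (β s).im))) ≤
          Real.log (M / ε) := by
        have e1 : Real.sinh (c * (h - (β s).im)) ≤ Real.sinh (c * h) := by
          rw [Real.sinh_le_sinh]
          exact mul_le_mul_of_nonneg_left (by linarith) hc0.le
        have e0 : 0 ≤ Real.sinh (c * (h - (β s).im)) :=
          Real.sinh_nonneg_iff.2 (mul_nonneg hc0.le (by linarith))
        calc _ ≤ N * Real.sinh (c * h) := by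
              refine mul_le_mul_of_nonneg_left ?_ hN0
              refine le_trans ?_ e1
              exact mul_le_of_le_one_left e0 (Real.sin_le_one _)
          _ = _ := by rw [hN, div_mul_cancel₀ _ hsh.ne']
      calc _ ≤ ε * Real.exp (Real.log (M / ε)) :=
            mul_le_mul (hβε s hs) (Real.exp_le_exp.2 hle) (Real.exp_pos _).le hε.le
        _ = M := by rw [Real.exp_log (by positivity)]; field_simp
    · have hzQ : z ∉ Q := fun h => hzO ⟨h, hzβ⟩
      have h3' : 0 < z.im := hVH hzcl
      have hz0 : Real.sin (c * (z.re - a)) * Real.sinh (c * (h - z.im)) = 0 := by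
        rcases h1.eq_or_lt with e | e
        · simp [← e]
        rcases h2.eq_or_lt with e' | e'
        · have : c * (b - a) = Real.pi := by rw [hc]; field_simp
          simp [e', this]
        rcases h4.eq_or_lt with e'' | e''
        · simp [e'']
        · exact absurd ⟨⟨e, e'⟩, h3', e''⟩ hzQ
      rw [hz0, mul_zero, Real.exp_zero, mul_one]
      exact hzM
  have hmax := Complex.norm_le_of_forall_mem_frontier_norm_le hVb
    (hΦd.mono hVH).diffContOnCl hbd (subset_closure hz₁V)
  rw [hΦn, hΩre] at hmax
  have e1 : c * (z₁.re - a) = Real.pi / 2 := by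
    simp only [hz₁, hc]; field_simp; ring
  have e2 : c * (h - z₁.im) = c * (h / 2) := by simp only [hz₁]; ring
  rw [e1, e2, Real.sin_pi_div_two, one_mul] at hmax
  have e3 : (ε / M) ^ (Real.sinh (c * (h / 2)) / Real.sinh (c * h)) =
      Real.exp (-(N * Real.sinh (c * (h / 2)))) := by
    rw [Real.rpow_def_of_pos (by positivity)]
    congr 1
    rw [hN, ← inv_div, Real.log_inv]
    ring
  rw [e3, Real.exp_neg, ← div_eq_mul_inv, le_div_iff₀ (Real.exp_pos _)]
  exact hmax

/-- **Koebe's lemma**: a bounded zero-free holomorphic function on the upper half-plane is not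
arbitrarily small on paths which lead from points close to a boundary point `x` to points at
distance `d` from `x`. -/
theorem exists_pos_forall_path_not_small {φ : ℂ → ℂ} (hφ : DifferentiableOn ℂ φ upperHalf) {M : ℝ}
    (hM : ∀ z ∈ upperHalf, ‖φ z‖ ≤ M) (h0 : ∀ z ∈ upperHalf, φ z ≠ 0) (x : ℝ) {d : ℝ}
    (hd : 0 < d) :
    ∃ ε > 0, ∀ β : ℝ → ℂ, ContinuousOn β (Icc 0 1) → (∀ s ∈ Icc (0 : ℝ) 1, 0 < (β s).im) →
      (∀ s ∈ Icc (0 : ℝ) 1, ‖φ (β s)‖ ≤ ε) → ‖β 0 - x‖ < d / 4 → ‖β 1 - x‖ < d := by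
  -- the centres of two boxes of width `d / 4`, one on each side of `x`; smallness on a path that
  -- crosses such a box would bound `φ` at its centre below the value it has there
  set zR : ℂ := ⟨(x + d / 4 + (x + d / 2)) / 2, d / 4 / 2⟩ with hzR
  set zL : ℂ := ⟨(x - d / 2 + (x - d / 4)) / 2, d / 4 / 2⟩ with hzL
  have hzRH : zR ∈ upperHalf := show 0 < d / 4 / 2 by positivity
  have hzLH : zL ∈ upperHalf := show 0 < d / 4 / 2 by positivity
  have hM0 : 0 < M := (norm_pos_iff.2 (h0 _ hzRH)).trans_le (hM _ hzRH)
  set κ := Real.sinh (Real.pi / (d / 4) * (d / 4 / 2)) / Real.sinh (Real.pi / (d / 4) * (d / 4))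
    with hκ
  have hπ := Real.pi_pos
  have hκ0 : 0 < κ := div_pos (Real.sinh_pos_iff.2 (by positivity))
    (Real.sinh_pos_iff.2 (by positivity))
  have hbR : x + d / 2 - (x + d / 4) = d / 4 := by ring
  have hbL : x - d / 4 - (x - d / 2) = d / 4 := by ring
  set C : Set ℂ := Icc (x - d / 2) (x + d / 2) ×ℂ Icc (d / 16) (d / 2) with hC
  have hCc : IsCompact C := isCompact_Icc.reProdIm isCompact_Icc
  have hCH : C ⊆ upperHalf := fun z hz => lt_of_lt_of_le (by positivity : 0 < d / 16) hz.2.1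
  obtain ⟨m, hm0, hm⟩ : ∃ m > 0, ∀ z ∈ C, m ≤ ‖φ z‖ := by
    have hne : C.Nonempty := ⟨⟨x, d / 4⟩, ⟨by constructor <;> simp only <;> linarith,
      by constructor <;> simp only <;> linarith⟩⟩
    obtain ⟨z, hz, hmin⟩ := hCc.exists_isMinOn hne (hφ.mono hCH).continuousOn.norm
    exact ⟨‖φ z‖, norm_pos_iff.2 (h0 z (hCH hz)), fun w hw => hmin hw⟩
  obtain ⟨ε, hε0, hεM, hεm, hεR, hεL⟩ : ∃ ε > 0, ε ≤ M ∧ ε < m ∧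
      M * (ε / M) ^ κ < ‖φ zR‖ ∧ M * (ε / M) ^ κ < ‖φ zL‖ := by
    have ht : Tendsto (fun ε : ℝ => M * (ε / M) ^ κ) (𝓝[>] 0) (𝓝 0) := by
      have : ContinuousAt (fun ε : ℝ => M * (ε / M) ^ κ) 0 := by
        refine continuousAt_const.mul (ContinuousAt.rpow_const (by fun_prop) (Or.inr hκ0.le))
      have h1 := this.tendsto
      simp only [zero_div, Real.zero_rpow hκ0.ne', mul_zero] at h1
      exact h1.mono_left nhdsWithin_le_nhds
    have e1 := ht.eventually (gt_mem_nhds (norm_pos_iff.2 (h0 _ hzRH)))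
    have e2 := ht.eventually (gt_mem_nhds (norm_pos_iff.2 (h0 _ hzLH)))
    have e3 : ∀ᶠ ε : ℝ in 𝓝[>] 0, ε < M :=
      (eventually_lt_nhds hM0).filter_mono nhdsWithin_le_nhds
    have e4 : ∀ᶠ ε : ℝ in 𝓝[>] 0, ε < m :=
      (eventually_lt_nhds hm0).filter_mono nhdsWithin_le_nhds
    have e5 : ∀ᶠ ε : ℝ in 𝓝[>] 0, 0 < ε := self_mem_nhdsWithin
    obtain ⟨ε, h1, h2, h3, h4, h5⟩ := (e1.and (e2.and (e3.and (e4.and e5)))).exists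
    exact ⟨ε, h5, h3.le, h4, h1, h2⟩
  refine ⟨ε, hε0, fun β hβ hβim hβε hβ0 => ?_⟩
  by_contra! hβ1
  -- stop the path when it leaves the box of width `d` and height `d / 2` about `x`
  set B : Set ℂ := {z | |z.re - x| < d / 2 ∧ z.im < d / 2} with hB
  have hcre : Continuous fun z : ℂ => |z.re - x| :=
    (Complex.continuous_re.sub continuous_const).abs
  have hBo : IsOpen B := (isOpen_lt hcre continuous_const).inter
    (isOpen_lt Complex.continuous_im continuous_const)
  have hβ0re : |(β 0).re - x| < d / 4 := by
    refine lt_of_le_of_lt ?_ hβ0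
    simpa using Complex.abs_re_le_norm (β 0 - x)
  have hβ0im : (β 0).im < d / 4 := by
    refine lt_of_le_of_lt ?_ hβ0
    simpa using (le_abs_self _).trans (Complex.abs_im_le_norm (β 0 - x))
  have h0I : (0 : ℝ) ∈ Icc (0 : ℝ) 1 := by simp
  have h1I : (1 : ℝ) ∈ Icc (0 : ℝ) 1 := by simp
  have hβ0B : β 0 ∈ B := ⟨by linarith, by linarith⟩
  have hβ1B : β 1 ∉ B := by
    rintro ⟨h1, h2⟩
    have h3 := Complex.norm_le_abs_re_add_abs_im (β 1 - x)
    simp only [Complex.sub_re, Complex.ofReal_re, Complex.sub_im, Complex.ofReal_im, sub_zero,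
      abs_of_pos (hβim 1 h1I)] at h3
    linarith
  have hexit : IsCompact {s ∈ Icc (0 : ℝ) 1 | β s ∉ B} := by
    have := hβ.preimage_isClosed_of_isClosed isClosed_Icc hBo.isClosed_compl
    exact isCompact_Icc.of_isClosed_subset this inter_subset_left
  obtain ⟨s₁, ⟨hs₁I, hs₁B⟩, hs₁min⟩ := hexit.exists_isLeast ⟨1, h1I, hβ1B⟩
  have hs₁0 : 0 < s₁ := by
    refine lt_of_le_of_ne hs₁I.1 fun h => hs₁B ?_
    rw [← h]; exact hβ0B
  have hbefore : ∀ s, 0 ≤ s → s < s₁ → β s ∈ B := by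
    intro s hs hss
    by_contra h
    exact absurd (hs₁min ⟨⟨hs, hss.le.trans hs₁I.2⟩, h⟩) (not_le.2 hss)
  have hclos : ∀ s ∈ Icc 0 s₁, |(β s).re - x| ≤ d / 2 ∧ (β s).im ≤ d / 2 := by
    intro s hs
    have hcl : IsClosed {z : ℂ | |z.re - x| ≤ d / 2 ∧ z.im ≤ d / 2} :=
      (isClosed_le hcre continuous_const).inter
        (isClosed_le Complex.continuous_im continuous_const)
    have hc : ContinuousOn β (closure (Ico 0 s₁)) := by
      rw [closure_Ico hs₁0.ne]
      exact hβ.mono (Icc_subset_Icc_right hs₁I.2)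
    have hm : MapsTo β (Ico 0 s₁) {z : ℂ | |z.re - x| ≤ d / 2 ∧ z.im ≤ d / 2} := fun u hu =>
      ⟨(hbefore u hu.1 hu.2).1.le, (hbefore u hu.1 hu.2).2.le⟩
    have h2 := hm.closure_of_continuousOn hc
    rw [hcl.closure_eq, closure_Ico hs₁0.ne] at h2
    exact h2 hs
  have hsub : ∀ s ∈ Icc 0 s₁, s ∈ Icc (0 : ℝ) 1 := fun s hs => ⟨hs.1, hs.2.trans hs₁I.2⟩
  -- higher up `φ` is bounded below by compactness, so the path creeps along the real axis
  have hlow : ∀ s ∈ Icc 0 s₁, (β s).im ≤ d / 16 := by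
    intro s hs
    by_contra! hgt
    obtain ⟨h1, h2⟩ := hclos s hs
    have h3 := abs_le.1 h1
    have := hm (β s) ⟨⟨by linarith, by linarith⟩, hgt.le, h2⟩
    linarith [hβε s (hsub s hs)]
  have hs₁m : s₁ ∈ Icc 0 s₁ := ⟨hs₁0.le, le_rfl⟩
  have hedge : d / 2 ≤ |(β s₁).re - x| := by
    by_contra! h
    exact hs₁B ⟨h, by linarith [hlow s₁ hs₁m]⟩
  have hmap : ∀ s ∈ Icc (0 : ℝ) 1, s₁ * s ∈ Icc 0 s₁ := fun s hs =>
    ⟨mul_nonneg hs₁0.le hs.1, mul_le_of_le_one_right hs₁0.le hs.2⟩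
  have hmap' : ∀ s ∈ Icc (0 : ℝ) 1, s₁ * (1 - s) ∈ Icc 0 s₁ := fun s hs =>
    hmap _ ⟨by linarith [hs.2], by linarith [hs.1]⟩
  have h3 := abs_lt.1 hβ0re
  rcases le_abs.1 hedge with h | h
  · have := norm_le_of_small_on_crossing hφ hM hε0 hεM (a := x + d / 4) (b := x + d / 2)
      (h := d / 4) (by linarith) (by positivity) (β := fun s => β (s₁ * s))
      (hβ.comp (by fun_prop) fun s hs => hsub _ (hmap s hs))
      (fun s hs => hβim _ (hsub _ (hmap s hs)))
      (fun s hs => (hlow _ (hmap s hs)).trans (by linarith))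
      (fun s hs => hβε _ (hsub _ (hmap s hs)))
      (by simp only [mul_zero]; linarith) (by simp only [mul_one]; linarith)
    rw [hbR] at this
    exact hεR.not_ge this
  · have := norm_le_of_small_on_crossing hφ hM hε0 hεM (a := x - d / 2) (b := x - d / 4)
      (h := d / 4) (by linarith) (by positivity) (β := fun s => β (s₁ * (1 - s)))
      (hβ.comp (by fun_prop) fun s hs => hsub _ (hmap' s hs))
      (fun s hs => hβim _ (hsub _ (hmap' s hs)))
      (fun s hs => (hlow _ (hmap' s hs)).trans (by linarith))
      (fun s hs => hβε _ (hsub _ (hmap' s hs)))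
      (by simp only [sub_zero, mul_one]; linarith) (by simp only [sub_self, mul_zero]; linarith)
    rw [hbL] at this
    exact hεL.not_ge this

end AnnulusLoewner

/-! ### Univalent maps and automorphisms of the half-plane -/

namespace AnnulusLoewner

section Univalent

variable {U : Set ℂ} {f : ℂ → ℂ}

theorem nhds_le_map_of_injOn (hU : IsOpen U) (hf : DifferentiableOn ℂ f U) (hi : InjOn f U) {z : ℂ}
    (hz : z ∈ U) : 𝓝 (f z) ≤ map f (𝓝 z) := by
  refine ((hf.analyticAt (hU.mem_nhds hz)).eventually_constant_or_nhds_le_map_nhds).resolve_left ?_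
  intro h
  have h1 : ∀ᶠ w in 𝓝[≠] z, w = z := by
    filter_upwards [nhdsWithin_le_nhds h, nhdsWithin_le_nhds (hU.mem_nhds hz)] with w hw hwU
    exact hi hwU hz hw
  obtain ⟨w, hw, hw'⟩ := (h1.and self_mem_nhdsWithin).exists
  exact hw' hw

theorem isOpen_image_of_injOn (hU : IsOpen U) (hf : DifferentiableOn ℂ f U) (hi : InjOn f U) :
    IsOpen (f '' U) := by
  rw [isOpen_iff_mem_nhds]
  rintro _ ⟨z, hz, rfl⟩
  exact nhds_le_map_of_injOn hU hf hi hz (image_mem_map (hU.mem_nhds hz))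

theorem continuousAt_invFunOn (hU : IsOpen U) (hf : DifferentiableOn ℂ f U) (hi : InjOn f U)
    {z : ℂ} (hz : z ∈ U) : ContinuousAt (Function.invFunOn f U) (f z) := by
  rw [ContinuousAt, hi.leftInvOn_invFunOn hz]
  intro V hV
  have h1 := nhds_le_map_of_injOn hU hf hi hz (image_mem_map (inter_mem hV (hU.mem_nhds hz)))
  rw [mem_map]
  filter_upwards [h1]
  rintro _ ⟨w, ⟨hwV, hwU⟩, rfl⟩
  rw [mem_preimage, hi.leftInvOn_invFunOn hwU]
  exact hwV

/-- The inverse of an injective holomorphic function is holomorphic: critical points are isolated,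
and at their values the continuous inverse has a removable singularity. -/
theorem differentiableAt_invFunOn (hU : IsOpen U) (hf : DifferentiableOn ℂ f U) (hi : InjOn f U)
    {z : ℂ} (hz : z ∈ U) : DifferentiableAt ℂ (Function.invFunOn f U) (f z) := by
  set g := Function.invFunOn f U with hg
  have hgf : ∀ w ∈ U, g (f w) = w := fun w hw => hi.leftInvOn_invFunOn hw
  have han : AnalyticAt ℂ (deriv f) z := (hf.analyticAt (hU.mem_nhds hz)).deriv
  have hreg : ∀ w ∈ U, deriv f w ≠ 0 → DifferentiableAt ℂ g (f w) := by
    intro w hw hd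
    have hda : HasDerivAt f (deriv f w) (g (f w)) := by
      rw [hgf w hw]
      exact (hf.differentiableAt (hU.mem_nhds hw)).hasDerivAt
    refine (hda.of_local_left_inverse (continuousAt_invFunOn hU hf hi hw) hd ?_).differentiableAt
    filter_upwards [(isOpen_image_of_injOn hU hf hi).mem_nhds (mem_image_of_mem f hw)]
    rintro _ ⟨v, hv, rfl⟩
    rw [← hg, hgf v hv]
  rcases han.eventually_eq_zero_or_eventually_ne_zero with h | h
  · exfalso
    have h2 : ∀ᶠ w in 𝓝 z, f w = f z := by
      obtain ⟨r, hr, hball⟩ := Metric.eventually_nhds_iff_ball.1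
        (h.and (hU.mem_nhds hz))
      filter_upwards [Metric.ball_mem_nhds z hr] with w hw
      exact (convex_ball z r).is_const_of_fderivWithin_eq_zero (𝕜 := ℂ)
        (fun v hv => (hf.differentiableAt
          (hU.mem_nhds (hball v hv).2)).differentiableWithinAt) (fun v hv => by
            rw [fderivWithin_of_isOpen Metric.isOpen_ball hv]
            ext
            simpa using (hball v hv).1) hw (Metric.mem_ball_self hr)
    have h1 : ∀ᶠ w in 𝓝[≠] z, w = z := by
      filter_upwards [nhdsWithin_le_nhds h2, nhdsWithin_le_nhds (hU.mem_nhds hz)] with w hw hwU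
      exact hi hwU hz hw
    obtain ⟨w, hw, hw'⟩ := (h1.and self_mem_nhdsWithin).exists
    exact hw' hw
  · rw [eventually_nhdsWithin_iff] at h
    obtain ⟨r, hr, hball⟩ := Metric.eventually_nhds_iff_ball.1 (h.and (hU.mem_nhds hz))
    have hbU : Metric.ball z r ⊆ U := fun v hv => (hball v hv).2
    have hVo : IsOpen (f '' Metric.ball z r) :=
      isOpen_image_of_injOn Metric.isOpen_ball (hf.mono hbU) (hi.mono hbU)
    have hV : f '' Metric.ball z r ∈ 𝓝 (f z) :=
      hVo.mem_nhds (mem_image_of_mem f (Metric.mem_ball_self hr))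
    have := (Complex.differentiableOn_compl_singleton_and_continuousAt_iff (f := g) hV).1 ⟨?_,
      continuousAt_invFunOn hU hf hi hz⟩
    · exact this.differentiableAt hV
    · rintro _ ⟨⟨v, hv, rfl⟩, hne⟩
      refine (hreg v (hbU hv) ((hball v hv).1 ?_)).differentiableWithinAt
      rintro rfl
      exact hne rfl

theorem deriv_ne_zero_of_injOn (hU : IsOpen U) (hf : DifferentiableOn ℂ f U) (hi : InjOn f U)
    {z : ℂ} (hz : z ∈ U) : deriv f z ≠ 0 := by
  intro h0
  have h1 := (differentiableAt_invFunOn hU hf hi hz).hasDerivAt.comp z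
    (hf.differentiableAt (hU.mem_nhds hz)).hasDerivAt
  rw [h0, mul_zero] at h1
  have h2 : HasDerivAt (Function.invFunOn f U ∘ f) 1 z := by
    refine (hasDerivAt_id z).congr_of_eventuallyEq ?_
    filter_upwards [hU.mem_nhds hz] with w hw
    exact hi.leftInvOn_invFunOn hw
  exact zero_ne_one (h1.unique h2)

end Univalent

theorem isOpen_upperHalf : IsOpen upperHalf := isOpen_lt continuous_const Complex.continuous_im

theorem mem_upperHalf {z : ℂ} : z ∈ upperHalf ↔ 0 < z.im := Iff.rfl

/-- A holomorphic automorphism of the upper half-plane that fixes `0` and `∞` is a dilation. By the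
Schwarz lemma an automorphism fixing `i` is a rotation in the disc model, and it is the identity
as soon as it fixes `∞`. -/
theorem exists_eq_mul_of_automorphism {ψ χ : ℂ → ℂ} (hψ : DifferentiableOn ℂ ψ upperHalf)
    (hχ : DifferentiableOn ℂ χ upperHalf) (hψm : MapsTo ψ upperHalf upperHalf)
    (hχm : MapsTo χ upperHalf upperHalf) (hχψ : ∀ z ∈ upperHalf, χ (ψ z) = z)
    (h0 : Tendsto ψ (𝓝[upperHalf] 0) (𝓝 0))
    (hinf : Tendsto ψ (Bornology.cobounded ℂ ⊓ 𝓟 upperHalf) (Bornology.cobounded ℂ)) :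
    ∃ a : ℝ, 0 < a ∧ ∀ z ∈ upperHalf, ψ z = a * z := by
  have hI : Complex.I ∈ upperHalf := by simp
  set p := (ψ Complex.I).re with hp
  set q := (ψ Complex.I).im with hq
  have hq0 : 0 < q := hψm hI
  have hqc : (q : ℂ) ≠ 0 := by exact_mod_cast hq0.ne'
  have hpq : ψ Complex.I = p + q * Complex.I := (Complex.re_add_im _).symm
  -- `C` is the Cayley transform onto the disc, `Ci` its inverse
  set C : ℂ → ℂ := fun z => (z - Complex.I) / (z + Complex.I) with hC
  set Ci : ℂ → ℂ := fun u => Complex.I * (1 + u) / (1 - u) with hCi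
  have hplus : ∀ z ∈ upperHalf, z + Complex.I ≠ 0 := by
    intro z hz h
    have := congrArg Complex.im h
    simp at this
    linarith [mem_upperHalf.1 hz]
  have hminus : ∀ u ∈ Metric.ball (0 : ℂ) 1, 1 - u ≠ 0 := by
    intro u hu h
    rw [mem_ball_zero_iff, ← sub_eq_zero.1 h] at hu
    simp at hu
  have hCm : MapsTo C upperHalf (Metric.ball 0 1) := by
    intro z hz
    rw [mem_ball_zero_iff, hC, norm_div, div_lt_one (norm_pos_iff.2 (hplus z hz))]
    rw [← sq_lt_sq₀ (norm_nonneg _) (norm_nonneg _), ← Complex.normSq_eq_norm_sq,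
      ← Complex.normSq_eq_norm_sq, Complex.normSq_apply, Complex.normSq_apply]
    have := mem_upperHalf.1 hz
    simp
    nlinarith
  have hCiC : ∀ z ∈ upperHalf, Ci (C z) = z := by
    intro z hz
    have h1 := hplus z hz
    have h2 := hminus _ (hCm hz)
    have e : 1 - (z - Complex.I) / (z + Complex.I) = 2 * Complex.I / (z + Complex.I) := by
      field_simp; ring
    simp only [hC, hCi]
    rw [e]
    field_simp
    ring
  have hCCi : ∀ u ∈ Metric.ball (0 : ℂ) 1, C (Ci u) = u := by
    intro u hu
    have h2 := hminus u hu
    have e1 : Complex.I * (1 + u) / (1 - u) - Complex.I = 2 * Complex.I * u / (1 - u) := by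
      field_simp; ring
    have e2 : Complex.I * (1 + u) / (1 - u) + Complex.I = 2 * Complex.I / (1 - u) := by
      field_simp; ring
    simp only [hC, hCi]
    rw [e1, e2]
    field_simp
  have hCim : MapsTo Ci (Metric.ball 0 1) upperHalf := by
    intro u hu
    have h2 := hminus u hu
    have e : Ci u = Complex.I * ((1 + u) * (starRingEnd ℂ) (1 - u)) / (Complex.normSq (1 - u)) := by
      rw [hCi]
      have h3 : (starRingEnd ℂ) (1 - u) ≠ 0 := by
        rwa [Ne, map_eq_zero_iff _ (starRingEnd ℂ).injective]
      rw [← Complex.mul_conj]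
      field_simp
    have h3 : 0 < Complex.normSq (1 - u) := Complex.normSq_pos.2 h2
    rw [mem_upperHalf, e, Complex.div_ofReal_im]
    refine div_pos ?_ h3
    have h4 : Complex.normSq u < 1 := by
      rw [mem_ball_zero_iff] at hu
      rw [Complex.normSq_eq_norm_sq]
      nlinarith [norm_nonneg u]
    rw [Complex.normSq_apply] at h4
    simp
    nlinarith
  have hCd : DifferentiableOn ℂ C upperHalf :=
    DifferentiableOn.div (by fun_prop) (by fun_prop) hplus
  have hCid : DifferentiableOn ℂ Ci (Metric.ball 0 1) :=
    DifferentiableOn.div (by fun_prop) (by fun_prop) hminus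
  -- normalize by an affine map so that `i` is fixed
  set ψ₁ : ℂ → ℂ := fun z => (ψ z - p) / q with hψ₁
  set χ₁ : ℂ → ℂ := fun z => χ (q * z + p) with hχ₁
  have hψ₁m : MapsTo ψ₁ upperHalf upperHalf := by
    intro z hz
    rw [mem_upperHalf, hψ₁, Complex.div_ofReal_im]
    have := mem_upperHalf.1 (hψm hz)
    simp
    positivity
  have haff : MapsTo (fun z : ℂ => (q : ℂ) * z + p) upperHalf upperHalf := by
    intro z hz
    have := mem_upperHalf.1 hz
    rw [mem_upperHalf]
    simp
    positivity
  have hχ₁m : MapsTo χ₁ upperHalf upperHalf := fun z hz => hχm (haff hz)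
  have hχψ₁ : ∀ z ∈ upperHalf, χ₁ (ψ₁ z) = z := by
    intro z hz
    have : (q : ℂ) * ((ψ z - p) / q) + p = ψ z := by field_simp; ring
    simp only [hχ₁, hψ₁, this]
    exact hχψ z hz
  have hψ₁I : ψ₁ Complex.I = Complex.I := by
    simp only [hψ₁, hpq]; field_simp; ring
  have hχ₁I : χ₁ Complex.I = Complex.I := by
    conv_lhs => rw [← hψ₁I]
    exact hχψ₁ _ hI
  have hCi0 : Ci 0 = Complex.I := by simp [hCi]
  have hCI : C Complex.I = 0 := by simp [hC]
  have hH : ∀ {θ : ℂ → ℂ}, DifferentiableOn ℂ θ upperHalf → MapsTo θ upperHalf upperHalf →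
      DifferentiableOn ℂ (fun u => C (θ (Ci u))) (Metric.ball 0 1) := fun hd hm =>
    hCd.comp (hd.comp hCid hCim) (hm.comp hCim)
  have hψ₁d : DifferentiableOn ℂ ψ₁ upperHalf := (hψ.sub_const _).div_const _
  have hχ₁d : DifferentiableOn ℂ χ₁ upperHalf := hχ.comp (by fun_prop) haff
  set h : ℂ → ℂ := fun u => C (ψ₁ (Ci u)) with hh
  have hhm : MapsTo h (Metric.ball 0 1) (Metric.ball 0 1) := hCm.comp (hψ₁m.comp hCim)
  have hh0 : h 0 = 0 := by simp only [hh, hCi0, hψ₁I, hCI]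
  -- the Schwarz lemma for the map and for its inverse
  have hnorm : ∀ u ∈ Metric.ball (0 : ℂ) 1, ‖h u‖ = ‖u‖ := by
    intro u hu
    have hu' := mem_ball_zero_iff.1 hu
    refine le_antisymm ?_ ?_
    · exact Complex.norm_le_norm_of_mapsTo_ball (hH hψ₁d hψ₁m)
        (hhm.mono_right Metric.ball_subset_closedBall) hh0 hu'
    · have h1 := Complex.norm_le_norm_of_mapsTo_ball (hH hχ₁d hχ₁m)
        ((hCm.comp (hχ₁m.comp hCim)).mono_right Metric.ball_subset_closedBall)
        (by simp only [hCi0, hχ₁I, hCI]) (mem_ball_zero_iff.1 (hhm hu))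
      have h2 : C (χ₁ (Ci (h u))) = u := by
        simp only [hh]
        rw [hCiC _ (hψ₁m (hCim hu)), hχψ₁ _ (hCim hu), hCCi u hu]
      rwa [h2] at h1
  have hhalf : (1 / 2 : ℂ) ∈ Metric.ball (0 : ℂ) 1 := by
    rw [mem_ball_zero_iff]; norm_num
  obtain ⟨c, -, hc⟩ := Complex.affine_of_mapsTo_ball_of_exists_norm_dslope_eq_div' (f := h)
    (c := 0) (R₁ := 1) (R₂ := 1) (hH hψ₁d hψ₁m)
    (by rw [hh0]; exact hhm.mono_right Metric.ball_subset_closedBall)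
    ⟨1 / 2, hhalf, by
      rw [dslope_of_ne _ (by norm_num), slope_def_field, hh0, sub_zero, norm_div, hnorm _ hhalf]
      norm_num⟩
  have hlin : ∀ z ∈ upperHalf, C (ψ₁ z) = C z * c := by
    intro z hz
    have := hc (hCm hz)
    rw [hh0] at this
    simp only [zero_add, sub_zero, smul_eq_mul, hh] at this
    rwa [hCiC z hz] at this
  have hCinf : Tendsto C (Bornology.cobounded ℂ ⊓ 𝓟 upperHalf) (𝓝 1) := by
    have h1 : Tendsto (fun z : ℂ => 1 - 2 * Complex.I * (z + Complex.I)⁻¹)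
        (Bornology.cobounded ℂ) (𝓝 (1 - 2 * Complex.I * 0)) :=
      tendsto_const_nhds.sub (tendsto_const_nhds.mul
        (tendsto_inv₀_cobounded.comp (tendsto_add_const_cobounded Complex.I)))
    rw [mul_zero, sub_zero] at h1
    refine (h1.mono_left inf_le_left).congr' ?_
    filter_upwards [mem_inf_of_right (mem_principal_self _)] with z hz
    have := hplus z hz
    simp only [hC]
    field_simp
    ring
  have hiy : Tendsto (fun y : ℝ => (y : ℂ) * Complex.I) atTop
      (Bornology.cobounded ℂ ⊓ 𝓟 upperHalf) := by
    refine tendsto_inf.2 ⟨?_, tendsto_principal.2 ?_⟩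
    · rw [← tendsto_norm_atTop_iff_cobounded]
      simpa using tendsto_abs_atTop_atTop
    · filter_upwards [eventually_gt_atTop 0] with y hy
      simpa [mem_upperHalf] using hy
  have hψ₁inf : Tendsto (fun y : ℝ => ψ₁ (y * Complex.I)) atTop
      (Bornology.cobounded ℂ ⊓ 𝓟 upperHalf) := by
    refine tendsto_inf.2 ⟨?_, tendsto_principal.2 ?_⟩
    · have h1 : Tendsto (fun z : ℂ => (z - p) / q) (Bornology.cobounded ℂ)
          (Bornology.cobounded ℂ) := by
        have h2 := tendsto_norm_cobounded_atTop.comp (tendsto_sub_const_cobounded (p : ℂ))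
        rw [← tendsto_norm_atTop_iff_cobounded]
        refine (h2.atTop_div_const hq0).congr fun z => ?_
        simp [abs_of_pos hq0]
      exact h1.comp (hinf.comp hiy)
    · have := (tendsto_inf.1 hiy).2
      filter_upwards [tendsto_principal.1 this] with y hy
      exact hψ₁m hy
  have hc1 : c = 1 := by
    have h1 : Tendsto (fun y : ℝ => C (ψ₁ (y * Complex.I))) atTop (𝓝 1) := hCinf.comp hψ₁inf
    have h2 : Tendsto (fun y : ℝ => C (y * Complex.I) * c) atTop (𝓝 (1 * c)) :=
      (hCinf.comp hiy).mul_const c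
    rw [one_mul] at h2
    refine tendsto_nhds_unique (h2.congr' ?_) h1
    filter_upwards [tendsto_principal.1 (tendsto_inf.1 hiy).2] with y hy
    exact (hlin _ hy).symm
  have haffine : ∀ z ∈ upperHalf, ψ z = q * z + p := by
    intro z hz
    have h1 := hlin z hz
    rw [hc1, mul_one] at h1
    have h2 : ψ₁ z = z := by rw [← hCiC _ (hψ₁m hz), h1, hCiC z hz]
    have h3 : ψ z = q * ψ₁ z + p := by simp only [hψ₁]; field_simp; ring
    rw [h3, h2]
  have hp0 : (p : ℂ) = 0 := by
    have hne : (𝓝[upperHalf] (0 : ℂ)).NeBot := by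
      refine mem_closure_iff_nhdsWithin_neBot.1 (Metric.mem_closure_iff.2 fun ε hε => ?_)
      refine ⟨(ε / 2 : ℝ) * Complex.I, by simpa [mem_upperHalf] using hε, ?_⟩
      rw [dist_zero_left]
      simp [abs_of_pos hε]
      linarith
    have h1 : Tendsto (fun z : ℂ => (q : ℂ) * z + p) (𝓝[upperHalf] 0) (𝓝 (q * 0 + p)) :=
      (by fun_prop : Continuous fun z : ℂ => (q : ℂ) * z + p).continuousAt.mono_left
        nhdsWithin_le_nhds
    rw [mul_zero, zero_add] at h1
    refine tendsto_nhds_unique (h1.congr' ?_) h0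
    filter_upwards [self_mem_nhdsWithin] with z hz
    exact (haffine z hz).symm
  exact ⟨q, hq0, fun z hz => by rw [haffine z hz, hp0, add_zero]⟩

end AnnulusLoewner

/-! ### Boundary behaviour of slit maps -/

namespace AnnulusLoewner

/-- A normalized conformal map of the upper half-plane onto the complement of the slits; the
image is described by the logarithmic coordinate. -/
structure IsSlitMap (τ₀ : ℝ) (l : ℝ → ℂ) (t : ℝ) (f : ℂ → ℂ) : Prop where
  differentiableOn : DifferentiableOn ℂ f upperHalf
  injOn : InjOn f upperHalf
  image_eq : f '' upperHalf = {w | Complex.log w ∈ logDomain τ₀ l t}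
  tendsto_zero : Tendsto f (𝓝[upperHalf] 0) (𝓝 0)
  tendsto_infty : Tendsto f (Bornology.cobounded ℂ ⊓ 𝓟 upperHalf) (Bornology.cobounded ℂ)

theorem log_exp_of_mem_strip {w : ℂ} (hw : w ∈ strip) : Complex.log (Complex.exp w) = w :=
  Complex.log_exp (by linarith [hw.1, Real.pi_pos]) hw.2.le

theorem im_pos_of_log_mem_strip {w : ℂ} (hw : Complex.log w ∈ strip) : 0 < w.im := by
  have h1 : 0 < Complex.arg w := by simpa [Complex.log_im] using hw.1
  have h2 : Complex.arg w < Real.pi := by simpa [Complex.log_im] using hw.2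
  have h3 : 0 ≤ w.im := Complex.arg_nonneg_iff.1 h1.le
  refine lt_of_le_of_ne h3 fun h => ?_
  rcases le_or_gt 0 w.re with h4 | h4
  · exact h1.ne' (Complex.arg_eq_zero_iff.2 ⟨h4, h.symm⟩)
  · exact h2.ne (Complex.arg_eq_pi_iff.2 ⟨h4, h.symm⟩)

theorem log_mem_strip {w : ℂ} (hw : 0 < w.im) : Complex.log w ∈ strip := by
  have h0 : 0 ≤ Complex.arg w := Complex.arg_nonneg_iff.2 hw.le
  constructor
  · rw [Complex.log_im]
    refine lt_of_le_of_ne h0 fun h => ?_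
    exact hw.ne' (Complex.arg_eq_zero_iff.1 h.symm).2
  · rw [Complex.log_im]
    refine lt_of_le_of_ne (Complex.arg_le_pi w) fun h => ?_
    exact hw.ne' (Complex.arg_eq_pi_iff.1 h).2

theorem exp_mem_upperHalf {w : ℂ} (hw : w ∈ strip) : Complex.exp w ∈ upperHalf := by
  rw [mem_upperHalf, Complex.exp_im]
  exact mul_pos (Real.exp_pos _) (Real.sin_pos_of_pos_of_lt_pi hw.1 hw.2)

theorem ne_zero_of_mem_upperHalf {z : ℂ} (hz : z ∈ upperHalf) : z ≠ 0 := by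
  rintro rfl
  simp at hz

theorem differentiableAt_log_of_mem_upperHalf {z : ℂ} (hz : z ∈ upperHalf) :
    DifferentiableAt ℂ Complex.log z :=
  Complex.differentiableAt_log (Complex.mem_slitPlane_iff.2 (Or.inr (ne_of_gt hz)))

theorem one_le_norm_add_I {z : ℂ} (hz : 0 < z.im) : 1 ≤ ‖z + Complex.I‖ := by
  refine le_trans ?_ ((le_abs_self _).trans (Complex.abs_im_le_norm _))
  simp; linarith

namespace IsSlitMap

variable {τ₀ T : ℝ} {l : ℝ → ℂ} {t : ℝ} {f : ℂ → ℂ}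

theorem log_mem (hf : IsSlitMap τ₀ l t f) {z : ℂ} (hz : z ∈ upperHalf) :
    Complex.log (f z) ∈ logDomain τ₀ l t := by
  have : f z ∈ f '' upperHalf := mem_image_of_mem f hz
  rwa [hf.image_eq] at this

theorem mapsTo (hf : IsSlitMap τ₀ l t f) {z : ℂ} (hz : z ∈ upperHalf) : f z ∈ upperHalf :=
  im_pos_of_log_mem_strip (hf.log_mem hz).1

theorem inverse_mem (hf : IsSlitMap τ₀ l t f) {w : ℂ} (hw : Complex.log w ∈ logDomain τ₀ l t) :
    inverseMap f w ∈ upperHalf :=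
  Function.invFunOn_mem (by rw [← mem_image, hf.image_eq]; exact hw)

theorem apply_inverse (hf : IsSlitMap τ₀ l t f) {w : ℂ} (hw : Complex.log w ∈ logDomain τ₀ l t) :
    f (inverseMap f w) = w :=
  Function.invFunOn_eq (by rw [← mem_image, hf.image_eq]; exact hw)

theorem inverse_apply (hf : IsSlitMap τ₀ l t f) {z : ℂ} (hz : z ∈ upperHalf) :
    inverseMap f (f z) = z :=
  hf.injOn.leftInvOn_invFunOn hz

theorem differentiableAt_inverse (hf : IsSlitMap τ₀ l t f) {w : ℂ}
    (hw : Complex.log w ∈ logDomain τ₀ l t) : DifferentiableAt ℂ (inverseMap f) w := by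
  have := differentiableAt_invFunOn isOpen_upperHalf hf.differentiableOn hf.injOn
    (hf.inverse_mem hw)
  rwa [hf.apply_inverse hw] at this

theorem continuousAt (hf : IsSlitMap τ₀ l t f) {z : ℂ} (hz : z ∈ upperHalf) : ContinuousAt f z :=
  (hf.differentiableOn.differentiableAt (isOpen_upperHalf.mem_nhds hz)).continuousAt

/-- Paths in the logarithmic slit domain are pulled back to paths in the upper half-plane. -/
theorem exists_path (hf : IsSlitMap τ₀ l t f) {W : Set ℂ} {a b : ℂ}
    (h : JoinedIn (logDomain τ₀ l t ∩ W) a b) :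
    ∃ β : ℝ → ℂ, ContinuousOn β (Icc 0 1) ∧ (∀ s ∈ Icc (0 : ℝ) 1, 0 < (β s).im) ∧
      (∀ s ∈ Icc (0 : ℝ) 1, Complex.log (f (β s)) ∈ W) ∧
      β 0 = inverseMap f (Complex.exp a) ∧ β 1 = inverseMap f (Complex.exp b) := by
  obtain ⟨α, hα⟩ := h
  have hm : ∀ s ∈ Icc (0 : ℝ) 1, α.extend s ∈ logDomain τ₀ l t ∩ W := fun s hs => by
    rw [α.extend_apply hs]; exact hα _
  have hlog : ∀ s ∈ Icc (0 : ℝ) 1, Complex.log (Complex.exp (α.extend s)) = α.extend s :=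
    fun s hs => log_exp_of_mem_strip (hm s hs).1.1
  have hD : ∀ s ∈ Icc (0 : ℝ) 1, Complex.log (Complex.exp (α.extend s)) ∈ logDomain τ₀ l t :=
    fun s hs => by rw [hlog s hs]; exact (hm s hs).1
  refine ⟨fun s => inverseMap f (Complex.exp (α.extend s)), ?_, fun s hs => ?_, fun s hs => ?_,
    by simp, by simp⟩
  · intro s hs
    have h1 : ContinuousAt (fun s => Complex.exp (α.extend s)) s :=
      (Complex.continuous_exp.comp α.continuous_extend).continuousAt
    exact (ContinuousAt.comp (f := fun s => Complex.exp (α.extend s))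
      (hf.differentiableAt_inverse (hD s hs)).continuousAt h1).continuousWithinAt
  · exact hf.inverse_mem (hD s hs)
  · rw [hf.apply_inverse (hD s hs), hlog s hs]
    exact (hm s hs).2

theorem exists_lt_norm (hf : IsSlitMap τ₀ l t f) (N : ℝ) :
    ∃ R, ∀ z ∈ upperHalf, R < ‖z‖ → N < ‖f z‖ := by
  have h := (tendsto_norm_cobounded_atTop.comp hf.tendsto_infty).eventually (eventually_gt_atTop N)
  rw [eventually_inf_principal] at h
  rw [← comap_norm_atTop, eventually_comap] at h
  obtain ⟨R, hR⟩ := eventually_atTop.1 h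
  exact ⟨R, fun z hz hzR => hR _ hzR.le z rfl hz⟩

theorem exists_norm_lt (hf : IsSlitMap τ₀ l t f) {ε : ℝ} (hε : 0 < ε) :
    ∃ δ > 0, ∀ z ∈ upperHalf, ‖z‖ < δ → ‖f z‖ < ε := by
  have h := hf.tendsto_zero (Metric.ball_mem_nhds 0 hε)
  obtain ⟨δ, hδ, hsub⟩ := Metric.mem_nhdsWithin_iff.1 h
  exact ⟨δ, hδ, fun z hz hzδ => by simpa using hsub ⟨by simpa using hzδ, hz⟩⟩

/-- A bounded sequence in the upper half-plane whose image under a slit map leaves the slit domain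
accumulates at a real point. -/
theorem exists_subseq_tendsto_real (hf : IsSlitMap τ₀ l t f) {z : ℕ → ℂ}
    (hz : ∀ n, z n ∈ upperHalf) {R : ℝ} (hR : ∀ n, ‖z n‖ ≤ R)
    (hout : ∀ w, Complex.log w ∈ logDomain τ₀ l t → ¬ MapClusterPt w atTop fun n => f (z n)) :
    ∃ x : ℝ, ∃ θ : ℕ → ℕ, StrictMono θ ∧ Tendsto (fun n => z (θ n)) atTop (𝓝 x) := by
  obtain ⟨a, -, θ, hθ, hlim⟩ := tendsto_subseq_of_bounded
    (Metric.isBounded_closedBall (x := (0 : ℂ)) (r := R)) (fun n => by simpa using hR n)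
  have hre : a.im = 0 := by
    have h1 : 0 ≤ a.im := by
      refine ge_of_tendsto' ((Complex.continuous_im.tendsto a).comp hlim) fun n => ?_
      exact (mem_upperHalf.1 (hz _)).le
    refine le_antisymm (not_lt.1 fun h => ?_) h1
    refine hout (f a) (hf.log_mem h) ?_
    exact ((hf.continuousAt h).tendsto.comp hlim).mapClusterPt.of_comp hθ.tendsto_atTop
  refine ⟨a.re, θ, hθ, ?_⟩
  have ha : (a.re : ℂ) = a := Complex.ext (by simp) (by simp [hre])
  rw [ha]
  exact hlim

/-- The inverse of a normalized slit map tends to infinity at infinity. -/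
theorem inverse_exists_lt_norm (hf : IsSlitMap τ₀ l t f) (hl : IsLogSlit τ₀ T l) (hτ : 0 < τ₀)
    (ht : t ∈ Icc 0 T) (R : ℝ) :
    ∃ N, ∀ w, Complex.log w ∈ logDomain τ₀ l t → N < ‖w‖ → R < ‖inverseMap f w‖ := by
  by_contra! hcon
  choose w hwD hwn hwR using fun n : ℕ => hcon n
  have hfw : ∀ n, f (inverseMap f (w n)) = w n := fun n => hf.apply_inverse (hwD n)
  have hwinf : Tendsto (fun n => ‖w n‖) atTop atTop :=
    tendsto_atTop_mono (fun n => (hwn n).le) tendsto_natCast_atTop_atTop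
  obtain ⟨x, θ, hθ, hlim⟩ := hf.exists_subseq_tendsto_real
    (z := fun n => inverseMap f (w n)) (fun n => hf.inverse_mem (hwD n)) hwR (by
      intro v _ hv
      simp only [hfw] at hv
      obtain ⟨ψ, hψ, hψlim⟩ := hv.tendsto_subseq
      exact not_tendsto_nhds_of_tendsto_atTop (hwinf.comp hψ.tendsto_atTop) _ hψlim.norm)
  -- Koebe's lemma for `1 / (f + i)`, which is bounded, zero-free, and small near the end
  obtain ⟨L, hL, hjoin⟩ := hl.exists_joinedIn_re hτ (ht.1.trans ht.2)
  have hφ : DifferentiableOn ℂ (fun z => (f z + Complex.I)⁻¹) upperHalf :=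
    (hf.differentiableOn.add_const _).inv fun z hz => by
      have := one_le_norm_add_I (hf.mapsTo hz)
      exact norm_pos_iff.1 (by linarith)
  obtain ⟨ε, hε, hpath⟩ := exists_pos_forall_path_not_small hφ (M := 1) (fun z hz => by
      rw [norm_inv]
      exact inv_le_one_of_one_le₀ (one_le_norm_add_I (hf.mapsTo hz))) (fun z hz => by
      have := one_le_norm_add_I (hf.mapsTo hz)
      exact inv_ne_zero (norm_pos_iff.1 (by linarith))) x one_pos
  -- points with real part above `B` in the logarithmic coordinate give values below `ε`
  set B := Real.log (ε⁻¹ + 1) with hB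
  have hsmall : ∀ z ∈ upperHalf, B < (Complex.log (f z)).re → ‖(f z + Complex.I)⁻¹‖ ≤ ε := by
    intro z hz h
    rw [Complex.log_re, hB] at h
    have hpos : 0 < ‖f z‖ := norm_pos_iff.2 (ne_zero_of_mem_upperHalf (hf.mapsTo hz))
    have h1 := (Real.log_lt_log_iff (by positivity) hpos).1 h
    have h2 : ‖f z‖ ≤ ‖f z + Complex.I‖ + 1 := by
      have := norm_sub_le (f z + Complex.I) Complex.I
      simpa using this
    rw [norm_inv]
    refine inv_le_of_inv_le₀ hε ?_
    linarith
  obtain ⟨R', hR'⟩ := hf.exists_lt_norm (Real.exp (B + L))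
  set y := max (R' + 1) (|x| + 2) with hy
  have hy0 : 0 < y := lt_of_lt_of_le (by positivity) (le_max_right _ _)
  have hyH : (y : ℂ) * Complex.I ∈ upperHalf := by simpa [mem_upperHalf] using hy0
  have hyn : ‖(y : ℂ) * Complex.I‖ = y := by simp [abs_of_pos hy0]
  have hyf : B + L < (Complex.log (f (y * Complex.I))).re := by
    rw [Complex.log_re, Real.lt_log_iff_exp_lt
      (norm_pos_iff.2 (ne_zero_of_mem_upperHalf (hf.mapsTo hyH)))]
    refine hR' _ hyH ?_
    rw [hyn]
    linarith [le_max_left (R' + 1) (|x| + 2)]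
  have e1 : ∀ᶠ n in atTop, ‖inverseMap f (w (θ n)) - x‖ < 1 / 4 := by
    have := (tendsto_iff_norm_sub_tendsto_zero.1 hlim).eventually (gt_mem_nhds
      (by norm_num : (0 : ℝ) < 1 / 4))
    exact this
  have e2 : ∀ᶠ n in atTop, Real.exp (B + L) < ‖w (θ n)‖ :=
    (hwinf.comp hθ.tendsto_atTop).eventually (eventually_gt_atTop _)
  obtain ⟨n, hn1, hn2⟩ := (e1.and e2).exists
  have hwne : 0 < ‖w (θ n)‖ := (Real.exp_pos _).trans hn2
  have hwf : B + L < (Complex.log (w (θ n))).re := by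
    rw [Complex.log_re]; exact (Real.lt_log_iff_exp_lt hwne).2 hn2
  obtain ⟨β, hβ, hβim, hβW, hβ0, hβ1⟩ := hf.exists_path
    (hjoin t ht _ (hwD (θ n)) _ (hf.log_mem hyH))
  rw [Complex.exp_log (norm_pos_iff.1 hwne)] at hβ0
  rw [Complex.exp_log (ne_zero_of_mem_upperHalf (hf.mapsTo hyH)), hf.inverse_apply hyH] at hβ1
  have hfin := hpath β hβ hβim (fun s hs => hsmall _ (hβim s hs) (by
    have h1 := (hβW s hs).1
    have h2 := lt_min hwf hyf
    linarith)) (by rw [hβ0]; exact hn1)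
  rw [hβ1] at hfin
  have h3 := norm_sub_norm_le ((y : ℂ) * Complex.I) x
  rw [hyn, Complex.norm_real, Real.norm_eq_abs] at h3
  linarith [le_max_right (R' + 1) (|x| + 2)]

/-- The inverse of a normalized slit map tends to zero at zero. -/
theorem inverse_exists_norm_lt (hf : IsSlitMap τ₀ l t f) (hl : IsLogSlit τ₀ T l) (hτ : 0 < τ₀)
    (ht : t ∈ Icc 0 T) {r : ℝ} (hr : 0 < r) :
    ∃ δ > 0, ∀ w, Complex.log w ∈ logDomain τ₀ l t → ‖w‖ < δ → ‖inverseMap f w‖ < r := by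
  by_contra! hcon
  choose w hwD hwn hwR using fun n : ℕ => hcon (1 / (n + 1 : ℝ)) (by positivity)
  have hfw : ∀ n, f (inverseMap f (w n)) = w n := fun n => hf.apply_inverse (hwD n)
  have hw0 : Tendsto w atTop (𝓝 0) := squeeze_zero_norm (fun n => (hwn n).le)
    tendsto_one_div_add_atTop_nhds_zero_nat
  obtain ⟨R, hR⟩ := hf.exists_lt_norm 1
  obtain ⟨x, θ, hθ, hlim⟩ := hf.exists_subseq_tendsto_real
    (z := fun n => inverseMap f (w n)) (fun n => hf.inverse_mem (hwD n)) (R := R) (by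
      intro n
      by_contra! h
      have h1 := hR _ (hf.inverse_mem (hwD n)) h
      rw [hfw] at h1
      have h2 := hwn n
      have h3 : 1 / (n + 1 : ℝ) ≤ 1 := by
        rw [div_le_one (by positivity)]; linarith [(Nat.cast_nonneg n : (0 : ℝ) ≤ n)]
      linarith) (by
      intro v hv hcl
      simp only [hfw] at hcl
      obtain ⟨ψ, hψ, hψlim⟩ := hcl.tendsto_subseq
      rw [tendsto_nhds_unique hψlim (hw0.comp hψ.tendsto_atTop)] at hv
      simpa using hv.1.1)
  have hxr : r ≤ |x| := by
    have := ge_of_tendsto' hlim.norm fun n => hwR (θ n)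
    simpa using this
  have hx0 : 0 < |x| := hr.trans_le hxr
  obtain ⟨L, hL, hjoin⟩ := hl.exists_joinedIn_re hτ (ht.1.trans ht.2)
  have hne : ∀ z ∈ upperHalf, f z + Complex.I ≠ 0 := fun z hz => by
    have := one_le_norm_add_I (hf.mapsTo hz)
    exact norm_pos_iff.1 (by linarith)
  have hφ : DifferentiableOn ℂ (fun z => f z / (f z + Complex.I)) upperHalf :=
    hf.differentiableOn.div (hf.differentiableOn.add_const _) hne
  have hle : ∀ z ∈ upperHalf, ‖f z / (f z + Complex.I)‖ ≤ ‖f z‖ := fun z hz => by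
    rw [norm_div]
    exact div_le_self (norm_nonneg _) (one_le_norm_add_I (hf.mapsTo hz))
  obtain ⟨ε, hε, hpath⟩ := exists_pos_forall_path_not_small hφ (M := 2) (fun z hz => by
      have h1 := one_le_norm_add_I (hf.mapsTo hz)
      have h2 : ‖f z‖ ≤ ‖f z + Complex.I‖ + 1 := by
        simpa using norm_sub_le (f z + Complex.I) Complex.I
      rw [norm_div, div_le_iff₀ (by linarith)]
      linarith) (fun z hz =>
      div_ne_zero (ne_zero_of_mem_upperHalf (hf.mapsTo hz)) (hne z hz)) x hx0
  set B := Real.log ε with hB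
  have hsmall : ∀ z ∈ upperHalf, (Complex.log (f z)).re < B →
      ‖f z / (f z + Complex.I)‖ ≤ ε := by
    intro z hz h
    rw [Complex.log_re, hB] at h
    have hpos : 0 < ‖f z‖ := norm_pos_iff.2 (ne_zero_of_mem_upperHalf (hf.mapsTo hz))
    exact (hle z hz).trans ((Real.log_lt_log_iff hpos hε).1 h).le
  obtain ⟨δ, hδ, hfδ⟩ := hf.exists_norm_lt (Real.exp_pos (B - L))
  set y := δ / 2 with hy
  have hy0 : 0 < y := by positivity
  have hyH : (y : ℂ) * Complex.I ∈ upperHalf := by simpa [mem_upperHalf] using hy0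
  have hyn : ‖(y : ℂ) * Complex.I‖ = y := by simp [abs_of_pos hy0]
  have hyf : (Complex.log (f (y * Complex.I))).re < B - L := by
    rw [Complex.log_re, Real.log_lt_iff_lt_exp
      (norm_pos_iff.2 (ne_zero_of_mem_upperHalf (hf.mapsTo hyH)))]
    exact hfδ _ hyH (by rw [hyn]; linarith)
  have e1 : ∀ᶠ n in atTop, ‖inverseMap f (w (θ n)) - x‖ < |x| / 4 :=
    (tendsto_iff_norm_sub_tendsto_zero.1 hlim).eventually (gt_mem_nhds (by positivity))
  have e2 : ∀ᶠ n in atTop, ‖w (θ n)‖ < Real.exp (B - L) := by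
    have := (hw0.comp hθ.tendsto_atTop).norm
    rw [norm_zero] at this
    exact this.eventually (gt_mem_nhds (Real.exp_pos _))
  obtain ⟨n, hn1, hn2⟩ := (e1.and e2).exists
  have hwne : w (θ n) ≠ 0 := by
    intro h
    have := (hwD (θ n)).1.1
    simp [h] at this
  have hwf : (Complex.log (w (θ n))).re < B - L := by
    rw [Complex.log_re]; exact (Real.log_lt_iff_lt_exp (norm_pos_iff.2 hwne)).2 hn2
  obtain ⟨β, hβ, hβim, hβW, hβ0, hβ1⟩ := hf.exists_path
    (hjoin t ht _ (hwD (θ n)) _ (hf.log_mem hyH))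
  rw [Complex.exp_log hwne] at hβ0
  rw [Complex.exp_log (ne_zero_of_mem_upperHalf (hf.mapsTo hyH)), hf.inverse_apply hyH] at hβ1
  have hfin := hpath β hβ hβim (fun s hs => hsmall _ (hβim s hs) (by
    have h1 := (hβW s hs).2
    have h2 := max_lt hwf hyf
    linarith)) (by rw [hβ0]; exact hn1)
  rw [hβ1] at hfin
  have h3 := Complex.abs_re_le_norm ((y : ℂ) * Complex.I - x)
  simp at h3
  linarith

/-- The inverse of a slit map has a real limit at the tip of the slit. -/
theorem exists_tendsto_inverse_tip (hf : IsSlitMap τ₀ l t f) (hl : IsLogSlit τ₀ T l) (hτ : 0 < τ₀)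
    (ht : t ∈ Ioc 0 T) :
    ∃ x : ℝ, x ≠ 0 ∧ Tendsto (inverseMap f) (𝓝[{w | Complex.log w ∈ logDomain τ₀ l t}]
      (Complex.exp (l t))) (𝓝 x) := by
  set D := {w | Complex.log w ∈ logDomain τ₀ l t} with hD
  set p := Complex.exp (l t) with hp
  have hlS := hl.mem_strip t ht
  have hpH : p ∈ upperHalf := exp_mem_upperHalf hlS
  have hlogp : Complex.log p = l t := log_exp_of_mem_strip hlS
  have hpD : p ∉ D := by
    intro h
    rw [hD, mem_ofPred_eq, hlogp] at h
    exact h.2 0 t ⟨ht.1, le_rfl⟩ (by simp)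
  -- that the tip is a limit point of the domain is not needed: otherwise there is nothing to show
  rcases (𝓝[D] p).eq_or_neBot with hbot | hne
  · exact ⟨1, one_ne_zero, by rw [hbot]; exact tendsto_bot⟩
  obtain ⟨w, hw⟩ := exists_seq_tendsto (𝓝[D] p)
  obtain ⟨hwp, hwD⟩ := tendsto_nhdsWithin_iff.1 hw
  obtain ⟨n₀, hn₀⟩ := eventually_atTop.1 (hwD.and (hwp.norm.eventually
    (gt_mem_nhds (lt_add_one ‖p‖))))
  obtain ⟨R, hR⟩ := hf.exists_lt_norm (‖p‖ + 1)
  set w' : ℕ → ℂ := fun n => w (n + n₀) with hw'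
  have hw'D : ∀ n, w' n ∈ D := fun n => (hn₀ (n + n₀) (Nat.le_add_left _ _)).1
  have hw'p : Tendsto w' atTop (𝓝 p) := hwp.comp (tendsto_add_atTop_nat n₀)
  have hfw : ∀ n, f (inverseMap f (w' n)) = w' n := fun n => hf.apply_inverse (hw'D n)
  obtain ⟨x, θ, hθ, hlim⟩ := hf.exists_subseq_tendsto_real
    (z := fun n => inverseMap f (w' n)) (fun n => hf.inverse_mem (hw'D n)) (R := R) (by
      intro n
      by_contra! h
      have h1 := hR _ (hf.inverse_mem (hw'D n)) h
      rw [hfw] at h1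
      exact absurd h1 (hn₀ (n + n₀) (Nat.le_add_left _ _)).2.not_gt) (by
      intro v hv hcl
      simp only [hfw] at hcl
      obtain ⟨ψ, hψ, hψlim⟩ := hcl.tendsto_subseq
      rw [tendsto_nhds_unique hψlim (hw'p.comp hψ.tendsto_atTop)] at hv
      exact hpD hv)
  -- `x` is the limit along one sequence; it is not zero since `f` tends to `0` there, and Koebe's
  -- lemma for `(f - p) / (f + i)` makes it the limit along all sequences
  refine ⟨x, ?_, ?_⟩
  · rintro rfl
    rw [Complex.ofReal_zero] at hlim
    have h1 : Tendsto (fun n => f (inverseMap f (w' (θ n)))) atTop (𝓝 0) :=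
      hf.tendsto_zero.comp (tendsto_nhdsWithin_iff.2 ⟨hlim, Eventually.of_forall fun n =>
        hf.inverse_mem (hw'D _)⟩)
    simp only [hfw] at h1
    have := tendsto_nhds_unique h1 (hw'p.comp hθ.tendsto_atTop)
    exact ne_zero_of_mem_upperHalf hpH this.symm
  rw [Metric.tendsto_nhdsWithin_nhds]
  intro d hd
  have hne : ∀ z ∈ upperHalf, f z + Complex.I ≠ 0 := fun z hz => by
    have := one_le_norm_add_I (hf.mapsTo hz)
    exact norm_pos_iff.1 (by linarith)
  have hφ : DifferentiableOn ℂ (fun z => (f z - p) / (f z + Complex.I)) upperHalf :=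
    (hf.differentiableOn.sub_const _).div (hf.differentiableOn.add_const _) hne
  obtain ⟨ε, hε, hpath⟩ := exists_pos_forall_path_not_small hφ (M := 1 + ‖p + Complex.I‖)
    (fun z hz => by
      have h1 := one_le_norm_add_I (hf.mapsTo hz)
      have h2 : ‖f z - p‖ ≤ ‖f z + Complex.I‖ + ‖p + Complex.I‖ := by
        simpa using norm_sub_le (f z + Complex.I) (p + Complex.I)
      rw [norm_div, div_le_iff₀ (by linarith)]
      nlinarith [norm_nonneg (p + Complex.I)]) (fun z hz =>
      div_ne_zero (sub_ne_zero.2 fun h => hpD (h ▸ hf.log_mem hz)) (hne z hz)) x hd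
  obtain ⟨r, hr, hrε⟩ := Metric.continuousAt_iff.1
    (Complex.continuous_exp.continuousAt (x := l t)) ε hε
  obtain ⟨δ, hδ, hjoin⟩ := hl.joinedIn_near_tip hτ ht hr
  obtain ⟨δ', hδ', hlog⟩ := Metric.continuousAt_iff.1
    (differentiableAt_log_of_mem_upperHalf hpH).continuousAt δ hδ
  rw [hlogp] at hlog
  have e1 : ∀ᶠ n in atTop, ‖inverseMap f (w' (θ n)) - x‖ < d / 4 :=
    (tendsto_iff_norm_sub_tendsto_zero.1 hlim).eventually (gt_mem_nhds (by positivity))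
  have e2 : ∀ᶠ n in atTop, dist (w' (θ n)) p < δ' :=
    (hw'p.comp hθ.tendsto_atTop).eventually (Metric.ball_mem_nhds p hδ')
  obtain ⟨n, hn1, hn2⟩ := (e1.and e2).exists
  refine ⟨δ', hδ', fun v hv hvp => ?_⟩
  obtain ⟨β, hβ, hβim, hβW, hβ0, hβ1⟩ := hf.exists_path
    (hjoin _ ⟨hw'D (θ n), hlog hn2⟩ _ ⟨hv, hlog hvp⟩)
  have hexp : ∀ v ∈ D, Complex.exp (Complex.log v) = v := fun v hv =>
    Complex.exp_log (ne_zero_of_mem_upperHalf (im_pos_of_log_mem_strip hv.1))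
  rw [hexp _ (hw'D _)] at hβ0
  rw [hexp _ hv] at hβ1
  have hfin := hpath β hβ hβim (fun s hs => by
    have h1 := hrε (hβW s hs)
    have hz : β s ∈ upperHalf := hβim s hs
    rw [Complex.exp_log (ne_zero_of_mem_upperHalf (hf.mapsTo hz)), dist_eq_norm] at h1
    rw [norm_div]
    exact (div_le_self (norm_nonneg _) (one_le_norm_add_I (hf.mapsTo hz))).trans h1.le)
    (by rw [hβ0]; exact hn1)
  rw [dist_eq_norm, ← hβ1]
  exact hfin

theorem log_exp_mul (a : ℝ) {w : ℂ} (h : w ∈ upperHalf) :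
    Complex.log ((Real.exp a : ℂ) * w) = Complex.log w + a := by
  rw [Complex.log_ofReal_mul (Real.exp_pos a) (ne_zero_of_mem_upperHalf h), Real.log_exp, add_comm]

theorem log_exp_mul_mem {w : ℂ} (hw : Complex.log w ∈ logDomain τ₀ l t) (n : ℤ) :
    Complex.log ((Real.exp (n * τ₀) : ℂ) * w) ∈ logDomain τ₀ l t := by
  rw [log_exp_mul _ (im_pos_of_log_mem_strip hw.1)]
  push_cast
  exact add_mem_logDomain hw n

/-- The deck group of the domain of a normalized slit map is generated by a dilation. -/
theorem exists_dilation (hf : IsSlitMap τ₀ l t f) (hl : IsLogSlit τ₀ T l) (hτ : 0 < τ₀)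
    (ht : t ∈ Icc 0 T) :
    ∃ τ : ℝ, 0 < τ ∧ ∀ z ∈ upperHalf,
      f ((Real.exp τ : ℂ) * z) = (Real.exp τ₀ : ℂ) * f z := by
  -- conjugating a deck transformation by `f` gives an automorphism of the half-plane
  set conj : ℤ → ℂ → ℂ := fun n z => inverseMap f ((Real.exp (n * τ₀) : ℂ) * f z) with hconj
  have hmem : ∀ n : ℤ, ∀ z ∈ upperHalf,
      Complex.log ((Real.exp (n * τ₀) : ℂ) * f z) ∈ logDomain τ₀ l t := fun n z hz =>
    log_exp_mul_mem (hf.log_mem hz) n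
  have hmaps : ∀ n : ℤ, MapsTo (conj n) upperHalf upperHalf := fun n z hz =>
    hf.inverse_mem (hmem n z hz)
  have hdiff : ∀ n : ℤ, DifferentiableOn ℂ (conj n) upperHalf := by
    intro n z hz
    have h1 : DifferentiableAt ℂ (fun z => (Real.exp (n * τ₀) : ℂ) * f z) z :=
      (hf.differentiableOn.differentiableAt (isOpen_upperHalf.mem_nhds hz)).const_mul _
    exact (DifferentiableAt.comp (f := fun z => (Real.exp (n * τ₀) : ℂ) * f z) z
      (hf.differentiableAt_inverse (hmem n z hz)) h1).differentiableWithinAt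
  have hfc : ∀ n : ℤ, ∀ z ∈ upperHalf, f (conj n z) = (Real.exp (n * τ₀) : ℂ) * f z :=
    fun n z hz => hf.apply_inverse (hmem n z hz)
  have hnorm : ∀ z, ‖(Real.exp (((1 : ℤ) : ℝ) * τ₀) : ℂ) * f z‖ = Real.exp τ₀ * ‖f z‖ := by
    intro z
    rw [norm_mul, Complex.norm_real, Real.norm_eq_abs, Real.abs_exp]
    simp
  obtain ⟨a, ha, hψ⟩ := exists_eq_mul_of_automorphism (hdiff 1) (hdiff (-1)) (hmaps 1) (hmaps (-1))
    (by
      intro z hz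
      have h1 := hfc 1 z hz
      have h2 : conj (-1) (conj 1 z) = inverseMap f (f z) := by
        change inverseMap f ((Real.exp (((-1 : ℤ) : ℝ) * τ₀) : ℂ) * f (conj 1 z)) = _
        rw [h1, ← mul_assoc, ← Complex.ofReal_mul, ← Real.exp_add]
        simp
      rw [h2, hf.inverse_apply hz])
    (by
      rw [Metric.tendsto_nhdsWithin_nhds]
      intro r hr
      obtain ⟨δ, hδ, h1⟩ := hf.inverse_exists_norm_lt hl hτ ht hr
      obtain ⟨δ', hδ', h2⟩ := hf.exists_norm_lt (ε := δ / Real.exp τ₀) (by positivity)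
      refine ⟨δ', hδ', fun z hz hzδ => ?_⟩
      rw [dist_zero_right] at hzδ ⊢
      refine h1 _ (hmem 1 z hz) ?_
      rw [hnorm, mul_comm]
      exact (lt_div_iff₀ (Real.exp_pos _)).1 (h2 z hz hzδ))
    (by
      rw [← tendsto_norm_atTop_iff_cobounded, tendsto_atTop]
      intro R
      obtain ⟨N, h1⟩ := hf.inverse_exists_lt_norm hl hτ ht R
      obtain ⟨R', h2⟩ := hf.exists_lt_norm (max N 0)
      rw [eventually_inf_principal, ← comap_norm_atTop, eventually_comap]
      filter_upwards [eventually_gt_atTop R'] with b hb z hzb hz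
      refine (h1 _ (hmem 1 z hz) ?_).le
      rw [hnorm]
      have h3 := h2 z hz (by rw [hzb]; exact hb)
      have h4 : (1 : ℝ) ≤ Real.exp τ₀ := Real.one_le_exp hτ.le
      calc N ≤ max N 0 := le_max_left _ _
        _ < ‖f z‖ := h3
        _ ≤ _ := le_mul_of_one_le_left (norm_nonneg _) h4)
  have hfa : ∀ z ∈ upperHalf, f ((a : ℂ) * z) = (Real.exp τ₀ : ℂ) * f z := by
    intro z hz
    rw [← hψ z hz, hfc 1 z hz]
    simp
  have hI : Complex.I ∈ upperHalf := by simp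
  have hfI : 0 < ‖f Complex.I‖ := norm_pos_iff.2 (ne_zero_of_mem_upperHalf (hf.mapsTo hI))
  have hexp : 1 < Real.exp τ₀ := Real.one_lt_exp_iff.2 hτ
  -- iterating a contraction leads to `0`, where `f` is small, while the values of `f` grow
  have ha1 : 1 < a := by
    by_contra! hle
    have hpow : ∀ n : ℕ, (((a ^ n : ℝ) : ℂ) * Complex.I ∈ upperHalf) := fun n => by
      simpa [mem_upperHalf, ← Complex.ofReal_pow] using pow_pos ha n
    have hiter : ∀ n : ℕ, ‖f (((a ^ n : ℝ) : ℂ) * Complex.I)‖ =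
        Real.exp τ₀ ^ n * ‖f Complex.I‖ := by
      intro n
      induction n with
      | zero => simp
      | succ n ih =>
        have e : ((a ^ (n + 1) : ℝ) : ℂ) * Complex.I = a * (((a ^ n : ℝ) : ℂ) * Complex.I) := by
          push_cast; ring
        rw [e, hfa _ (hpow n), norm_mul, ih, Complex.norm_real, Real.norm_eq_abs, Real.abs_exp]
        ring
    rcases hle.eq_or_lt with h | h
    · have := hiter 1
      simp only [h, Complex.ofReal_one, one_mul, pow_one] at this
      nlinarith
    · obtain ⟨δ, hδ, h1⟩ := hf.exists_norm_lt hfI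
      obtain ⟨n, hn⟩ := exists_pow_lt_of_lt_one hδ h
      have h2 := h1 _ (hpow n) (by
        rw [norm_mul, Complex.norm_I, mul_one, Complex.norm_real, Real.norm_eq_abs,
          abs_of_pos (pow_pos ha n)]
        exact hn)
      rw [hiter n] at h2
      have h3 : (1 : ℝ) ≤ Real.exp τ₀ ^ n := one_le_pow₀ hexp.le
      nlinarith
  exact ⟨Real.log a, Real.log_pos ha1, fun z hz => by rw [Real.exp_log ha, hfa z hz]⟩

end IsSlitMap
end AnnulusLoewner

/-! ### Fourier expansion of periodic functions on the strip -/

namespace AnnulusLoewner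

/-- Horizontal translation invariance of the integral over one period of a periodic holomorphic
function on a horizontal strip (Cauchy's theorem on a rectangle one period wide). -/
theorem integral_period_eq {R : ℂ → ℂ} {τ y₀ y₁ : ℝ}
    (hR : DifferentiableOn ℂ R {z | y₀ < z.im ∧ z.im < y₁})
    (hper : ∀ z : ℂ, y₀ < z.im → z.im < y₁ → R (z + τ) = R z) {y y' : ℝ} (hy : y ∈ Ioo y₀ y₁)
    (hy' : y' ∈ Ioo y₀ y₁) :
    ∫ x in (0 : ℝ)..τ, R (x + y * Complex.I) = ∫ x in (0 : ℝ)..τ, R (x + y' * Complex.I) := by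
  have h := Complex.integral_boundary_rect_eq_zero_of_differentiableOn R (y * Complex.I)
    (τ + y' * Complex.I) (hR.mono (by
      intro z hz
      have h2 : z.im ∈ uIcc y y' := by simpa using hz.2
      have h3 := (uIcc_subset_Icc (Ioo_subset_Icc_self hy) (Ioo_subset_Icc_self hy')) h2
      rcases le_total y y' with h4 | h4
      · rw [uIcc_of_le h4] at h2
        exact ⟨hy.1.trans_le h2.1, h2.2.trans_lt hy'.2⟩
      · rw [uIcc_of_ge h4] at h2
        exact ⟨hy'.1.trans_le h2.1, h2.2.trans_lt hy.2⟩))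
  have hv : ∫ v in y..y', R ((τ : ℂ) + v * Complex.I) = ∫ v in y..y', R ((0 : ℂ) + v * Complex.I) := by
    refine intervalIntegral.integral_congr fun v hv => ?_
    have h3 : v ∈ Ioo y₀ y₁ := by
      rcases le_total y y' with h4 | h4
      · rw [uIcc_of_le h4] at hv
        exact ⟨hy.1.trans_le hv.1, hv.2.trans_lt hy'.2⟩
      · rw [uIcc_of_ge h4] at hv
        exact ⟨hy'.1.trans_le hv.1, hv.2.trans_lt hy.2⟩
    have := hper (0 + v * Complex.I) (by simpa using h3.1) (by simpa using h3.2)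
    rw [← this]
    congr 1
    ring
  simp at h
  simp only [zero_add] at hv
  rw [hv] at h
  linear_combination h

/-- The frequency `2 π n / τ`. -/
noncomputable def freq (τ : ℝ) (n : ℤ) : ℝ := 2 * Real.pi * n / τ

/-- The `n`-th Fourier coefficient of a `τ`-periodic holomorphic function on the strip, in the
expansion `∑ qₙ e^{i ωₙ ζ}`; it is computed on the central line of the strip. -/
noncomputable def stripCoeff (τ : ℝ) (R : ℂ → ℂ) (n : ℤ) : ℂ :=
  (1 / τ : ℝ) * ∫ x in (0 : ℝ)..τ, R (x + (Real.pi / 2 : ℝ) * Complex.I) *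
    Complex.exp (-(Complex.I * freq τ n * (x + (Real.pi / 2 : ℝ) * Complex.I)))

theorem freq_mul (τ : ℝ) (hτ : 0 < τ) (n : ℤ) : freq τ n * τ = 2 * Real.pi * n := by
  rw [freq]; field_simp

theorem freq_neg (τ : ℝ) (n : ℤ) : freq τ (-n) = -freq τ n := by
  simp [freq]; ring

theorem exp_freq_periodic {τ : ℝ} (hτ : 0 < τ) (n : ℤ) (z : ℂ) :
    Complex.exp (-(Complex.I * freq τ n * (z + τ))) = Complex.exp (-(Complex.I * freq τ n * z)) := by
  have h : (freq τ n : ℂ) * τ = 2 * Real.pi * n := by exact_mod_cast freq_mul τ hτ n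
  rw [mul_add, neg_add, Complex.exp_add]
  have : -(Complex.I * freq τ n * τ) = ((-n : ℤ) : ℂ) * (2 * Real.pi * Complex.I) := by
    push_cast
    linear_combination (-Complex.I) * h
  rw [this, Complex.exp_int_mul_two_pi_mul_I, mul_one]

theorem mem_strip_of_Ioo {y : ℝ} (hy : y ∈ Ioo 0 Real.pi) (x : ℝ) :
    (x : ℂ) + y * Complex.I ∈ strip := by
  simpa [strip] using hy

theorem half_pi_mem : Real.pi / 2 ∈ Ioo 0 Real.pi :=
  ⟨by positivity, by linarith [Real.pi_pos]⟩

/-- On every horizontal line of the strip the Fourier coefficients are `qₙ e^{-ωₙ y}`. -/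
theorem integral_mul_exp_eq {R : ℂ → ℂ} {τ : ℝ} (hτ : 0 < τ) (hR : DifferentiableOn ℂ R strip)
    (hper : ∀ z ∈ strip, R (z + τ) = R z) (n : ℤ) {y : ℝ} (hy : y ∈ Ioo 0 Real.pi) :
    ∫ x in (0 : ℝ)..τ, R (x + y * Complex.I) * Complex.exp (-(Complex.I * freq τ n * x)) =
      τ * (stripCoeff τ R n * Complex.exp (-(freq τ n * y))) := by
  have h := integral_period_eq (R := fun z => R z * Complex.exp (-(Complex.I * freq τ n * z)))
    (τ := τ) (y₀ := 0) (y₁ := Real.pi)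
    (hR.mul (by fun_prop)) (fun z h1 h2 => by
      rw [hper z ⟨h1, h2⟩, exp_freq_periodic hτ]) hy half_pi_mem
  have e : ∀ x : ℝ, R (x + y * Complex.I) * Complex.exp (-(Complex.I * freq τ n * x)) =
      (R (x + y * Complex.I) * Complex.exp (-(Complex.I * freq τ n * (x + y * Complex.I)))) *
        Complex.exp (-(freq τ n * y)) := by
    intro x
    rw [mul_assoc (R _), ← Complex.exp_add]
    congr 2
    linear_combination (freq τ n * y : ℂ) * Complex.I_sq
  simp_rw [e]
  rw [intervalIntegral.integral_mul_const, h, stripCoeff]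
  have h0 : (τ : ℂ) ≠ 0 := by exact_mod_cast hτ.ne'
  generalize (∫ x in (0 : ℝ)..τ, R (x + (Real.pi / 2 : ℝ) * Complex.I) *
    Complex.exp (-(Complex.I * freq τ n * (x + (Real.pi / 2 : ℝ) * Complex.I)))) = J
  push_cast
  field_simp

theorem continuous_line {R : ℂ → ℂ} (hR : DifferentiableOn ℂ R strip) {y : ℝ}
    (hy : y ∈ Ioo 0 Real.pi) : Continuous fun x : ℝ => R (x + y * Complex.I) :=
  hR.continuousOn.comp_continuous (by fun_prop) fun x => mem_strip_of_Ioo hy x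

/-- Fourier expansion of a periodic holomorphic function on the strip. -/
theorem hasSum_stripCoeff {R : ℂ → ℂ} {τ : ℝ} (hτ : 0 < τ) (hR : DifferentiableOn ℂ R strip)
    (hper : ∀ z ∈ strip, R (z + τ) = R z) {z : ℂ} (hz : z ∈ strip)
    (hs : Summable fun n : ℤ => ‖stripCoeff τ R n‖ * Real.exp (-(freq τ n * z.im))) :
    HasSum (fun n : ℤ => stripCoeff τ R n * Complex.exp (Complex.I * freq τ n * z)) (R z) := by
  have : Fact (0 < τ) := ⟨hτ⟩
  set y := z.im with hy
  have hyI : y ∈ Ioo 0 Real.pi := hz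
  have hp : Function.Periodic (fun x : ℝ => R (x + y * Complex.I)) τ := by
    intro x
    have := hper _ (mem_strip_of_Ioo hyI x)
    beta_reduce
    rw [← this]
    push_cast
    ring_nf
  set F : C(AddCircle τ, ℂ) := ⟨hp.lift, continuous_coinduced_dom.2 (continuous_line hR hyI)⟩ with hF
  have hFx : ∀ x : ℝ, F (x : AddCircle τ) = R (x + y * Complex.I) := fun x => hp.lift_coe x
  have hco : ∀ n : ℤ, fourierCoeff F n = stripCoeff τ R n * Complex.exp (-(freq τ n * y)) := by
    intro n
    rw [fourierCoeff_eq_intervalIntegral F n 0, zero_add]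
    have e : ∀ x : ℝ, (fourier (-n) (x : AddCircle τ) : ℂ) • F (x : AddCircle τ) =
        R (x + y * Complex.I) * Complex.exp (-(Complex.I * freq τ n * x)) := by
      intro x
      rw [fourier_coe_apply, hFx, smul_eq_mul, mul_comm]
      congr 2
      rw [freq]
      push_cast
      ring
    simp_rw [e]
    rw [integral_mul_exp_eq hτ hR hper n hyI]
    have : (τ : ℂ) ≠ 0 := by exact_mod_cast hτ.ne'
    rw [Complex.real_smul]
    push_cast
    field_simp
  have hsum : Summable (fourierCoeff F) := by
    refine Summable.of_norm (hs.congr fun n => ?_)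
    rw [hco n, norm_mul, Complex.norm_exp]
    simp
  have h := has_pointwise_sum_fourier_series_of_summable hsum (z.re : AddCircle τ)
  rw [hFx] at h
  have hzz : (z.re : ℂ) + y * Complex.I = z := Complex.re_add_im z
  rw [hzz] at h
  refine h.congr_fun fun n => ?_
  rw [hco n, fourier_coe_apply, smul_eq_mul, mul_assoc (stripCoeff τ R n), ← Complex.exp_add]
  congr 2
  conv_lhs => rw [← hzz]
  rw [freq]
  push_cast
  linear_combination (2 * Real.pi * n / τ * y : ℂ) * Complex.I_sq

end AnnulusLoewner

/-! ### Fourier coefficients of the imaginary part -/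

namespace AnnulusLoewner

/-- The periodic part `Q ζ + b ζ` of a function with `Q (ζ + τ) = Q ζ - b τ`. -/
def periodicPart (b : ℝ) (Q : ℂ → ℂ) (z : ℂ) : ℂ := Q z + b * z

/-- The `n`-th Fourier coefficient of `x ↦ Im Q (x + i y)` for a function with
`Q (ζ + τ) = Q ζ - b τ`, expressed by the coefficients of the periodic part of `Q`. -/
noncomputable def imMode (τ b : ℝ) (Q : ℂ → ℂ) (n : ℤ) (y : ℝ) : ℂ :=
  (stripCoeff τ (periodicPart b Q) n * Complex.exp (-(freq τ n * y)) -
    (starRingEnd ℂ) (stripCoeff τ (periodicPart b Q) (-n)) * Complex.exp (freq τ n * y)) /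
      (2 * Complex.I) - if n = 0 then (b * y : ℂ) else 0

theorem continuous_imMode (τ b : ℝ) (Q : ℂ → ℂ) (n : ℤ) : Continuous (imMode τ b Q n) := by
  unfold imMode
  split_ifs <;> fun_prop

theorem periodicPart_periodic {τ b : ℝ} {Q : ℂ → ℂ}
    (hper : ∀ z ∈ strip, Q (z + τ) = Q z - b * τ) :
    ∀ z ∈ strip, periodicPart b Q (z + τ) = periodicPart b Q z := by
  intro z hz
  rw [periodicPart, periodicPart, hper z hz]
  ring

theorem differentiableOn_periodicPart {b : ℝ} {Q : ℂ → ℂ} (hQ : DifferentiableOn ℂ Q strip) :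
    DifferentiableOn ℂ (periodicPart b Q) strip :=
  hQ.add (by fun_prop)

theorem freq_zero (τ : ℝ) : freq τ 0 = 0 := by simp [freq]

theorem freq_ne_zero {τ : ℝ} (hτ : 0 < τ) {n : ℤ} (hn : n ≠ 0) : freq τ n ≠ 0 := by
  have : (n : ℝ) ≠ 0 := by exact_mod_cast hn
  rw [freq]
  positivity

theorem integral_exp_freq {τ : ℝ} (hτ : 0 < τ) {n : ℤ} (hn : n ≠ 0) :
    ∫ x in (0 : ℝ)..τ, Complex.exp (-(Complex.I * freq τ n * x)) = 0 := by
  have hc : -(Complex.I * freq τ n) ≠ 0 := by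
    simpa using freq_ne_zero hτ hn
  have h := integral_exp_mul_complex (a := 0) (b := τ) hc
  have e := exp_freq_periodic hτ n 0
  simp only [zero_add, mul_zero, neg_zero] at e
  simp only [neg_mul] at h
  rw [h, e]
  simp

/-- The coefficients `imMode` are the Fourier integrals of `Im Q` on horizontal lines. For `n ≠ 0`
the linear term `b ζ` contributes nothing. -/
theorem integral_im_mul_exp {τ b : ℝ} {Q : ℂ → ℂ} (hτ : 0 < τ) (hQ : DifferentiableOn ℂ Q strip)
    (hper : ∀ z ∈ strip, Q (z + τ) = Q z - b * τ) (n : ℤ) {y : ℝ} (hy : y ∈ Ioo 0 Real.pi) :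
    ∫ x in (0 : ℝ)..τ, ((Q (x + y * Complex.I)).im : ℂ) * Complex.exp (-(Complex.I * freq τ n * x))
      = τ * imMode τ b Q n y := by
  have hRd := differentiableOn_periodicPart (b := b) hQ
  have hRp := periodicPart_periodic hper
  have h1 := integral_mul_exp_eq hτ hRd hRp n hy
  have h2 := integral_mul_exp_eq hτ hRd hRp (-n) hy
  have h3 := congrArg (starRingEnd ℂ) h2
  rw [← intervalIntegral.intervalIntegral_conj] at h3
  have hc := continuous_line hRd hy
  have e : ∀ x : ℝ, ((Q (x + y * Complex.I)).im : ℂ) * Complex.exp (-(Complex.I * freq τ n * x)) =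
      (periodicPart b Q (x + y * Complex.I) * Complex.exp (-(Complex.I * freq τ n * x)) -
        (starRingEnd ℂ) (periodicPart b Q (x + y * Complex.I) *
          Complex.exp (-(Complex.I * freq τ (-n) * x)))) / (2 * Complex.I) -
        b * y * Complex.exp (-(Complex.I * freq τ n * x)) := by
    intro x
    have e1 : (starRingEnd ℂ) (Complex.exp (-(Complex.I * freq τ (-n) * x))) =
        Complex.exp (-(Complex.I * freq τ n * x)) := by
      rw [← Complex.exp_conj, freq_neg]
      simp
    rw [map_mul, e1, ← sub_mul, Complex.sub_conj]
    have e2 : (periodicPart b Q (x + y * Complex.I)).im = (Q (x + y * Complex.I)).im + b * y := by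
      simp [periodicPart]
    rw [e2]
    push_cast
    field_simp
    ring
  simp_rw [e]
  have ci : ∀ m : ℤ, Continuous fun x : ℝ => periodicPart b Q (x + y * Complex.I) *
      Complex.exp (-(Complex.I * freq τ m * x)) := fun m => hc.mul (by fun_prop)
  have cc : Continuous fun x : ℝ => (starRingEnd ℂ) (periodicPart b Q (x + y * Complex.I) *
          Complex.exp (-(Complex.I * freq τ (-n) * x))) := Complex.continuous_conj.comp (ci (-n))
  have ce : Continuous fun x : ℝ => (b * y : ℂ) * Complex.exp (-(Complex.I * freq τ n * x)) := by
    fun_prop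
  have cd : Continuous fun x : ℝ => (periodicPart b Q (x + y * Complex.I) *
      Complex.exp (-(Complex.I * freq τ n * x)) -
        (starRingEnd ℂ) (periodicPart b Q (x + y * Complex.I) *
          Complex.exp (-(Complex.I * freq τ (-n) * x)))) / (2 * Complex.I) :=
    ((ci n).sub cc).div_const _
  rw [intervalIntegral.integral_sub (cd.intervalIntegrable _ _)
    (ce.intervalIntegrable _ _), intervalIntegral.integral_div,
    intervalIntegral.integral_sub ((ci n).intervalIntegrable _ _) (cc.intervalIntegrable _ _), h1,
    h3, intervalIntegral.integral_const_mul, imMode]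
  have e3 : (starRingEnd ℂ) (τ * (stripCoeff τ (periodicPart b Q) (-n) *
      Complex.exp (-(freq τ (-n) * y)))) = τ * ((starRingEnd ℂ)
        (stripCoeff τ (periodicPart b Q) (-n)) * Complex.exp (freq τ n * y)) := by
    rw [map_mul, map_mul, ← Complex.exp_conj, freq_neg]
    simp
  rw [e3]
  split_ifs with hn
  · subst hn
    simp [freq_zero]
    ring
  · rw [integral_exp_freq hτ hn]
    ring

theorem imMode_zero (τ b : ℝ) (Q : ℂ → ℂ) (y : ℝ) :
    imMode τ b Q 0 y = (((stripCoeff τ (periodicPart b Q) 0).im - b * y : ℝ) : ℂ) := by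
  rw [imMode]
  simp only [freq_zero, Complex.ofReal_zero, zero_mul, neg_zero, Complex.exp_zero, mul_one,
    if_true, Complex.sub_conj]
  push_cast
  field_simp

theorem integral_im {τ b : ℝ} {Q : ℂ → ℂ} (hτ : 0 < τ) (hQ : DifferentiableOn ℂ Q strip)
    (hper : ∀ z ∈ strip, Q (z + τ) = Q z - b * τ) {y : ℝ} (hy : y ∈ Ioo 0 Real.pi) :
    ∫ x in (0 : ℝ)..τ, (Q (x + y * Complex.I)).im =
      τ * ((stripCoeff τ (periodicPart b Q) 0).im - b * y) := by
  have h := integral_im_mul_exp hτ hQ hper 0 hy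
  rw [imMode_zero] at h
  simp only [freq_zero, Complex.ofReal_zero, zero_mul, mul_zero, neg_zero, Complex.exp_zero, mul_one]
    at h
  rw [intervalIntegral.integral_ofReal] at h
  exact_mod_cast h

theorem continuous_im_line {Q : ℂ → ℂ} (hQ : DifferentiableOn ℂ Q strip) {y : ℝ}
    (hy : y ∈ Ioo 0 Real.pi) : Continuous fun x : ℝ => (Q (x + y * Complex.I)).im :=
  Complex.continuous_im.comp (continuous_line hQ hy)

theorem norm_exp_freq (τ : ℝ) (n : ℤ) (x : ℝ) :
    ‖Complex.exp (-(Complex.I * freq τ n * x))‖ = 1 := by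
  rw [Complex.norm_exp]
  simp

theorem norm_imMode_le_of_abs_le {τ b ε : ℝ} {Q : ℂ → ℂ} (hτ : 0 < τ)
    (hQ : DifferentiableOn ℂ Q strip) (hper : ∀ z ∈ strip, Q (z + τ) = Q z - b * τ) (n : ℤ) {y : ℝ}
    (hy : y ∈ Ioo 0 Real.pi) (h : ∀ x : ℝ, |(Q (x + y * Complex.I)).im| ≤ ε) :
    ‖imMode τ b Q n y‖ ≤ ε := by
  have h1 := integral_im_mul_exp hτ hQ hper n hy
  have h2 := intervalIntegral.norm_integral_le_of_norm_le_const (a := 0) (b := τ) (C := ε)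
    (f := fun x : ℝ => ((Q (x + y * Complex.I)).im : ℂ) *
      Complex.exp (-(Complex.I * freq τ n * x))) (fun x _ => by
        rw [norm_mul, norm_exp_freq, mul_one, Complex.norm_real]
        exact h x)
  rw [h1, norm_mul, Complex.norm_real, Real.norm_of_nonneg hτ.le, sub_zero, abs_of_pos hτ,
    mul_comm] at h2
  exact le_of_mul_le_mul_right h2 hτ

/-- If `|Im Q| ≤ σ Im Q + c` on a line, the mean of `Im Q` bounds all its Fourier coefficients. -/
theorem norm_imMode_le_of_abs_le_mul_add {τ b σ c : ℝ} {Q : ℂ → ℂ} (hτ : 0 < τ)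
    (hQ : DifferentiableOn ℂ Q strip) (hper : ∀ z ∈ strip, Q (z + τ) = Q z - b * τ) (n : ℤ) {y : ℝ}
    (hy : y ∈ Ioo 0 Real.pi)
    (h : ∀ x : ℝ, |(Q (x + y * Complex.I)).im| ≤ σ * (Q (x + y * Complex.I)).im + c) :
    ‖imMode τ b Q n y‖ ≤ σ * ((stripCoeff τ (periodicPart b Q) 0).im - b * y) + c := by
  have h1 := integral_im_mul_exp hτ hQ hper n hy
  have hc := continuous_im_line hQ hy
  have i1 : Continuous fun x : ℝ => σ * (Q (x + y * Complex.I)).im := continuous_const.mul hc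
  have h2 := intervalIntegral.norm_integral_le_of_norm_le (μ := volume) hτ.le
    (f := fun x : ℝ => ((Q (x + y * Complex.I)).im : ℂ) *
      Complex.exp (-(Complex.I * freq τ n * x)))
    (g := fun x : ℝ => σ * (Q (x + y * Complex.I)).im + c) (Eventually.of_forall fun x _ => by
        rw [norm_mul, norm_exp_freq, mul_one, Complex.norm_real]
        exact h x)
    ((i1.add continuous_const).intervalIntegrable _ _)
  rw [h1, intervalIntegral.integral_add (i1.intervalIntegrable _ _)
    (continuous_const.intervalIntegrable _ _), intervalIntegral.integral_const_mul,
    integral_im hτ hQ hper hy, norm_mul, Complex.norm_real, Real.norm_of_nonneg hτ.le] at h2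
  simp only [intervalIntegral.integral_const, smul_eq_mul, sub_zero] at h2
  refine le_of_mul_le_mul_left (h2.trans_eq ?_) hτ
  ring

theorem exp_freq_shift {τ : ℝ} (hτ : 0 < τ) (n k : ℤ) (x : ℝ) :
    Complex.exp (-(Complex.I * freq τ n * (x + k * τ : ℝ))) =
      Complex.exp (-(Complex.I * freq τ n * x)) := by
  have h : (freq τ n : ℂ) * τ = 2 * Real.pi * n := by exact_mod_cast freq_mul τ hτ n
  have : -(Complex.I * freq τ n * (x + k * τ : ℝ)) =
      -(Complex.I * freq τ n * x) + ((-(n * k) : ℤ) : ℂ) * (2 * Real.pi * Complex.I) := by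
    push_cast
    linear_combination (-Complex.I * k) * h
  rw [this, Complex.exp_add, Complex.exp_int_mul_two_pi_mul_I, mul_one]

theorem norm_exp_freq_sub_le (τ : ℝ) (n : ℤ) (x x' : ℝ) :
    ‖Complex.exp (-(Complex.I * freq τ n * x)) - Complex.exp (-(Complex.I * freq τ n * x'))‖ ≤
      |freq τ n| * |x - x'| := by
  have : Complex.exp (-(Complex.I * freq τ n * x)) - Complex.exp (-(Complex.I * freq τ n * x')) =
      Complex.exp (-(Complex.I * freq τ n * x')) *
        (Complex.exp (Complex.I * (-(freq τ n * (x - x')) : ℝ)) - 1) := by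
    rw [mul_sub, ← Complex.exp_add, mul_one]
    congr 2
    push_cast
    ring
  rw [this, norm_mul, norm_exp_freq, one_mul]
  refine Real.norm_exp_I_mul_ofReal_sub_one_le.trans ?_
  rw [Real.norm_eq_abs, abs_neg, abs_mul]

/-- If `Im Q` is nonnegative up to `ε` on a line and small off an `η`-neighbourhood of
`x₀ + τ ℤ`, its Fourier coefficients are almost those of a point mass at `x₀`. -/
theorem norm_imMode_sub_le {τ b ε η x₀ : ℝ} {Q : ℂ → ℂ} (hτ : 0 < τ)
    (hQ : DifferentiableOn ℂ Q strip) (hper : ∀ z ∈ strip, Q (z + τ) = Q z - b * τ) (n : ℤ) {y : ℝ}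
    (hε : 0 ≤ ε) (hη : 0 ≤ η)
    (hy : y ∈ Ioo 0 Real.pi) (h : ∀ x : ℝ, -ε ≤ (Q (x + y * Complex.I)).im)
    (hoff : ∀ x : ℝ, (∀ k : ℤ, η ≤ |x - x₀ - k * τ|) → |(Q (x + y * Complex.I)).im| ≤ ε) :
    ‖imMode τ b Q n y - Complex.exp (-(Complex.I * freq τ n * x₀)) *
        ((stripCoeff τ (periodicPart b Q) 0).im - b * y : ℝ)‖ ≤
      |freq τ n| * η * ((stripCoeff τ (periodicPart b Q) 0).im - b * y + 2 * ε) + 2 * ε := by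
  have h1 := integral_im_mul_exp hτ hQ hper n hy
  have hc := continuous_im_line hQ hy
  have h0 := integral_im hτ hQ hper hy
  have hcc : Continuous fun x : ℝ => ((Q (x + y * Complex.I)).im : ℂ) :=
    Complex.continuous_ofReal.comp hc
  set m := (stripCoeff τ (periodicPart b Q) 0).im - b * y
  set w := Complex.exp (-(Complex.I * freq τ n * x₀)) with hw
  have hi : ∫ x in (0 : ℝ)..τ, ((Q (x + y * Complex.I)).im : ℂ) *
      (Complex.exp (-(Complex.I * freq τ n * x)) - w) = τ * (imMode τ b Q n y - w * (m : ℝ)) := by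
    simp_rw [mul_sub]
    have i1 : Continuous fun x : ℝ => ((Q (x + y * Complex.I)).im : ℂ) *
        Complex.exp (-(Complex.I * freq τ n * x)) := hcc.mul (by fun_prop)
    have i2 : Continuous fun x : ℝ => ((Q (x + y * Complex.I)).im : ℂ) * w :=
      hcc.mul continuous_const
    rw [intervalIntegral.integral_sub (i1.intervalIntegrable _ _) (i2.intervalIntegrable _ _), h1,
      intervalIntegral.integral_mul_const,
      intervalIntegral.integral_ofReal, h0]
    push_cast
    ring
  have hwn : ‖w‖ = 1 := norm_exp_freq τ n x₀
  have hpt : ∀ x : ℝ, ‖((Q (x + y * Complex.I)).im : ℂ) *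
      (Complex.exp (-(Complex.I * freq τ n * x)) - w)‖ ≤
        (|freq τ n| * η) * ((Q (x + y * Complex.I)).im + 2 * ε) + 2 * ε := by
    intro x
    rw [norm_mul, Complex.norm_real, Real.norm_eq_abs]
    have hfn : 0 ≤ |freq τ n| * η := by positivity
    have ha : |(Q (x + y * Complex.I)).im| ≤ (Q (x + y * Complex.I)).im + 2 * ε :=
      abs_le.2 ⟨by linarith [h x], by linarith⟩
    by_cases hx : ∀ k : ℤ, η ≤ |x - x₀ - k * τ|
    · have h2 : ‖Complex.exp (-(Complex.I * freq τ n * x)) - w‖ ≤ 2 := by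
        refine (norm_sub_le _ _).trans ?_
        rw [norm_exp_freq, hwn]
        norm_num
      have h3 := hoff x hx
      have h4 := mul_nonneg hfn ((abs_nonneg _).trans ha)
      nlinarith [mul_le_mul h3 h2 (norm_nonneg _) hε]
    · push Not at hx
      obtain ⟨k, hk⟩ := hx
      have h2 := norm_exp_freq_sub_le τ n x (x₀ + k * τ)
      rw [exp_freq_shift hτ n k x₀, ← hw, ← sub_sub] at h2
      have h3 : ‖Complex.exp (-(Complex.I * freq τ n * x)) - w‖ ≤ |freq τ n| * η :=
        h2.trans (mul_le_mul_of_nonneg_left hk.le (abs_nonneg _))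
      have h4 := mul_le_mul ha h3 (norm_nonneg _) ((abs_nonneg _).trans ha)
      linarith
  have h2 := intervalIntegral.norm_integral_le_of_norm_le (μ := volume) hτ.le
    (f := fun x : ℝ => ((Q (x + y * Complex.I)).im : ℂ) *
      (Complex.exp (-(Complex.I * freq τ n * x)) - w))
    (g := fun x : ℝ => (|freq τ n| * η) * ((Q (x + y * Complex.I)).im + 2 * ε) + 2 * ε)
    (Eventually.of_forall fun x _ => hpt x)
    ((((hc.add continuous_const).const_mul _).add continuous_const).intervalIntegrable _ _)
  have h5 : ∫ x in (0 : ℝ)..τ, ((|freq τ n| * η) * ((Q (x + y * Complex.I)).im + 2 * ε) + 2 * ε) =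
      τ * (|freq τ n| * η * (m + 2 * ε) + 2 * ε) := by
    have i1 : Continuous fun x : ℝ => (|freq τ n| * η) * ((Q (x + y * Complex.I)).im + 2 * ε) :=
      continuous_const.mul (hc.add continuous_const)
    rw [intervalIntegral.integral_add (i1.intervalIntegrable _ _)
      (continuous_const.intervalIntegrable _ _), intervalIntegral.integral_const_mul,
      intervalIntegral.integral_add (hc.intervalIntegrable _ _)
      (continuous_const.intervalIntegrable _ _), h0]
    simp only [intervalIntegral.integral_const, smul_eq_mul, sub_zero]
    ring
  rw [hi, h5, norm_mul, Complex.norm_real, Real.norm_of_nonneg hτ.le] at h2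
  exact le_of_mul_le_mul_left h2 hτ

end AnnulusLoewner

/-! ### Functions with concentrated boundary values -/

namespace AnnulusLoewner

/-- A holomorphic function `Q` on the strip with `Q (ζ + τ) = Q ζ - b τ`, whose imaginary part
tends to `0` at the top side, is nonnegative at the bottom side, and tends to `0` at the bottom
side away from the `η`-neighbourhood of `x₀ + τ ℤ`. -/
structure HasStripBoundary (τ x₀ η b : ℝ) (Q : ℂ → ℂ) : Prop where
  differentiableOn : DifferentiableOn ℂ Q strip
  map_add : ∀ z ∈ strip, Q (z + τ) = Q z - b * τ
  top : ∀ ε > 0, ∃ δ > 0, ∀ z ∈ strip, Real.pi - δ < z.im → |(Q z).im| ≤ ε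
  bottom : ∀ ε > 0, ∃ δ > 0, ∀ z ∈ strip, z.im < δ → -ε ≤ (Q z).im
  off : ∀ ε > 0, ∃ δ > 0, ∀ z ∈ strip, z.im < δ → (∀ k : ℤ, η ≤ |z.re - x₀ - k * τ|) →
    |(Q z).im| ≤ ε

theorem le_of_le_near_zero {F G : ℝ → ℝ} (hF : Continuous F) (hG : Continuous G)
    (h : ∀ ε > 0, ∃ δ > 0, ∀ y ∈ Ioo 0 Real.pi, y < δ → F y ≤ G y + ε) : F 0 ≤ G 0 := by
  refine le_of_forall_pos_le_add fun ε hε => ?_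
  obtain ⟨δ, hδ, hd⟩ := h ε hε
  refine le_of_tendsto_of_tendsto ((hF.tendsto 0).mono_left (nhdsWithin_le_nhds (s := Ioi 0)))
    (((hG.add continuous_const).tendsto 0).mono_left nhdsWithin_le_nhds) ?_
  filter_upwards [Ioo_mem_nhdsGT (lt_min hδ Real.pi_pos)] with y hy
  exact hd y ⟨hy.1, hy.2.trans_le (min_le_right _ _)⟩ (hy.2.trans_le (min_le_left _ _))

theorem le_of_le_near_pi {F G : ℝ → ℝ} (hF : Continuous F) (hG : Continuous G)
    (h : ∀ ε > 0, ∃ δ > 0, ∀ y ∈ Ioo 0 Real.pi, Real.pi - δ < y → F y ≤ G y + ε) :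
    F Real.pi ≤ G Real.pi := by
  refine le_of_forall_pos_le_add fun ε hε => ?_
  obtain ⟨δ, hδ, hd⟩ := h ε hε
  refine le_of_tendsto_of_tendsto
    ((hF.tendsto Real.pi).mono_left (nhdsWithin_le_nhds (s := Iio Real.pi)))
    (((hG.add continuous_const).tendsto Real.pi).mono_left nhdsWithin_le_nhds) ?_
  filter_upwards [Ioo_mem_nhdsLT (max_lt (sub_lt_self Real.pi hδ) Real.pi_pos)] with y hy
  exact hd y ⟨(le_max_right _ _).trans_lt hy.1, hy.2⟩ ((le_max_left _ _).trans_lt hy.1)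

theorem line_mem_strip {y : ℝ} (hy : y ∈ Ioo 0 Real.pi) (x : ℝ) :
    (x : ℂ) + y * Complex.I ∈ strip ∧ ((x : ℂ) + y * Complex.I).im = y ∧
      ((x : ℂ) + y * Complex.I).re = x :=
  ⟨mem_strip_of_Ioo hy x, by simp, by simp⟩

/-- If the Fourier coefficients of `Im Q` vanish at the top side, those at the bottom side
determine the coefficients of `Q`. -/
theorem stripCoeff_of_imMode_pi_eq_zero {τ b : ℝ} {Q : ℂ → ℂ} {n : ℤ} (hn : n ≠ 0)
    (h : imMode τ b Q n Real.pi = 0) :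
    (1 - Real.exp (-(2 * freq τ n * Real.pi)) : ℝ) * stripCoeff τ (periodicPart b Q) n =
      2 * Complex.I * imMode τ b Q n 0 := by
  rw [imMode, if_neg hn] at h ⊢
  set q := stripCoeff τ (periodicPart b Q) n
  set p := (starRingEnd ℂ) (stripCoeff τ (periodicPart b Q) (-n))
  have h1 : q * Complex.exp (-(freq τ n * Real.pi)) - p * Complex.exp (freq τ n * Real.pi) = 0 := by
    have : (2 * Complex.I) ≠ 0 := by simp
    field_simp at h
    simpa using h
  have h2 : p = q * Complex.exp (-(2 * freq τ n * Real.pi)) := by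
    have e : Complex.exp (-(2 * freq τ n * Real.pi)) =
        Complex.exp (-(freq τ n * Real.pi)) * Complex.exp (-(freq τ n * Real.pi)) := by
      rw [← Complex.exp_add]; congr 1; ring
    have e2 : Complex.exp (freq τ n * Real.pi) * Complex.exp (-(freq τ n * Real.pi)) = 1 := by
      rw [← Complex.exp_add]; simp
    rw [e]
    linear_combination (-Complex.exp (-(freq τ n * Real.pi))) * h1 - p * e2
  rw [h2]
  push_cast
  simp
  field_simp

/-- A function with `Q (ζ + τ) = Q ζ - b τ` whose imaginary part is nonnegative at the bottom and
nonpositive at the top has `b ≥ 0`, with equality only for real constants. -/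
theorem nonneg_and_eq_const_of_boundary {τ b : ℝ} {Q : ℂ → ℂ} (hτ : 0 < τ)
    (hQ : DifferentiableOn ℂ Q strip) (hper : ∀ z ∈ strip, Q (z + τ) = Q z - b * τ)
    (htop : ∀ ε > 0, ∃ δ > 0, ∀ z ∈ strip, Real.pi - δ < z.im → (Q z).im ≤ ε)
    (hbot : ∀ ε > 0, ∃ δ > 0, ∀ z ∈ strip, z.im < δ → -ε ≤ (Q z).im) :
    0 ≤ b ∧ (b = 0 → ∃ lam : ℝ, ∀ z ∈ strip, Q z = lam) := by
  set m := (stripCoeff τ (periodicPart b Q) 0).im with hm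
  have h0 : ∀ n, ‖imMode τ b Q n 0‖ ≤ m - b * 0 := by
    intro n
    refine le_of_le_near_zero (F := fun y => ‖imMode τ b Q n y‖) (G := fun y => m - b * y)
      (continuous_imMode τ b Q n).norm (by fun_prop) fun ε hε => ?_
    obtain ⟨δ, hδ, hd⟩ := hbot (ε / 2) (by positivity)
    refine ⟨δ, hδ, fun y hy hyd => ?_⟩
    have := norm_imMode_le_of_abs_le_mul_add (σ := 1) (c := ε) hτ hQ hper n hy (fun x => by
      obtain ⟨h1, h2, -⟩ := line_mem_strip hy x
      have h3 := hd _ h1 (by rw [h2]; exact hyd)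
      exact abs_le.2 ⟨by linarith, by linarith⟩)
    linarith
  have h1 : ∀ n, ‖imMode τ b Q n Real.pi‖ ≤ -(m - b * Real.pi) := by
    intro n
    refine le_of_le_near_pi (F := fun y => ‖imMode τ b Q n y‖) (G := fun y => -(m - b * y))
      (continuous_imMode τ b Q n).norm (by fun_prop) fun ε hε => ?_
    obtain ⟨δ, hδ, hd⟩ := htop (ε / 2) (by positivity)
    refine ⟨δ, hδ, fun y hy hyd => ?_⟩
    have := norm_imMode_le_of_abs_le_mul_add (σ := -1) (c := ε) hτ hQ hper n hy (fun x => by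
      obtain ⟨h1, h2, -⟩ := line_mem_strip hy x
      have h3 := hd _ h1 (by rw [h2]; exact hyd)
      exact abs_le.2 ⟨by linarith, by linarith⟩)
    linarith
  have hm0 : 0 ≤ m := by have := (norm_nonneg _).trans (h0 0); linarith
  have hm1 : 0 ≤ b * Real.pi - m := by have := (norm_nonneg _).trans (h1 0); linarith
  refine ⟨le_of_mul_le_mul_right (by linarith : 0 * Real.pi ≤ b * Real.pi) Real.pi_pos, ?_⟩
  rintro rfl
  have hm2 : m = 0 := by linarith
  have hq : ∀ n : ℤ, n ≠ 0 → stripCoeff τ (periodicPart 0 Q) n = 0 := by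
    intro n hn
    have a0 : imMode τ 0 Q n 0 = 0 := by
      have := h0 n; rw [hm2] at this; exact norm_le_zero_iff.1 (by linarith)
    have a1 : imMode τ 0 Q n Real.pi = 0 := by
      have := h1 n; rw [hm2] at this; exact norm_le_zero_iff.1 (by linarith)
    have h3 := stripCoeff_of_imMode_pi_eq_zero hn a1
    rw [a0, mul_zero] at h3
    refine (mul_eq_zero.1 h3).resolve_left ?_
    rw [Complex.ofReal_eq_zero, sub_eq_zero]
    refine fun h => ?_
    rw [eq_comm, Real.exp_eq_one_iff, neg_eq_zero] at h
    exact mul_ne_zero (mul_ne_zero two_ne_zero (freq_ne_zero hτ hn)) Real.pi_pos.ne' h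
  refine ⟨(stripCoeff τ (periodicPart 0 Q) 0).re, fun z hz => ?_⟩
  have hs := hasSum_stripCoeff hτ (differentiableOn_periodicPart (b := 0) hQ)
    (periodicPart_periodic hper) hz (summable_of_ne_finset_zero (s := {0}) fun n hn => by
      rw [hq n (by simpa using hn)]; simp)
  have h4 := hs.unique (hasSum_single 0 fun n hn => by rw [hq n hn, zero_mul])
  have h5 : periodicPart 0 Q z = Q z := by simp [periodicPart]
  rw [h5] at h4
  rw [h4]
  simp only [freq_zero, Complex.ofReal_zero, mul_zero, zero_mul, Complex.exp_zero, mul_one]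
  exact Complex.ext (by simp) (by simpa using hm2)

namespace HasStripBoundary

variable {τ x₀ η b : ℝ} {Q : ℂ → ℂ}

theorem imMode_pi (hτ : 0 < τ) (h : HasStripBoundary τ x₀ η b Q) (n : ℤ) :
    imMode τ b Q n Real.pi = 0 := by
  refine norm_le_zero_iff.1 (le_of_le_near_pi (F := fun y => ‖imMode τ b Q n y‖)
    (G := fun y => 0) (continuous_imMode τ b Q n).norm continuous_const fun ε hε => ?_)
  obtain ⟨δ, hδ, hd⟩ := h.top ε hε
  refine ⟨δ, hδ, fun y hy hyd => ?_⟩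
  rw [zero_add]
  refine norm_imMode_le_of_abs_le hτ h.differentiableOn h.map_add n hy fun x => ?_
  obtain ⟨h1, h2, -⟩ := line_mem_strip hy x
  exact hd _ h1 (by rw [h2]; exact hyd)

/-- The total mass of the boundary values is determined by the drop over a period. -/
theorem im_stripCoeff_zero (hτ : 0 < τ) (h : HasStripBoundary τ x₀ η b Q) :
    (stripCoeff τ (periodicPart b Q) 0).im = b * Real.pi := by
  have h1 := h.imMode_pi hτ 0
  rw [imMode_zero] at h1
  have : (stripCoeff τ (periodicPart b Q) 0).im - b * Real.pi = 0 := by exact_mod_cast h1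
  linarith

/-- At the bottom side the coefficients of `Im Q` are those of a point mass `b π` at `x₀`, up to an
error proportional to `η`. -/
theorem norm_imMode_zero_sub_le (hτ : 0 < τ) (hη : 0 ≤ η) (h : HasStripBoundary τ x₀ η b Q)
    (n : ℤ) :
    ‖imMode τ b Q n 0 - Complex.exp (-(Complex.I * freq τ n * x₀)) * (b * Real.pi : ℝ)‖ ≤
      |freq τ n| * η * (b * Real.pi) := by
  have hm := h.im_stripCoeff_zero hτ
  set w := Complex.exp (-(Complex.I * freq τ n * x₀))
  have key := le_of_le_near_zero
    (F := fun y => ‖imMode τ b Q n y - w * (b * Real.pi - b * y : ℝ)‖)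
    (G := fun y => |freq τ n| * η * (b * Real.pi - b * y))
    (((continuous_imMode τ b Q n).sub (by fun_prop)).norm) (by fun_prop) fun ε hε => by
      set c := 2 * (|freq τ n| * η) + 2
      have hc : 0 < c := by positivity
      obtain ⟨δ, hδ, hd⟩ := h.bottom (ε / c) (by positivity)
      obtain ⟨δ', hδ', hd'⟩ := h.off (ε / c) (by positivity)
      refine ⟨min δ δ', lt_min hδ hδ', fun y hy hyd => ?_⟩
      have := norm_imMode_sub_le (ε := ε / c) (x₀ := x₀) hτ h.differentiableOn h.map_add n
        (by positivity) hη hy (fun x => by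
          obtain ⟨h1, h2, -⟩ := line_mem_strip hy x
          exact hd _ h1 (by rw [h2]; exact hyd.trans_le (min_le_left _ _))) (fun x hx => by
          obtain ⟨h1, h2, h3⟩ := line_mem_strip hy x
          exact hd' _ h1 (by rw [h2]; exact hyd.trans_le (min_le_right _ _))
            (by rw [h3]; exact hx))
      rw [hm] at this
      refine this.trans_eq ?_
      have hεc : ε / c * (2 * (|freq τ n| * η) + 2) = ε := div_mul_cancel₀ _ hc.ne'
      linear_combination hεc
  simpa using key

theorem summable_freq_mul_exp (hτ : 0 < τ) {y : ℝ} (hy : 0 < y) :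
    Summable fun n : ℤ => |freq τ n| * Real.exp (-(|freq τ n| * y)) := by
  have key : Summable fun n : ℕ => |freq τ n| * Real.exp (-(|freq τ n| * y)) := by
    have h1 : ‖Real.exp (-(2 * Real.pi / τ * y))‖ < 1 := by
      rw [Real.norm_of_nonneg (Real.exp_pos _).le, Real.exp_lt_one_iff]
      have := Real.pi_pos
      have : 0 < 2 * Real.pi / τ * y := by positivity
      linarith
    have h2 := (summable_pow_mul_geometric_of_norm_lt_one 1 h1).mul_left (2 * Real.pi / τ)
    refine h2.congr fun n => ?_
    have : |freq τ n| = 2 * Real.pi / τ * n := by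
      have := Real.pi_pos
      rw [freq, abs_of_nonneg (by positivity)]
      push_cast
      ring
    rw [this, ← Real.exp_nat_mul, pow_one, mul_assoc]
    congr 3
    ring
  refine Summable.of_nat_of_neg key (key.congr fun n => ?_)
  rw [freq_neg, abs_neg]

/-- The constant in the comparison of two functions with concentrated boundary values. -/
noncomputable def comparisonConst (τ y : ℝ) : ℝ :=
  ∑' n : ℤ, 2 * Real.pi / (1 - Real.exp (-(2 * freq τ 1 * Real.pi))) *
    (|freq τ n| * Real.exp (-(|freq τ n| * y)))

theorem one_sub_exp_pos (hτ : 0 < τ) : 0 < 1 - Real.exp (-(2 * freq τ 1 * Real.pi)) := by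
  have : 0 < freq τ 1 := by have := Real.pi_pos; simp only [freq]; positivity
  have h2 : 0 < 2 * freq τ 1 * Real.pi := by have := Real.pi_pos; positivity
  have : Real.exp (-(2 * freq τ 1 * Real.pi)) < 1 := Real.exp_lt_one_iff.2 (by linarith)
  linarith

/-- The factor relating the coefficients at the bottom side to those of `Q` is bounded below,
uniformly in `n`, relative to the exponentials in the Fourier series. -/
theorem one_sub_exp_mul_le (hτ : 0 < τ) {n : ℤ} (hn : n ≠ 0) {y : ℝ} (hy : y ≤ Real.pi) :
    (1 - Real.exp (-(2 * freq τ 1 * Real.pi))) * Real.exp (-(freq τ n * y)) ≤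
      |1 - Real.exp (-(2 * freq τ n * Real.pi))| * Real.exp (-(|freq τ n| * y)) := by
  have hpi := Real.pi_pos
  have hf1 : 0 < 2 * Real.pi / τ := by positivity
  have e : ∀ m : ℤ, freq τ m = 2 * Real.pi / τ * m := fun m => by rw [freq]; ring
  rcases lt_or_gt_of_ne hn with h | h
  · have h1 : (n : ℝ) ≤ -1 := by exact_mod_cast Int.le_sub_one_iff.2 h
    have h2 : freq τ n ≤ -freq τ 1 := by
      rw [e, e]; push_cast; nlinarith
    have h3 : 0 < freq τ 1 := by rw [e]; push_cast; linarith
    rw [abs_of_neg (by linarith : freq τ n < 0)]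
    have h4 : 1 ≤ Real.exp (-(2 * freq τ n * Real.pi)) := Real.one_le_exp (by nlinarith)
    rw [abs_of_nonpos (by linarith)]
    set ω := -freq τ n with hω
    have a : freq τ n = -ω := by rw [hω]; ring
    rw [a]
    have e1 : Real.exp (-(-ω * y)) = Real.exp (2 * ω * Real.pi) *
        Real.exp (-(ω * y)) * Real.exp (-(2 * ω * (Real.pi - y))) := by
      rw [← Real.exp_add, ← Real.exp_add]; congr 1; ring
    have e2 : Real.exp (-(2 * -ω * Real.pi)) = Real.exp (2 * ω * Real.pi) := by congr 1; ring
    have e3 : Real.exp (-(2 * ω * (Real.pi - y))) ≤ 1 := by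
      rw [Real.exp_le_one_iff]
      have : 0 ≤ ω * (Real.pi - y) := mul_nonneg (by linarith) (by linarith)
      linarith
    have e4 : Real.exp (2 * ω * Real.pi) * Real.exp (-(2 * freq τ 1 * Real.pi)) ≥ 1 := by
      rw [← Real.exp_add]
      exact Real.one_le_exp (by nlinarith)
    rw [e1, e2]
    have p1 := Real.exp_pos (2 * ω * Real.pi)
    have p2 := Real.exp_pos (-(ω * y))
    have hk := one_sub_exp_pos hτ
    calc _ = ((1 - Real.exp (-(2 * freq τ 1 * Real.pi))) * Real.exp (2 * ω * Real.pi)) *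
            Real.exp (-(ω * y)) * Real.exp (-(2 * ω * (Real.pi - y))) := by ring
      _ ≤ ((1 - Real.exp (-(2 * freq τ 1 * Real.pi))) * Real.exp (2 * ω * Real.pi)) *
            Real.exp (-(ω * y)) := mul_le_of_le_one_right (by positivity) e3
      _ ≤ _ := by
        refine mul_le_mul_of_nonneg_right ?_ p2.le
        nlinarith
  · have h1 : (1 : ℝ) ≤ n := by exact_mod_cast h
    have h2 : freq τ 1 ≤ freq τ n := by
      rw [e, e]; push_cast; nlinarith
    have h3 : 0 < freq τ 1 := by rw [e]; push_cast; linarith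
    rw [abs_of_pos (by linarith : 0 < freq τ n)]
    refine mul_le_mul_of_nonneg_right ((le_abs_self _).trans' ?_) (Real.exp_pos _).le
    gcongr

/-- Two functions with boundary values concentrated at the same point agree, up to the ratio of
their total masses and a real constant, with an error proportional to the mass and to the width
`η` of the concentration interval. -/
theorem exists_norm_sub_le (hτ : 0 < τ) (hη : 0 ≤ η) (h : HasStripBoundary τ x₀ η b Q)
    {E : ℂ → ℂ} (hE : ∀ η > 0, HasStripBoundary τ x₀ η 1 E) :
    ∃ lam : ℝ, ∀ z ∈ strip, ‖Q z - b * E z - lam‖ ≤ comparisonConst τ z.im * (b * η) := by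
  have hκ := one_sub_exp_pos hτ
  set κ := 1 - Real.exp (-(2 * freq τ 1 * Real.pi)) with hκd
  have hE1 := hE 1 one_pos
  set D : ℂ → ℂ := fun z => Q z - b * E z with hD
  have hDd : DifferentiableOn ℂ D strip :=
    h.differentiableOn.sub (hE1.differentiableOn.const_mul _)
  have hDp : ∀ z ∈ strip, D (z + τ) = D z := fun z hz => by
    simp only [hD]
    rw [h.map_add z hz, hE1.map_add z hz]
    push_cast
    ring
  have hlin : ∀ n, stripCoeff τ D n =
      stripCoeff τ (periodicPart b Q) n - b * stripCoeff τ (periodicPart 1 E) n := by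
    intro n
    have c1 := continuous_line (differentiableOn_periodicPart (b := b) h.differentiableOn)
      half_pi_mem
    have c2 := continuous_line (differentiableOn_periodicPart (b := 1) hE1.differentiableOn)
      half_pi_mem
    have i1 : Continuous fun x : ℝ => periodicPart b Q (x + (Real.pi / 2 : ℝ) * Complex.I) *
        Complex.exp (-(Complex.I * freq τ n * (x + (Real.pi / 2 : ℝ) * Complex.I))) :=
      c1.mul (by fun_prop)
    have i2 : Continuous fun x : ℝ => (b : ℂ) *
        (periodicPart 1 E (x + (Real.pi / 2 : ℝ) * Complex.I) *
        Complex.exp (-(Complex.I * freq τ n * (x + (Real.pi / 2 : ℝ) * Complex.I)))) :=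
      continuous_const.mul (c2.mul (by fun_prop))
    simp only [stripCoeff]
    rw [mul_left_comm, ← mul_sub, ← intervalIntegral.integral_const_mul (b : ℂ),
      ← intervalIntegral.integral_sub (i1.intervalIntegrable _ _) (i2.intervalIntegrable _ _)]
    congr 1
    refine intervalIntegral.integral_congr fun x _ => ?_
    simp only [hD, periodicPart]
    push_cast
    ring
  -- `E` is concentrated at all scales, so its bottom coefficients are exactly those of a point mass
  have hA : ∀ n, imMode τ 1 E n 0 =
      Complex.exp (-(Complex.I * freq τ n * x₀)) * (Real.pi : ℝ) := by
    intro n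
    rw [← sub_eq_zero, ← norm_le_zero_iff]
    refine le_of_le_near_zero (F := fun y => ‖imMode τ 1 E n 0 -
      Complex.exp (-(Complex.I * freq τ n * x₀)) * (Real.pi : ℝ)‖)
      (G := fun y => |freq τ n| * y * Real.pi)
      continuous_const (by fun_prop) (fun ε hε => ⟨1, one_pos, fun y hy _ => ?_⟩) |>.trans_eq
      (by simp)
    have := (hE y hy.1).norm_imMode_zero_sub_le hτ hy.1.le n
    rw [one_mul] at this
    linarith
  have hd : ∀ z ∈ strip, ∀ n : ℤ, n ≠ 0 → ‖stripCoeff τ D n‖ * Real.exp (-(freq τ n * z.im)) ≤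
      2 * Real.pi / κ * (|freq τ n| * Real.exp (-(|freq τ n| * z.im))) * (b * η) := by
    intro z hz n hn
    have h1 := stripCoeff_of_imMode_pi_eq_zero hn (h.imMode_pi hτ n)
    have h2 := stripCoeff_of_imMode_pi_eq_zero hn (hE1.imMode_pi hτ n)
    have h3 : (1 - Real.exp (-(2 * freq τ n * Real.pi)) : ℝ) * stripCoeff τ D n =
        2 * Complex.I * (imMode τ b Q n 0 -
          Complex.exp (-(Complex.I * freq τ n * x₀)) * (b * Real.pi : ℝ)) := by
      rw [hlin, mul_sub, h1, mul_left_comm, h2, hA]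
      push_cast
      ring
    have h4 := congrArg norm h3
    rw [norm_mul, norm_mul, norm_mul, Complex.norm_real, Complex.norm_I, Complex.norm_ofNat,
      mul_one, Real.norm_eq_abs] at h4
    have h5 := h.norm_imMode_zero_sub_le hτ hη n
    have h6 := one_sub_exp_mul_le hτ hn hz.2.le
    rw [← hκd] at h6
    have p := Real.exp_pos (-(|freq τ n| * z.im))
    have h7 : κ * (‖stripCoeff τ D n‖ * Real.exp (-(freq τ n * z.im))) ≤
        2 * (|freq τ n| * η * (b * Real.pi)) * Real.exp (-(|freq τ n| * z.im)) := by
      calc _ = ‖stripCoeff τ D n‖ * (κ * Real.exp (-(freq τ n * z.im))) := by ring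
        _ ≤ ‖stripCoeff τ D n‖ * (|1 - Real.exp (-(2 * freq τ n * Real.pi))| *
              Real.exp (-(|freq τ n| * z.im))) := by gcongr
        _ = (|1 - Real.exp (-(2 * freq τ n * Real.pi))| * ‖stripCoeff τ D n‖) *
              Real.exp (-(|freq τ n| * z.im)) := by ring
        _ ≤ _ := by rw [h4]; gcongr
    rw [← le_div_iff₀' hκ] at h7
    refine h7.trans_eq ?_
    field_simp
  have hs0 : ∀ z ∈ strip, Summable fun n : ℤ => 2 * Real.pi / κ *
      (|freq τ n| * Real.exp (-(|freq τ n| * z.im))) := fun z hz =>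
    (summable_freq_mul_exp hτ hz.1).mul_left _
  have him : (stripCoeff τ D 0).im = 0 := by
    rw [hlin, Complex.sub_im, Complex.im_ofReal_mul,
      h.im_stripCoeff_zero hτ, hE1.im_stripCoeff_zero hτ]
    ring
  refine ⟨(stripCoeff τ D 0).re, fun z hz => ?_⟩
  have hsum := hasSum_stripCoeff hτ hDd hDp hz (by
    refine Summable.of_nonneg_of_le (fun n => by positivity) (fun n => ?_)
      (((hs0 z hz).mul_right (b * η)).add
        (hasSum_ite_eq (0 : ℤ) ‖stripCoeff τ D 0‖).summable)
    by_cases hn : n = 0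
    · subst hn
      simp [freq_zero]
    · simpa [hn] using hd z hz n hn)
  have h1 := hasSum_ite_sub_hasSum hsum 0
  simp only [freq_zero, Complex.ofReal_zero, mul_zero, zero_mul, Complex.exp_zero, mul_one] at h1
  have h0 : stripCoeff τ D 0 = ((stripCoeff τ D 0).re : ℂ) :=
    Complex.ext (by simp) (by simpa using him)
  rw [h0] at h1
  change ‖D z - _‖ ≤ _
  rw [← h1.tsum_eq, comparisonConst, ← hκd]
  refine tsum_of_norm_bounded ((hs0 z hz).mul_right (b * η)).hasSum (fun n => ?_) |>.trans_eq
    tsum_mul_right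
  by_cases hn : n = 0
  · subst hn
    simp [freq_zero]
  · rw [if_neg hn, norm_mul, Complex.norm_exp]
    refine (hd z hz n hn).trans_eq' ?_
    simp

end HasStripBoundary

end AnnulusLoewner

/-! ### Strip maps and their periods -/

namespace AnnulusLoewner

/-- `F` maps the strip conformally onto `D`, with inverse `G`, and intertwines the translations by
`τ` and `τ₀`. -/
structure IsStripMap (τ₀ τ : ℝ) (D : Set ℂ) (F G : ℂ → ℂ) : Prop where
  pos : 0 < τ
  differentiableOn : DifferentiableOn ℂ F strip
  differentiableOn_inv : DifferentiableOn ℂ G D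
  mapsTo : MapsTo F strip D
  mapsTo_inv : MapsTo G D strip
  left_inv : ∀ z ∈ strip, G (F z) = z
  right_inv : ∀ w ∈ D, F (G w) = w
  map_add : ∀ z ∈ strip, F (z + τ) = F z + τ₀
  exists_re : ∃ C, ∀ z ∈ strip, |(F z).re - τ₀ / τ * z.re| ≤ C

theorem add_mem_strip {z : ℂ} (hz : z ∈ strip) (x : ℝ) : z + x ∈ strip := by
  simpa [strip] using hz

theorem add_int_mul_mem_strip {z : ℂ} (hz : z ∈ strip) (k : ℤ) (x : ℝ) : z + k * x ∈ strip := by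
  simpa [strip] using hz

theorem map_add_int_mul {S : Set ℂ} {F : ℂ → ℂ} {τ σ : ℝ} (hS : ∀ z ∈ S, z + τ ∈ S)
    (hS' : ∀ z ∈ S, z - τ ∈ S)
    (h : ∀ z ∈ S, F (z + τ) = F z + σ) {z : ℂ} (hz : z ∈ S) (k : ℤ) :
    z + k * τ ∈ S ∧ F (z + k * τ) = F z + k * σ := by
  induction k using Int.induction_on with
  | zero => simp [hz]
  | succ n ih =>
    have e : z + ((n + 1 : ℤ) : ℂ) * τ = z + (n : ℤ) * τ + τ := by push_cast; ring
    rw [e, h _ ih.1, ih.2]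
    refine ⟨hS _ ih.1, ?_⟩
    push_cast; ring
  | pred n ih =>
    have e : z + ((-n - 1 : ℤ) : ℂ) * τ = z + (-n : ℤ) * τ - τ := by push_cast; ring
    have h1 := h _ (hS' _ ih.1)
    rw [sub_add_cancel, ih.2] at h1
    rw [e]
    refine ⟨hS' _ ih.1, ?_⟩
    push_cast at h1 ⊢
    linear_combination -h1

/-- Every point is moved into the fundamental domain `0 ≤ Re < τ` by a multiple of the period. -/
theorem exists_int_re_mem {τ : ℝ} (hτ : 0 < τ) (z : ℂ) :
    ∃ k : ℤ, 0 ≤ (z + k * τ).re ∧ (z + k * τ).re < τ := by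
  refine ⟨-⌊z.re / τ⌋, ?_⟩
  have h1 := Int.floor_le (z.re / τ)
  have h2 := Int.lt_floor_add_one (z.re / τ)
  rw [le_div_iff₀ hτ] at h1
  rw [div_lt_iff₀ hτ] at h2
  have : (z + ((-⌊z.re / τ⌋ : ℤ) : ℂ) * τ).re = z.re - ⌊z.re / τ⌋ * τ := by
    simp; ring
  rw [this]
  constructor <;> linarith

namespace IsStripMap

variable {τ₀ τ : ℝ} {D : Set ℂ} {F G : ℂ → ℂ}

theorem map_add_int (h : IsStripMap τ₀ τ D F G) {z : ℂ} (hz : z ∈ strip) (k : ℤ) :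
    F (z + k * τ) = F z + k * τ₀ :=
  (map_add_int_mul (fun z hz => add_mem_strip hz τ)
    (fun z hz => by simpa [sub_eq_add_neg] using add_mem_strip hz (-τ)) h.map_add hz k).2

theorem inv_add_int (h : IsStripMap τ₀ τ D F G) {w : ℂ} (hw : w ∈ D) (k : ℤ) :
    w + k * τ₀ ∈ D ∧ G (w + k * τ₀) = G w + k * τ := by
  have hz := h.mapsTo_inv hw
  have h1 := h.map_add_int hz k
  rw [h.right_inv w hw] at h1
  have h2 := add_int_mul_mem_strip hz k τ
  rw [← h1]
  exact ⟨h.mapsTo h2, h.left_inv _ h2⟩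

theorem exists_re_inv (h : IsStripMap τ₀ τ D F G) (hτ₀ : 0 < τ₀) :
    ∃ C, ∀ w ∈ D, |(G w).re - τ / τ₀ * w.re| ≤ C := by
  obtain ⟨C, hC⟩ := h.exists_re
  have hτ := h.pos
  refine ⟨τ / τ₀ * C, fun w hw => ?_⟩
  have h1 := hC _ (h.mapsTo_inv hw)
  rw [h.right_inv w hw] at h1
  have h2 : (G w).re - τ / τ₀ * w.re = -(τ / τ₀ * (w.re - τ₀ / τ * (G w).re)) := by
    field_simp
    ring
  rw [h2, abs_neg, abs_mul, abs_of_pos (by positivity : 0 < τ / τ₀)]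
  gcongr

theorem continuousAt (h : IsStripMap τ₀ τ D F G) {z : ℂ} (hz : z ∈ strip) : ContinuousAt F z :=
  (h.differentiableOn.differentiableAt (isOpen_strip.mem_nhds hz)).continuousAt

theorem continuousAt_inv (h : IsStripMap τ₀ τ D F G) (hD : IsOpen D) {w : ℂ} (hw : w ∈ D) :
    ContinuousAt G w :=
  (h.differentiableOn_inv.differentiableAt (hD.mem_nhds hw)).continuousAt

end IsStripMap

/-- A normalized slit map in logarithmic coordinates. -/
theorem IsSlitMap.isStripMap {τ₀ t τ : ℝ} {l : ℝ → ℂ} {f : ℂ → ℂ} (hf : IsSlitMap τ₀ l t f)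
    (hτ₀ : 0 < τ₀) (hτ : 0 < τ)
    (hdil : ∀ z ∈ upperHalf, f ((Real.exp τ : ℂ) * z) = (Real.exp τ₀ : ℂ) * f z) :
    IsStripMap τ₀ τ (logDomain τ₀ l t) (fun z => Complex.log (f (Complex.exp z)))
      (fun w => Complex.log (inverseMap f (Complex.exp w))) := by
  have hexp : ∀ w ∈ logDomain τ₀ l t, Complex.log (Complex.exp w) ∈ logDomain τ₀ l t :=
    fun w hw => by rwa [log_exp_of_mem_strip hw.1]
  have hadd : ∀ z ∈ strip, Complex.log (f (Complex.exp (z + τ))) =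
      Complex.log (f (Complex.exp z)) + τ₀ := by
    intro z hz
    have := exp_mem_upperHalf hz
    rw [Complex.exp_add, mul_comm, ← Complex.ofReal_exp, hdil _ this, log_exp_mul _ (hf.mapsTo this)]
  refine ⟨hτ, ?_, ?_, ?_, ?_, ?_, ?_, hadd, ?_⟩
  · intro z hz
    have h1 := exp_mem_upperHalf hz
    exact ((differentiableAt_log_of_mem_upperHalf (hf.mapsTo h1)).comp z
      ((hf.differentiableOn.differentiableAt (isOpen_upperHalf.mem_nhds h1)).comp z
        Complex.differentiableAt_exp)).differentiableWithinAt
  · intro w hw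
    have h1 := hexp w hw
    exact ((differentiableAt_log_of_mem_upperHalf (hf.inverse_mem h1)).comp w
      ((hf.differentiableAt_inverse h1).comp w
        Complex.differentiableAt_exp)).differentiableWithinAt
  · exact fun z hz => hf.log_mem (exp_mem_upperHalf hz)
  · exact fun w hw => log_mem_strip (hf.inverse_mem (hexp w hw))
  · intro z hz
    have h1 := exp_mem_upperHalf hz
    rw [Complex.exp_log (ne_zero_of_mem_upperHalf (hf.mapsTo h1)), hf.inverse_apply h1,
      log_exp_of_mem_strip hz]
  · intro w hw
    have h1 := hexp w hw
    rw [Complex.exp_log (ne_zero_of_mem_upperHalf (hf.inverse_mem h1)), hf.apply_inverse h1,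
      log_exp_of_mem_strip hw.1]
  · obtain ⟨δ, hδ, hd⟩ := hf.exists_norm_lt one_pos
    obtain ⟨R, hR⟩ := hf.exists_lt_norm 1
    set F : ℂ → ℂ := fun z => Complex.log (f (Complex.exp z)) with hF
    have hshift : ∀ z ∈ strip, ∀ k : ℤ, F (z + k * τ) = F z + k * τ₀ := fun z hz k =>
      (map_add_int_mul (F := F) (fun z hz => add_mem_strip hz τ)
        (fun z hz => by simpa [sub_eq_add_neg] using add_mem_strip hz (-τ)) hadd hz k).2
    have hlo : ∀ z ∈ strip, z.re < Real.log δ → (F z).re < 0 := by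
      intro z hz hzr
      have h1 := exp_mem_upperHalf hz
      have h2 := hd _ h1 (by
        rw [Complex.norm_exp]
        exact (Real.lt_log_iff_exp_lt hδ).1 hzr)
      simp only [hF, Complex.log_re]
      exact Real.log_neg (norm_pos_iff.2 (ne_zero_of_mem_upperHalf (hf.mapsTo h1))) h2
    have hhi : ∀ z ∈ strip, Real.log (max R 1) < z.re → 0 < (F z).re := by
      intro z hz hzr
      have h1 := exp_mem_upperHalf hz
      have h2 := hR _ h1 (by
        rw [Complex.norm_exp]
        exact (le_max_left _ _).trans_lt ((Real.log_lt_iff_lt_exp (by positivity)).1 hzr))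
      simp only [hF, Complex.log_re]
      exact Real.log_pos h2
    set a := Real.log δ
    set b := Real.log (max R 1)
    refine ⟨(|a| + |b|) * (τ₀ / τ) + 2 * τ₀, fun z hz => ?_⟩
    have hr : 0 < τ₀ / τ := by positivity
    have e : τ₀ = τ₀ / τ * τ := by field_simp
    set ρ := τ₀ / τ
    have hre : ∀ k : ℤ, (z + k * τ).re = z.re + k * τ ∧ (F (z + k * τ)).re = (F z).re + k * τ₀ := by
      intro k
      rw [hshift z hz k]
      simp
    have key1 : (F z).re ≤ ρ * (z.re - a) + 2 * τ₀ := by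
      set k : ℤ := ⌊(a - z.re) / τ⌋ - 1 with hk
      have h1 := Int.floor_le ((a - z.re) / τ)
      have h2 := Int.lt_floor_add_one ((a - z.re) / τ)
      rw [le_div_iff₀ hτ] at h1
      rw [div_lt_iff₀ hτ] at h2
      have hkr : (k : ℝ) = ⌊(a - z.re) / τ⌋ - 1 := by simp [hk]
      have h3 := hlo _ (add_int_mul_mem_strip hz k τ) (by rw [(hre k).1, hkr]; linarith)
      rw [(hre k).2, hkr] at h3
      rw [e] at h3 ⊢
      nlinarith [mul_lt_mul_of_pos_left h2 hr]
    have key2 : ρ * (z.re - b) - 2 * τ₀ ≤ (F z).re := by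
      set k : ℤ := ⌊(b - z.re) / τ⌋ + 1 with hk
      have h1 := Int.floor_le ((b - z.re) / τ)
      have h2 := Int.lt_floor_add_one ((b - z.re) / τ)
      rw [le_div_iff₀ hτ] at h1
      rw [div_lt_iff₀ hτ] at h2
      have hkr : (k : ℝ) = ⌊(b - z.re) / τ⌋ + 1 := by simp [hk]
      have h3 := hhi _ (add_int_mul_mem_strip hz k τ) (by rw [(hre k).1, hkr]; linarith)
      rw [(hre k).2, hkr] at h3
      rw [e] at h3 ⊢
      nlinarith [mul_le_mul_of_nonneg_left h1 hr.le]
    have ha := mul_le_mul_of_nonneg_left (neg_abs_le a) hr.le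
    have hb := mul_le_mul_of_nonneg_left (le_abs_self b) hr.le
    have ha' := mul_nonneg hr.le (abs_nonneg a)
    have hb' := mul_nonneg hr.le (abs_nonneg b)
    rw [abs_le]
    constructor <;> nlinarith

namespace IsStripMap

variable {τ₀ τ σ : ℝ} {D D' : Set ℂ} {F G F' G' : ℂ → ℂ}

/-! The transition map `F'⁻¹ ∘ F` between two strip maps with nested images is a holomorphic
self-map of the strip which intertwines the translations by the two periods. -/

theorem transition_differentiableOn (h : IsStripMap τ₀ τ D F G) (h' : IsStripMap τ₀ σ D' F' G')
    (hDD : D ⊆ D') : DifferentiableOn ℂ (fun z => G' (F z)) strip :=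
  h'.differentiableOn_inv.comp h.differentiableOn (h.mapsTo.mono_right hDD)

theorem transition_mapsTo (h : IsStripMap τ₀ τ D F G) (h' : IsStripMap τ₀ σ D' F' G')
    (hDD : D ⊆ D') : MapsTo (fun z => G' (F z)) strip strip :=
  fun _ hz => h'.mapsTo_inv (hDD (h.mapsTo hz))

theorem transition_add (h : IsStripMap τ₀ τ D F G) (h' : IsStripMap τ₀ σ D' F' G')
    (hDD : D ⊆ D') {z : ℂ} (hz : z ∈ strip) : G' (F (z + τ)) = G' (F z) + σ := by
  have := (h'.inv_add_int (hDD (h.mapsTo hz)) 1).2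
  rw [h.map_add z hz]
  simpa using this

/-- Shrinking the domain strictly increases the period (the modulus of the annulus). -/
theorem period_lt (h : IsStripMap τ₀ τ D F G) (h' : IsStripMap τ₀ σ D' F' G')
    (hDD : D ⊂ D') : σ < τ := by
  have hτ := h.pos
  obtain ⟨h1, h2⟩ := nonneg_and_eq_const_of_boundary (τ := τ) (b := 1 - σ / τ)
    (Q := fun z => G' (F z) - z) hτ
    ((h.transition_differentiableOn h' hDD.subset).sub differentiableOn_id)
    (fun z hz => by
      rw [h.transition_add h' hDD.subset hz]
      have : (τ : ℂ) ≠ 0 := by exact_mod_cast hτ.ne'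
      push_cast
      field_simp
      ring)
    -- at the top `Im` cannot increase beyond `π`, and at the bottom it cannot drop below `0`
    (fun ε hε => ⟨ε, hε, fun z hz hzi => by
      have := (h.transition_mapsTo h' hDD.subset hz).2
      simp only [Complex.sub_im]
      linarith⟩)
    (fun ε hε => ⟨ε, hε, fun z hz hzi => by
      have := (h.transition_mapsTo h' hDD.subset hz).1
      simp only [Complex.sub_im]
      linarith⟩)
  by_contra! hle
  have hb : 1 - σ / τ = 0 := by
    have : 1 ≤ σ / τ := by rwa [one_le_div hτ]
    linarith
  obtain ⟨lam, hlam⟩ := h2 hb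
  -- a translation is onto the strip, so the two domains coincide
  refine hDD.not_subset fun w hw => ?_
  have hz := h'.mapsTo_inv hw
  have hz' : G' w - lam ∈ strip := by
    have := add_mem_strip hz (-lam)
    rwa [Complex.ofReal_neg, ← sub_eq_add_neg] at this
  have h3 := hlam _ hz'
  have h4 : G' (F (G' w - lam)) = G' w := by linear_combination h3
  have h5 := congrArg F' h4
  rw [h'.right_inv _ (hDD.subset (h.mapsTo hz')), h'.right_inv w hw] at h5
  rw [← h5]
  exact h.mapsTo hz'

end IsStripMap

end AnnulusLoewner

/-! ### Boundary values of transition maps -/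

namespace AnnulusLoewner

/-- Compactness of rectangles in the strip, for sequences. -/
theorem exists_subseq_tendsto_strip {z : ℕ → ℂ} {C ε : ℝ} (hε : 0 < ε) (hre : ∀ n, |(z n).re| ≤ C)
    (him : ∀ n, ε ≤ (z n).im ∧ (z n).im ≤ Real.pi - ε) :
    ∃ a ∈ strip, ∃ θ : ℕ → ℕ, StrictMono θ ∧ Tendsto (fun n => z (θ n)) atTop (𝓝 a) := by
  obtain ⟨a, -, θ, hθ, hlim⟩ := tendsto_subseq_of_bounded
    (Metric.isBounded_closedBall (x := (0 : ℂ)) (r := C + Real.pi)) (x := z) (fun n => by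
      rw [mem_closedBall_zero_iff]
      refine (Complex.norm_le_abs_re_add_abs_im _).trans (add_le_add (hre n) ?_)
      rw [abs_of_pos (hε.trans_le (him n).1)]
      linarith [(him n).2])
  have hi := (Complex.continuous_im.tendsto a).comp hlim
  have h1 : ε ≤ a.im := ge_of_tendsto' hi fun n => (him _).1
  have h2 : a.im ≤ Real.pi - ε := le_of_tendsto' hi fun n => (him _).2
  exact ⟨a, ⟨hε.trans_le h1, by linarith⟩, θ, hθ, hlim⟩

namespace IsStripMap

variable {τ₀ τ T t x₀ : ℝ} {l : ℝ → ℂ} {F G : ℂ → ℂ}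

/-- The transition map from the slit of length `t` to a slightly shorter slit has boundary values
on the boundary of the strip, except near the prime end of the tip. -/
theorem transition_near_boundary (hl : IsLogSlit τ₀ T l) (hτ₀ : 0 < τ₀) (ht : t ∈ Ioc 0 T)
    (h : IsStripMap τ₀ τ (logDomain τ₀ l t) F G)
    (htip : Tendsto G (𝓝[logDomain τ₀ l t] (l t)) (𝓝 (x₀ : ℂ))) {η : ℝ} (hη : 0 < η) :
    ∃ s₀ < t, ∀ s ∈ Ico s₀ t, 0 ≤ s → ∀ (σ : ℝ) (F' G' : ℂ → ℂ),
      IsStripMap τ₀ σ (logDomain τ₀ l s) F' G' → ∀ ε > 0, ∃ y₁ > 0, ∀ z ∈ strip,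
        (Real.pi - y₁ < z.im ∨ (z.im < y₁ ∧ ∀ k : ℤ, η ≤ |z.re - x₀ - k * τ|)) →
          (G' (F z)).im < ε ∨ Real.pi - ε < (G' (F z)).im := by
  have hτ := h.pos
  have hpi := Real.pi_pos
  have hρ : 0 < min η (Real.pi / 2) := lt_min hη (by positivity)
  obtain ⟨δ, hδ, hd⟩ := Metric.tendsto_nhdsWithin_nhds.1 htip _ hρ
  -- the part of the slit near its tip
  have hcont : Tendsto l (𝓝[Icc 0 T] t) (𝓝 (l t)) := hl.continuousOn t ⟨ht.1.le, ht.2⟩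
  obtain ⟨r, hr, hrd⟩ := Metric.tendsto_nhdsWithin_nhds.1 hcont _ hδ
  refine ⟨t - r, by linarith, fun s hs hs0 σ F' G' h' ε hε => ?_⟩
  have hsub : logDomain τ₀ l t ⊆ logDomain τ₀ l s := logDomain_anti hs.2.le
  -- if not, some sequence approaches the boundary while its image stays in a smaller strip; reduce
  -- it modulo the period and pass to a limit
  by_contra! hcon
  choose ζ hζs hζb hζi hζi' using fun n : ℕ => hcon (1 / (n + 1 : ℝ)) (by positivity)
  choose k hk0 hk1 using fun n => exists_int_re_mem hτ (ζ n)
  set z : ℕ → ℂ := fun n => ζ n + k n * τ with hz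
  have hzs : ∀ n, z n ∈ strip := fun n => add_int_mul_mem_strip (hζs n) _ _
  have hGF : ∀ n, G' (F (z n)) = G' (F (ζ n)) + k n * σ := fun n => by
    simp only [hz]
    rw [h.map_add_int (hζs n)]
    exact (h'.inv_add_int (hsub (h.mapsTo (hζs n))) (k n)).2
  have hzim : ∀ n, (z n).im = (ζ n).im := fun n => by simp [hz]
  obtain ⟨C, hC⟩ := h.exists_re
  obtain ⟨C', hC'⟩ := h'.exists_re_inv hτ₀
  obtain ⟨a, ha, θ, hθ, hlim⟩ := exists_subseq_tendsto_strip (z := fun n => G' (F (z n)))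
    (C := C' + |σ / τ₀| * (C + |τ₀ / τ| * τ)) hε (fun n => by
      have h1 := hC _ (hzs n)
      have h2 := hC' _ (hsub (h.mapsTo (hzs n)))
      have h3 : |(F (z n)).re| ≤ C + |τ₀ / τ| * τ := by
        have h4 : |τ₀ / τ * (z n).re| ≤ |τ₀ / τ| * τ := by
          rw [abs_mul]
          have : |(z n).re| ≤ τ := abs_le.2 ⟨by linarith [hk0 n], (hk1 n).le⟩
          gcongr
        calc _ = |((F (z n)).re - τ₀ / τ * (z n).re) + τ₀ / τ * (z n).re| := by ring_nf
          _ ≤ _ := (abs_add_le _ _).trans (add_le_add h1 h4)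
      have h5 : |σ / τ₀ * (F (z n)).re| ≤ |σ / τ₀| * (C + |τ₀ / τ| * τ) := by
        rw [abs_mul]
        gcongr
      calc _ = |((G' (F (z n))).re - σ / τ₀ * (F (z n)).re) + σ / τ₀ * (F (z n)).re| := by ring_nf
        _ ≤ _ := (abs_add_le _ _).trans (add_le_add h2 h5))
    (fun n => by
      have : (G' (F (z n))).im = (G' (F (ζ n))).im := by rw [hGF]; simp
      rw [this]
      exact ⟨hζi n, hζi' n⟩)
  -- the images under `F` converge to a point of the larger domain
  have hFlim : Tendsto (fun n => F (z (θ n))) atTop (𝓝 (F' a)) := by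
    refine ((h'.continuousAt ha).tendsto.comp hlim).congr fun n => ?_
    exact h'.right_inv _ (hsub (h.mapsTo (hzs _)))
  have hinv : Tendsto (fun n : ℕ => 1 / ((θ n : ℝ) + 1)) atTop (𝓝 0) :=
    tendsto_one_div_add_atTop_nhds_zero_nat.comp hθ.tendsto_atTop
  by_cases hw : F' a ∈ logDomain τ₀ l t
  · -- a limit inside the smaller domain keeps `z n` away from the boundary
    have hz1 : Tendsto (fun n => z (θ n)) atTop (𝓝 (G (F' a))) := by
      refine ((h.continuousAt_inv (hl.isOpen_logDomain hτ₀ ht.2) hw).tendsto.comp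
        hFlim).congr fun n => ?_
      exact h.left_inv _ (hzs _)
    have hin := h.mapsTo_inv hw
    have hi := (Complex.continuous_im.tendsto _).comp hz1
    have e1 : ∀ᶠ n in atTop, 1 / ((θ n : ℝ) + 1) < (z (θ n)).im :=
      hinv.eventually_lt hi hin.1
    have e2 : ∀ᶠ n in atTop, (z (θ n)).im < Real.pi - 1 / ((θ n : ℝ) + 1) :=
      hi.eventually_lt (tendsto_const_nhds.sub hinv) (by simpa using hin.2)
    obtain ⟨n, h1, h2⟩ := (e1.and e2).exists
    rcases hζb (θ n) with h3 | h3
    · rw [← hzim] at h3; linarith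
    · rw [← hzim] at h3; linarith [h3.1]
  · have hwS := h'.mapsTo ha
    have : ∃ m : ℤ, ∃ u ∈ Ioc 0 t, F' a = l u + m * τ₀ := by
      by_contra! hno
      exact hw ⟨hwS.1, hno⟩
    obtain ⟨m, u, hu, hum⟩ := this
    have hus : s < u := by
      by_contra! hle
      exact hwS.2 m u ⟨hu.1, hle⟩ hum
    have hlu : dist (l u) (l t) < δ := hrd ⟨hu.1.le, hu.2.trans ht.2⟩ (by
      rw [Real.dist_eq, abs_sub_lt_iff]
      constructor <;> linarith [hu.2, hs.1])
    have hlim2 : Tendsto (fun n => F (z (θ n)) - m * τ₀) atTop (𝓝 (l u)) := by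
      have := hFlim.sub_const ((m : ℂ) * τ₀)
      rwa [hum, add_sub_cancel_right] at this
    have e1 : ∀ᶠ n in atTop, dist (F (z (θ n)) - m * τ₀) (l t) < δ :=
      (hlim2.dist tendsto_const_nhds).eventually_lt_const hlu
    have e2 : ∀ᶠ n in atTop, 1 / ((θ n : ℝ) + 1) < Real.pi / 2 :=
      hinv.eventually_lt_const (by positivity)
    obtain ⟨n, h1, h2⟩ := (e1.and e2).exists
    have h3 := h.inv_add_int (h.mapsTo (hzs (θ n))) (-m)
    have e : F (z (θ n)) + ((-m : ℤ) : ℂ) * τ₀ = F (z (θ n)) - m * τ₀ := by push_cast; ring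
    rw [e, h.left_inv _ (hzs _)] at h3
    have h4 := hd h3.1 h1
    rw [h3.2] at h4
    set y := z (θ n) + ((-m : ℤ) : ℂ) * τ with hy
    have hyim : y.im = (ζ (θ n)).im := by simp [hy, hzim]
    have hyre : y.re = (ζ (θ n)).re + k (θ n) * τ - m * τ := by simp [hy, hz]; ring
    rw [dist_eq_norm] at h4
    rcases hζb (θ n) with h5 | h5
    · have h6 := (Complex.abs_im_le_norm (y - x₀)).trans_lt (h4.trans_le (min_le_right _ _))
      rw [Complex.sub_im, Complex.ofReal_im, sub_zero, hyim] at h6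
      linarith [le_abs_self (ζ (θ n)).im]
    · have h6 := (Complex.abs_re_le_norm (y - x₀)).trans_lt (h4.trans_le (min_le_left _ _))
      rw [Complex.sub_re, Complex.ofReal_re, hyre] at h6
      have h7 := h5.2 (m - k (θ n))
      push_cast at h7
      have : (ζ (θ n)).re - x₀ - (m - k (θ n)) * τ =
        (ζ (θ n)).re + k (θ n) * τ - m * τ - x₀ := by ring
      rw [this] at h7
      linarith

end IsStripMap

/-- Intermediate values: on a convex set, a continuous function that avoids a middle range stays
on one side of it. -/
theorem forall_lt_or_forall_gt {S : Set ℂ} (hS : Convex ℝ S) {u : ℂ → ℝ} (hu : ContinuousOn u S)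
    {a b : ℝ} (hab : a ≤ b) (h : ∀ z ∈ S, u z < a ∨ b < u z) :
    (∀ z ∈ S, u z < a) ∨ (∀ z ∈ S, b < u z) := by
  by_contra! hcon
  obtain ⟨⟨z, hz, hz1⟩, ⟨w, hw, hw1⟩⟩ := hcon
  have h1 : b < u z := (h z hz).resolve_left (not_lt.2 hz1)
  have h2 : u w < a := (h w hw).resolve_right (not_lt.2 hw1)
  have himg := (hS.isPreconnected.image u hu).ordConnected
  obtain ⟨y, hy, hya⟩ := himg.out (mem_image_of_mem u hw) (mem_image_of_mem u hz)
    ⟨h2.le, hab.trans h1.le⟩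
  rcases h y hy with h3 | h3 <;> linarith

theorem integral_im_le {Q : ℂ → ℂ} {τ y c : ℝ} (hτ : 0 < τ) (hQ : DifferentiableOn ℂ Q strip)
    (hy : y ∈ Ioo 0 Real.pi) (h : ∀ z ∈ strip, z.im = y → (Q z).im ≤ c) :
    ∫ x in (0 : ℝ)..τ, (Q (x + y * Complex.I)).im ≤ τ * c := by
  have := intervalIntegral.integral_mono_on hτ.le
    ((continuous_im_line hQ hy).intervalIntegrable (μ := volume) _ _)
    ((continuous_const (y := c)).intervalIntegrable (μ := volume) _ _) (fun x _ => by
      obtain ⟨h1, h2, -⟩ := line_mem_strip hy x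
      exact h _ h1 h2)
  simpa using this

theorem le_integral_im {Q : ℂ → ℂ} {τ y c : ℝ} (hτ : 0 < τ) (hQ : DifferentiableOn ℂ Q strip)
    (hy : y ∈ Ioo 0 Real.pi) (h : ∀ z ∈ strip, z.im = y → c ≤ (Q z).im) :
    τ * c ≤ ∫ x in (0 : ℝ)..τ, (Q (x + y * Complex.I)).im := by
  have := intervalIntegral.integral_mono_on hτ.le
    ((continuous_const (y := c)).intervalIntegrable (μ := volume) _ _)
    ((continuous_im_line hQ hy).intervalIntegrable (μ := volume) _ _) (fun x _ => by
      obtain ⟨h1, h2, -⟩ := line_mem_strip hy x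
      exact h _ h1 h2)
  simpa using this

/-- A self-map of the strip that shortens the period and has boundary values on the boundary of the
strip except near `x₀ + τ ℤ` preserves the two sides: the means over horizontal lines leave no
other possibility. -/
theorem hasStripBoundary_sub_id {τ σ x₀ η : ℝ} {K : ℂ → ℂ} (hτ : 0 < τ) (hσ : 0 < σ)
    (hb : 1 - σ / τ < 1 / 2) (hη : 0 < η) (hητ : 8 * η < τ) (hK : DifferentiableOn ℂ K strip)
    (hmaps : MapsTo K strip strip) (hadd : ∀ z ∈ strip, K (z + τ) = K z + σ)
    (hbd : ∀ ε > 0, ∃ y₁ > 0, ∀ z ∈ strip,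
      (Real.pi - y₁ < z.im ∨ (z.im < y₁ ∧ ∀ k : ℤ, η ≤ |z.re - x₀ - k * τ|)) →
        (K z).im < ε ∨ Real.pi - ε < (K z).im) :
    HasStripBoundary τ x₀ η (1 - σ / τ) fun z => K z - z := by
  have hpi := Real.pi_pos
  have hτc : (τ : ℂ) ≠ 0 := by exact_mod_cast hτ.ne'
  have hKc : ContinuousOn (fun z => (K z).im) strip :=
    Complex.continuous_im.comp_continuousOn hK.continuousOn
  have hper : ∀ z ∈ strip, K (z + τ) = K z - (-(σ / τ) : ℝ) * τ := fun z hz => by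
    rw [hadd z hz]; push_cast; field_simp; ring
  set ρ := σ / τ with hρd
  have hρ : 0 < ρ := by positivity
  set m := (stripCoeff τ (periodicPart (-ρ) K) 0).im with hm
  have hmean : ∀ y ∈ Ioo 0 Real.pi, ∫ x in (0 : ℝ)..τ, (K (x + y * Complex.I)).im =
      τ * (m + ρ * y) := fun y hy => by
    rw [integral_im hτ hK hper hy]; ring
  have hm0 : 0 ≤ m := by
    have := le_of_le_near_zero (F := fun _ => 0) (G := fun y => m + ρ * y) continuous_const
      (by fun_prop) (fun ε hε => ⟨1, one_pos, fun y hy _ => by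
        have h1 := le_integral_im (c := 0) hτ hK hy fun z hz _ => (hmaps hz).1.le
        rw [hmean y hy] at h1
        linarith [le_of_mul_le_mul_left h1 hτ]⟩)
    simpa using this
  have htop : ∀ ε > 0, ∃ δ > 0, ∀ z ∈ strip, Real.pi - δ < z.im → Real.pi - ε < (K z).im := by
    intro ε hε
    set ε' := min ε (min (ρ * Real.pi / 2) (Real.pi / 2)) with hε'
    have e0 : 0 < ε' := by positivity
    have e1 : ε' ≤ ε := min_le_left _ _
    have e2 : ε' ≤ ρ * Real.pi / 2 := (min_le_right _ _).trans (min_le_left _ _)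
    have e3 : ε' ≤ Real.pi / 2 := (min_le_right _ _).trans (min_le_right _ _)
    obtain ⟨y₁, hy₁, h1⟩ := hbd ε' e0
    have hconv : Convex ℝ (strip ∩ {z : ℂ | Real.pi - y₁ < z.im}) :=
      convex_strip.inter (convex_halfSpace_im_gt _)
    rcases forall_lt_or_forall_gt hconv (hKc.mono inter_subset_left)
      (by linarith : ε' ≤ Real.pi - ε') (fun z hz => h1 z hz.1 (Or.inl hz.2)) with h2 | h2
    -- near the top the mean tends to `m + ρ π`, which is positive
    · exfalso
      have := le_of_le_near_pi (F := fun y => m + ρ * y) (G := fun _ => ε') (by fun_prop)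
        continuous_const (fun ε hε => ⟨y₁, hy₁, fun y hy hyd => by
          have h3 := integral_im_le (c := ε') hτ hK hy fun z hz hzy =>
            (h2 z ⟨hz, by rw [mem_ofPred_eq, hzy]; exact hyd⟩).le
          rw [hmean y hy] at h3
          linarith [le_of_mul_le_mul_left h3 hτ]⟩)
      beta_reduce at this
      have : 0 < ρ * Real.pi := by positivity
      linarith
    · exact ⟨y₁, hy₁, fun z hz hzi => by linarith [h2 z ⟨hz, hzi⟩]⟩
  have hmρ : m + ρ * Real.pi ≤ Real.pi :=
    le_of_le_near_pi (F := fun y => m + ρ * y) (G := fun _ => Real.pi) (by fun_prop)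
      continuous_const (fun ε hε => ⟨1, one_pos, fun y hy _ => by
        have h3 := integral_im_le hτ hK hy fun z hz hzy => (hmaps hz).2.le
        rw [hmean y hy] at h3
        linarith [le_of_mul_le_mul_left h3 hτ]⟩)
  have hshift : ∀ z ∈ strip, ∀ k : ℤ, (K (z + k * τ)).im = (K z).im := fun z hz k => by
    rw [(map_add_int_mul (F := K) (fun z hz => add_mem_strip hz τ)
        (fun z hz => by simpa [sub_eq_add_neg] using add_mem_strip hz (-τ)) hadd hz k).2]
    simp
  have hoff : ∀ ε > 0, ∃ δ > 0, ∀ z ∈ strip, z.im < δ →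
      (∀ k : ℤ, η ≤ |z.re - x₀ - k * τ|) → (K z).im < ε := by
    intro ε hε
    set ε' := min ε (Real.pi / 8) with hε'
    have e0 : 0 < ε' := by positivity
    have e1 : ε' ≤ ε := min_le_left _ _
    have e2 : ε' ≤ Real.pi / 8 := min_le_right _ _
    obtain ⟨y₁, hy₁, h1⟩ := hbd ε' e0
    -- one fundamental rectangle at the bottom, away from the exceptional points
    set S : Set ℂ := strip ∩ {z : ℂ | z.im < y₁} ∩
      ({z : ℂ | x₀ + η ≤ z.re} ∩ {z : ℂ | z.re ≤ x₀ + τ - η}) with hS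
    have hconv : Convex ℝ S := (convex_strip.inter (convex_halfSpace_im_lt _)).inter
      ((convex_halfSpace_re_ge _).inter (convex_halfSpace_re_le _))
    have hSoff : ∀ z ∈ S, ∀ k : ℤ, η ≤ |z.re - x₀ - k * τ| := by
      intro z hz k
      have a1 : x₀ + η ≤ z.re := hz.2.1
      have a2 : z.re ≤ x₀ + τ - η := hz.2.2
      rcases le_or_gt k 0 with hk | hk
      · have : (k : ℝ) * τ ≤ 0 := mul_nonpos_of_nonpos_of_nonneg (by exact_mod_cast hk) hτ.le
        exact le_trans (by linarith) (le_abs_self _)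
      · have : (1 : ℝ) ≤ k := by exact_mod_cast hk
        have : τ ≤ k * τ := by nlinarith
        exact le_trans (by linarith) (neg_le_abs _)
    rcases forall_lt_or_forall_gt hconv (hKc.mono fun z hz => hz.1.1)
      (by linarith : ε' ≤ Real.pi - ε') (fun z hz => h1 z hz.1.1 (Or.inr ⟨hz.1.2, hSoff z hz⟩))
      with h2 | h2
    · refine ⟨y₁, hy₁, fun z hz hzi hzo => ?_⟩
      obtain ⟨k, hk0, hk1⟩ := exists_int_re_mem hτ (z - x₀)
      have hre : (z - x₀ + k * τ).re = z.re - x₀ + k * τ := by simp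
      rw [hre] at hk0 hk1
      have b1 := hzo (-k)
      have b2 := hzo (-k + 1)
      push_cast at b1 b2
      rw [abs_of_nonneg (by linarith)] at b1
      rw [abs_of_nonpos (by linarith)] at b2
      rw [← hshift z hz k]
      have hz' : (z + k * τ).re = z.re + k * τ := by simp
      refine (h2 _ ⟨⟨add_int_mul_mem_strip hz k τ, ?_⟩, ?_, ?_⟩).trans_le e1
      · simpa using hzi
      · rw [mem_ofPred_eq, hz']; linarith
      · rw [mem_ofPred_eq, hz']; linarith
    -- the image cannot be near the top along most of the bottom side, since the mean there is at
    -- most `b π < π / 2`, while the rectangle fills three quarters of the period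
    · exfalso
      have h5 := le_of_le_near_zero (F := fun _ => 3 / 4 * (Real.pi - ε'))
        (G := fun y => m + ρ * y) continuous_const (by fun_prop)
        (fun ε hε => ⟨y₁, hy₁, fun y hy hyd => by
          have hc := continuous_im_line hK hy
          have hp : Function.Periodic (fun x : ℝ => (K (x + y * Complex.I)).im) τ := fun x => by
            have := hshift _ (mem_strip_of_Ioo hy x) 1
            beta_reduce
            rw [← this]
            push_cast
            ring_nf
          have h6 := hp.intervalIntegral_add_eq 0 x₀
          rw [zero_add, hmean y hy] at h6
          have h7 := intervalIntegral.integral_mono_interval (μ := volume) (c := x₀) (d := x₀ + τ)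
            (a := x₀ + η) (b := x₀ + τ - η) (f := fun x : ℝ => (K (x + y * Complex.I)).im)
            (by linarith) (by linarith) (by linarith)
            (Eventually.of_forall fun x => (hmaps (mem_strip_of_Ioo hy x)).1.le)
            (hc.intervalIntegrable _ _)
          have h8 := intervalIntegral.integral_mono_on (μ := volume)
            (by linarith : x₀ + η ≤ x₀ + τ - η)
            ((continuous_const (y := Real.pi - ε')).intervalIntegrable _ _)
            (hc.intervalIntegrable _ _) (fun x hx => by
              obtain ⟨c1, c2, c3⟩ := line_mem_strip hy x
              refine (h2 _ ⟨⟨c1, ?_⟩, ?_, ?_⟩).le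
              · rw [mem_ofPred_eq, c2]; exact hyd
              · rw [mem_ofPred_eq, c3]; exact hx.1
              · rw [mem_ofPred_eq, c3]; exact hx.2)
          rw [intervalIntegral.integral_const, smul_eq_mul] at h8
          have h9 : 3 / 4 * τ * (Real.pi - ε') ≤ (x₀ + τ - η - (x₀ + η)) * (Real.pi - ε') :=
            mul_le_mul_of_nonneg_right (by linarith) (by linarith)
          have h10 : τ * (3 / 4 * (Real.pi - ε')) ≤ τ * (m + ρ * y) := by
            rw [h6]
            refine le_trans (by linarith) (h8.trans h7)
          linarith [le_of_mul_le_mul_left h10 hτ]⟩)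
      beta_reduce at h5
      have := mul_lt_mul_of_pos_right hb hpi
      nlinarith
  refine ⟨hK.sub differentiableOn_id, fun z hz => ?_, fun ε hε => ?_, fun ε hε => ?_,
    fun ε hε => ?_⟩
  · rw [hadd z hz]
    push_cast
    rw [hρd]
    push_cast
    field_simp
    ring
  · obtain ⟨δ, hδ, hd⟩ := htop ε hε
    refine ⟨min δ ε, lt_min hδ hε, fun z hz hzi => ?_⟩
    have a1 := hd z hz (by linarith [min_le_left δ ε])
    have a2 := (hmaps hz).2
    have a3 := hz.2
    have a4 := min_le_right δ ε
    rw [Complex.sub_im, abs_le]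
    constructor <;> linarith
  · refine ⟨ε, hε, fun z hz hzi => ?_⟩
    have := (hmaps hz).1
    rw [Complex.sub_im]
    linarith
  · obtain ⟨δ, hδ, hd⟩ := hoff ε hε
    refine ⟨min δ ε, lt_min hδ hε, fun z hz hzi hzo => ?_⟩
    have a1 := hd z hz (hzi.trans_le (min_le_left _ _)) hzo
    have a2 := (hmaps hz).1
    have a3 := hz.1
    have a4 := hzi.trans_le (min_le_right _ _)
    rw [Complex.sub_im, abs_le]
    constructor <;> linarith

end AnnulusLoewner

/-! ### The sign of the image of the tip -/

namespace AnnulusLoewner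

/-- Below a horizontal line that lies above the slits, the inverse map stays away from the top side
of the strip. -/
theorem IsStripMap.exists_im_inv_le {τ₀ τ h₀ y₀ : ℝ} {D : Set ℂ} {F G : ℂ → ℂ}
    (h : IsStripMap τ₀ τ D F G) (hτ₀ : 0 < τ₀) (hD : D ⊆ strip) (hDo : IsOpen D) (hh : 0 ≤ h₀)
    (hsub : ∀ w ∈ strip, h₀ < w.im → w ∈ D) (hy₀ : y₀ ∈ Ioo h₀ Real.pi) :
    ∃ M < Real.pi, ∀ w ∈ D, w.im < y₀ → (G w).im ≤ M := by
  have hpi := Real.pi_pos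
  have hτ := h.pos
  have hτc : (τ₀ : ℂ) ≠ 0 := by exact_mod_cast hτ₀.ne'
  have hGc : ∀ w ∈ D, ContinuousAt G w := fun w hw => h.continuousAt_inv hDo hw
  have hadd : ∀ w ∈ D, ∀ k : ℤ, (G (w + k * τ₀)).im = (G w).im := fun w hw k => by
    rw [(h.inv_add_int hw k).2]; simp
  -- boundary values at the top lie on the boundary of the strip
  have near : ∀ ε > 0, ∃ δ > 0, ∀ w ∈ D, Real.pi - δ < w.im →
      (G w).im < ε ∨ Real.pi - ε < (G w).im := by
    intro ε hε
    by_contra! hcon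
    choose v hvD hvi hv1 hv2 using fun n : ℕ => hcon (1 / (n + 1 : ℝ)) (by positivity)
    choose k hk0 hk1 using fun n => exists_int_re_mem hτ₀ (v n)
    obtain ⟨C, hC⟩ := h.exists_re_inv hτ₀
    set w : ℕ → ℂ := fun n => v n + k n * τ₀ with hw
    have hwD : ∀ n, w n ∈ D := fun n => (h.inv_add_int (hvD n) (k n)).1
    have hwim : ∀ n, (w n).im = (v n).im := fun n => by simp [hw]
    obtain ⟨a, ha, θ, hθ, hlim⟩ := exists_subseq_tendsto_strip (z := fun n => G (w n))
      (C := C + τ / τ₀ * τ₀) hε (fun n => by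
        have h1 := hC _ (hwD n)
        have h2 : |τ / τ₀ * (w n).re| ≤ τ / τ₀ * τ₀ := by
          rw [abs_mul, abs_of_pos (by positivity : 0 < τ / τ₀)]
          have : |(w n).re| ≤ τ₀ := abs_le.2 ⟨by linarith [hk0 n], (hk1 n).le⟩
          gcongr
        calc _ = |((G (w n)).re - τ / τ₀ * (w n).re) + τ / τ₀ * (w n).re| := by ring_nf
          _ ≤ _ := (abs_add_le _ _).trans (add_le_add h1 h2))
      (fun n => by rw [hadd _ (hvD n)]; exact ⟨hv1 n, hv2 n⟩)
    have hwlim : Tendsto (fun n => w (θ n)) atTop (𝓝 (F a)) :=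
      ((h.continuousAt ha).tendsto.comp hlim).congr fun n => h.right_inv _ (hwD _)
    have hi := (Complex.continuous_im.tendsto _).comp hwlim
    have hinv : Tendsto (fun n : ℕ => Real.pi - 1 / ((θ n : ℝ) + 1)) atTop (𝓝 (Real.pi - 0)) :=
      tendsto_const_nhds.sub (tendsto_one_div_add_atTop_nhds_zero_nat.comp hθ.tendsto_atTop)
    have h3 : Real.pi - 0 ≤ (F a).im := le_of_tendsto_of_tendsto' hinv hi fun n => by
      simp only [Function.comp_apply, hwim]
      exact (hvi (θ n)).le
    linarith [(hD (h.mapsTo ha)).2]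
  have hline : ∀ {y : ℝ}, y ∈ Ioo h₀ Real.pi → ∀ x : ℝ, (x : ℂ) + y * Complex.I ∈ D := by
    intro y hy x
    obtain ⟨h1, h2, -⟩ := line_mem_strip ⟨hh.trans_lt hy.1, hy.2⟩ x
    exact hsub _ h1 (by rw [h2]; exact hy.1)
  -- the means of `Im G` over one period grow linearly, with positive slope
  have hmean : ∃ c : ℝ, ∀ y ∈ Ioo h₀ Real.pi,
      ∫ x in (0 : ℝ)..τ₀, (G (x + y * Complex.I)).im = c + τ * y := by
    set R : ℂ → ℂ := fun w => G w - (τ / τ₀ : ℝ) * w with hR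
    have hsubD : {z : ℂ | h₀ < z.im ∧ z.im < Real.pi} ⊆ D := fun z hz =>
      hsub z ⟨hh.trans_lt hz.1, hz.2⟩ hz.1
    have hRd : DifferentiableOn ℂ R {z | h₀ < z.im ∧ z.im < Real.pi} :=
      (h.differentiableOn_inv.mono hsubD).sub (by fun_prop)
    have hRp : ∀ z : ℂ, h₀ < z.im → z.im < Real.pi → R (z + τ₀) = R z := by
      intro z h1 h2
      have := (h.inv_add_int (hsubD ⟨h1, h2⟩) 1).2
      simp only [Int.cast_one, one_mul] at this
      simp only [hR]
      rw [this]
      push_cast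
      field_simp
      ring
    refine ⟨(∫ x in (0 : ℝ)..τ₀, R (x + y₀ * Complex.I)).im, fun y hy => ?_⟩
    rw [← integral_period_eq hRd hRp hy hy₀]
    have hcont : Continuous fun x : ℝ => R (x + y * Complex.I) :=
      hRd.continuousOn.comp_continuous (by fun_prop) fun x => by simpa using hy
    have e1 : (∫ x in (0 : ℝ)..τ₀, R (x + y * Complex.I)).im =
        ∫ x in (0 : ℝ)..τ₀, (R (x + y * Complex.I)).im :=
      (Complex.imCLM.intervalIntegral_comp_comm (hcont.intervalIntegrable _ _)).symm
    have e2 : ∀ x : ℝ, (G (x + y * Complex.I)).im = (R (x + y * Complex.I)).im + τ / τ₀ * y := by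
      intro x
      simp only [hR, Complex.sub_im, Complex.im_ofReal_mul]
      simp
    simp_rw [e2]
    have hci : Continuous fun x : ℝ => (R (x + y * Complex.I)).im :=
      Complex.continuous_im.comp hcont
    rw [intervalIntegral.integral_add (hci.intervalIntegrable _ _)
      (continuous_const.intervalIntegrable _ _), e1, intervalIntegral.integral_const]
    simp only [smul_eq_mul, sub_zero]
    field_simp
  obtain ⟨c, hc⟩ := hmean
  have hcontl : ∀ {y : ℝ}, y ∈ Ioo h₀ Real.pi →
      Continuous fun x : ℝ => (G (x + y * Complex.I)).im := fun hy =>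
    Complex.continuous_im.comp (h.differentiableOn_inv.continuousOn.comp_continuous (by fun_prop)
      (hline hy))
  have hc0 : 0 ≤ c + τ * y₀ := by
    rw [← hc y₀ hy₀]
    exact intervalIntegral.integral_nonneg hτ₀.le fun x _ => (h.mapsTo_inv (hline hy₀ x)).1.le
  have top : ∀ ε > 0, ∃ w ∈ D, y₀ < w.im ∧ Real.pi - ε < (G w).im := by
    intro ε hε
    set ε' := min ε (min (Real.pi / 2) (τ * (Real.pi - y₀) / (4 * τ₀))) with hε'
    have hyp : 0 < Real.pi - y₀ := by linarith [hy₀.2]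
    have e0 : 0 < ε' := by positivity
    have e2 : ε' ≤ Real.pi / 2 := (min_le_right _ _).trans (min_le_left _ _)
    have e3 : ε' ≤ τ * (Real.pi - y₀) / (4 * τ₀) := (min_le_right _ _).trans (min_le_right _ _)
    obtain ⟨δ, hδ, hd⟩ := near ε' e0
    set y := max (Real.pi - δ / 2) ((Real.pi + y₀) / 2) with hy
    have y1 : y < Real.pi := max_lt (by linarith) (by linarith)
    have y2 : Real.pi - δ / 2 ≤ y := le_max_left _ _
    have y3 : (Real.pi + y₀) / 2 ≤ y := le_max_right _ _
    have hyI : y ∈ Ioo h₀ Real.pi := ⟨by linarith [hy₀.1], y1⟩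
    by_contra! hcon
    have hle : ∀ x : ℝ, (G (x + y * Complex.I)).im ≤ ε' := by
      intro x
      have hyim : ((x : ℂ) + y * Complex.I).im = y := by simp
      have h1 := hcon _ (hline hyI x) (by rw [hyim]; linarith)
      rcases hd _ (hline hyI x) (by rw [hyim]; linarith) with h2 | h2
      · exact h2.le
      · linarith [min_le_left ε (min (Real.pi / 2) (τ * (Real.pi - y₀) / (4 * τ₀)))]
    have h4 := intervalIntegral.integral_mono_on (μ := volume) hτ₀.le
      ((hcontl hyI).intervalIntegrable 0 τ₀)
      ((continuous_const (y := ε')).intervalIntegrable _ _) fun x _ => hle x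
    rw [hc y hyI, intervalIntegral.integral_const, smul_eq_mul, sub_zero] at h4
    have h5 : τ₀ * ε' ≤ τ * (Real.pi - y₀) / 4 := by
      calc _ ≤ τ₀ * (τ * (Real.pi - y₀) / (4 * τ₀)) := by gcongr
        _ = _ := by field_simp
    have h6 : τ * ((Real.pi + y₀) / 2) ≤ τ * y := by gcongr
    have h7 : 0 < τ * (Real.pi - y₀) := by positivity
    linarith
  -- the image of a line is compact modulo the period
  obtain ⟨x₁, -, hx₁⟩ := isCompact_Icc.exists_isMaxOn (nonempty_Icc.2 hτ₀.le)
    (hcontl hy₀).continuousOn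
  set M := (G (x₁ + y₀ * Complex.I)).im with hM
  have hMpi : M < Real.pi := (h.mapsTo_inv (hline hy₀ x₁)).2
  have hMle : ∀ w ∈ D, w.im = y₀ → (G w).im ≤ M := by
    intro w hw hwi
    obtain ⟨k, hk0, hk1⟩ := exists_int_re_mem hτ₀ w
    rw [← hadd w hw k]
    have e : w + k * τ₀ = ((w + k * τ₀).re : ℂ) + y₀ * Complex.I := by
      have : (w + k * τ₀).im = y₀ := by simp [hwi]
      rw [← this, Complex.re_add_im]
    rw [e]
    exact hx₁ ⟨hk0, hk1.le⟩
  refine ⟨M, hMpi, fun w hw hwy => ?_⟩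
  have hconv : Convex ℝ (strip ∩ {z : ℂ | M < z.im}) := convex_strip.inter (convex_halfSpace_im_gt _)
  have hFc : ContinuousOn (fun z => (F z).im) (strip ∩ {z : ℂ | M < z.im}) :=
    Complex.continuous_im.comp_continuousOn (h.differentiableOn.continuousOn.mono inter_subset_left)
  by_contra! hgt
  rcases forall_lt_or_forall_gt hconv hFc le_rfl (fun z hz => by
    rcases lt_trichotomy (F z).im y₀ with h1 | h1 | h1
    · exact Or.inl h1
    · have h2 := hMle _ (h.mapsTo hz.1) h1
      rw [h.left_inv z hz.1] at h2
      exact absurd hz.2 (not_lt.2 h2)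
    · exact Or.inr h1) with h1 | h1
  · obtain ⟨v, hv, hvy, hvM⟩ := top (Real.pi - M) (by linarith)
    have := h1 (G v) ⟨h.mapsTo_inv hv, by rw [mem_ofPred_eq]; linarith⟩
    rw [h.right_inv v hv] at this
    linarith
  · have := h1 (G w) ⟨h.mapsTo_inv hw, hgt⟩
    rw [h.right_inv w hw] at this
    linarith

namespace IsSlitMap

variable {τ₀ T t : ℝ} {l : ℝ → ℂ} {f : ℂ → ℂ}

/-- The tip of a slit that starts on the positive axis is sent to the positive axis. -/
theorem tip_pos (hf : IsSlitMap τ₀ l t f) (hl : IsLogSlit τ₀ T l) (hτ₀ : 0 < τ₀) (ht : t ∈ Ioc 0 T)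
    {x : ℝ} (hx : x ≠ 0)
    (hlim : Tendsto (inverseMap f) (𝓝[{w | Complex.log w ∈ logDomain τ₀ l t}]
      (Complex.exp (l t))) (𝓝 x))
    (hne : (𝓝[{w | Complex.log w ∈ logDomain τ₀ l t}] (Complex.exp (l t))).NeBot) : 0 < x := by
  -- near a negative point the argument is close to `π`, the imaginary part of the top side
  refine lt_of_le_of_ne (not_lt.1 fun hneg => ?_) hx.symm
  have ht' : t ∈ Icc 0 T := ⟨ht.1.le, ht.2⟩
  obtain ⟨τ, hτ, hdil⟩ := hf.exists_dilation hl hτ₀ ht'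
  obtain ⟨h₀, hh0, hhpi, hh⟩ := hl.exists_im_le (ht.1.le.trans ht.2)
  have hlt := hh t ht'
  obtain ⟨M, hM, hle⟩ := (hf.isStripMap hτ₀ hτ hdil).exists_im_inv_le (h₀ := h₀)
    (y₀ := (h₀ + Real.pi) / 2) hτ₀ logDomain_subset_strip (hl.isOpen_logDomain hτ₀ ht.2) hh0
    (fun w hw hwi => ⟨hw, fun k u hu huw => by
      have := hh u ⟨hu.1.le, hu.2.trans ht.2⟩
      rw [huw] at hwi
      simp at hwi
      linarith⟩) ⟨by linarith, by linarith⟩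
  set p := Complex.exp (l t) with hp
  have hpH : p ∈ upperHalf := exp_mem_upperHalf (hl.mem_strip t ht)
  have hlogp : Complex.log p = l t := log_exp_of_mem_strip (hl.mem_strip t ht)
  have harg : Tendsto Complex.arg (𝓝[{z : ℂ | 0 ≤ z.im}] (x : ℂ)) (𝓝 Real.pi) := by
    have := Complex.continuousWithinAt_arg_of_re_neg_of_im_zero (z := x) (by simpa using hneg)
      (by simp)
    have h2 : Complex.arg x = Real.pi := Complex.arg_ofReal_of_neg hneg
    rw [← h2]
    exact this
  have hlim2 : Tendsto (inverseMap f) (𝓝[{w | Complex.log w ∈ logDomain τ₀ l t}] p)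
      (𝓝[{z : ℂ | 0 ≤ z.im}] (x : ℂ)) :=
    tendsto_nhdsWithin_iff.2 ⟨hlim, by
      filter_upwards [self_mem_nhdsWithin] with w hw
      exact (mem_upperHalf.1 (hf.inverse_mem hw)).le⟩
  refine absurd (le_of_tendsto (harg.comp hlim2) ?_) (not_le.2 hM)
  have hc : Tendsto (fun w => (Complex.log w).im) (𝓝 p) (𝓝 (l t).im) := by
    rw [← hlogp]
    exact Complex.continuous_im.continuousAt.comp
      (differentiableAt_log_of_mem_upperHalf hpH).continuousAt
  filter_upwards [self_mem_nhdsWithin, nhdsWithin_le_nhds (hc.eventually_lt_const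
    (by linarith : (l t).im < (h₀ + Real.pi) / 2))] with w hw hwi
  have := hle _ hw hwi
  rw [Complex.exp_log (ne_zero_of_mem_upperHalf (im_pos_of_log_mem_strip hw.1)),
    Complex.log_im] at this
  exact this

/-- The tip limit in logarithmic coordinates. -/
theorem tendsto_log_tip {x : ℝ} (hx : 0 < x)
    (hlim : Tendsto (inverseMap f) (𝓝[{w | Complex.log w ∈ logDomain τ₀ l t}]
      (Complex.exp (l t))) (𝓝 x)) :
    Tendsto (fun w => Complex.log (inverseMap f (Complex.exp w))) (𝓝[logDomain τ₀ l t] (l t))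
      (𝓝 ((Real.log x : ℝ) : ℂ)) := by
  have h1 : Tendsto Complex.exp (𝓝[logDomain τ₀ l t] (l t))
      (𝓝[{w | Complex.log w ∈ logDomain τ₀ l t}] (Complex.exp (l t))) :=
    tendsto_nhdsWithin_iff.2 ⟨(Complex.continuous_exp.tendsto _).mono_left nhdsWithin_le_nhds, by
      filter_upwards [self_mem_nhdsWithin] with w hw
      rw [log_exp_of_mem_strip hw.1]
      exact hw⟩
  have h2 : ContinuousAt Complex.log (x : ℂ) :=
    continuousAt_clog (Complex.mem_slitPlane_iff.2 (Or.inl (by simpa using hx)))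
  rw [Complex.ofReal_log hx.le]
  exact h2.tendsto.comp (hlim.comp h1)

end IsSlitMap

end AnnulusLoewner

/-! ### The kernel of the annulus -/

namespace AnnulusLoewner

/-- The `k`-th term of the kernel of the strip: poles at the points `-k τ`, and a real constant
that makes the series converge. -/
noncomputable def kernelTerm (τ c : ℝ) (z : ℂ) (k : ℤ) : ℂ :=
  1 / (Complex.exp (z + k * τ) - 1) - 1 / (c * Real.exp (k * τ) - 1 : ℝ)

/-- The kernel of the strip with period `τ`. Its imaginary part is the Poisson kernel of the annulus
`strip / τ ℤ` at the boundary point `0`. -/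
noncomputable def stripKernel (τ c : ℝ) (z : ℂ) : ℂ := -∑' k : ℤ, kernelTerm τ c z k

theorem mul_max_exp_le_abs_exp_sub_one {d x : ℝ} (hd : d ≤ |x|) :
    (1 - Real.exp (-d)) * max (Real.exp x) 1 ≤ |Real.exp x - 1| := by
  rcases le_total 0 x with hx | hx
  · rw [abs_of_nonneg hx] at hd
    have h1 : 1 ≤ Real.exp x := Real.one_le_exp hx
    rw [max_eq_left h1, abs_of_nonneg (by linarith)]
    have h2 : Real.exp (-d) * Real.exp x ≥ 1 := by
      rw [← Real.exp_add]; exact Real.one_le_exp (by linarith)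
    nlinarith
  · rw [abs_of_nonpos hx] at hd
    have h1 : Real.exp x ≤ 1 := Real.exp_le_one_iff.2 hx
    rw [max_eq_right h1, abs_of_nonpos (by linarith)]
    have : Real.exp x ≤ Real.exp (-d) := Real.exp_le_exp.2 (by linarith)
    linarith

theorem min_mul_max_le {a u : ℝ} (hu : 0 < u) : min a 1 * max u 1 ≤ max (a * u) 1 := by
  rcases le_total u 1 with h | h
  · rw [max_eq_right h, mul_one]
    exact (min_le_right _ _).trans (le_max_right _ _)
  · rw [max_eq_left h]
    exact (mul_le_mul_of_nonneg_right (min_le_left _ _) hu.le).trans (le_max_left _ _)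

/-- The denominators `c e^{kτ} - 1` stay away from zero, relative to their size: `log c` has a
positive distance to `τ ℤ`. -/
theorem exists_le_abs_mul_exp_sub_one {τ c : ℝ} (hτ : 0 < τ) (hc0 : c ≠ 0)
    (hc : ∀ k : ℤ, c * Real.exp (k * τ) ≠ 1) :
    ∃ κ > 0, ∀ k : ℤ, κ * max (Real.exp (k * τ)) 1 ≤ |c * Real.exp (k * τ) - 1| := by
  rcases lt_or_gt_of_ne hc0 with h | h
  · refine ⟨min (-c) 1, lt_min (by linarith) one_pos, fun k => ?_⟩
    have he := Real.exp_pos (k * τ)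
    refine (min_mul_max_le he).trans ?_
    have : 0 < -c * Real.exp (k * τ) := mul_pos (by linarith) he
    rw [abs_of_neg (by linarith)]
    exact max_le (by linarith) (by linarith)
  · set a := Real.log c / τ with ha
    have hca : ∀ k : ℤ, c * Real.exp (k * τ) = Real.exp ((a + k) * τ) := fun k => by
      rw [add_mul, Real.exp_add, ha, div_mul_cancel₀ _ hτ.ne', Real.exp_log h]
    have hfr : 0 < Int.fract a := by
      refine lt_of_le_of_ne (Int.fract_nonneg a) fun h0 => hc (-⌊a⌋) ?_
      have h1 := Int.self_sub_floor a
      rw [hca, Real.exp_eq_one_iff]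
      push_cast
      rw [← sub_eq_add_neg, h1, ← h0, zero_mul]
    have hfr1 := Int.fract_lt_one a
    set d := min (Int.fract a) (1 - Int.fract a) with hd
    have hd0 : 0 < d := lt_min hfr (by linarith)
    have hk : ∀ k : ℤ, d * τ ≤ |(a + k) * τ| := by
      intro k
      rw [abs_mul, abs_of_pos hτ]
      refine mul_le_mul_of_nonneg_right ?_ hτ.le
      have h1 : a + k = Int.fract a + ((⌊a⌋ + k : ℤ) : ℝ) := by
        push_cast
        linarith [Int.self_sub_floor a]
      rw [h1]
      rcases le_or_gt 0 (⌊a⌋ + k) with h2 | h2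
      · have : (0 : ℝ) ≤ ((⌊a⌋ + k : ℤ) : ℝ) := by exact_mod_cast h2
        exact (min_le_left _ _).trans (le_trans (by linarith) (le_abs_self _))
      · have : ((⌊a⌋ + k : ℤ) : ℝ) ≤ -1 := by exact_mod_cast Int.le_sub_one_iff.2 h2
        exact (min_le_right _ _).trans (le_trans (by linarith) (neg_le_abs _))
    have h2 : 0 < 1 - Real.exp (-(d * τ)) := by
      have : Real.exp (-(d * τ)) < 1 := Real.exp_lt_one_iff.2 (by
        have : 0 < d * τ := by positivity
        linarith)
      linarith
    refine ⟨(1 - Real.exp (-(d * τ))) * min c 1, by positivity, fun k => ?_⟩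
    rw [mul_assoc]
    refine (mul_le_mul_of_nonneg_left (min_mul_max_le (Real.exp_pos _)) h2.le).trans ?_
    rw [hca]
    exact mul_max_exp_le_abs_exp_sub_one (hk k)

/-- A complex number on the ray of angle `y` keeps its distance to `1`. -/
theorem sin_mul_max_le_norm_exp_sub_one {w : ℂ} (hw : w ∈ strip) :
    Real.sin w.im * max (Real.exp w.re) 1 ≤ ‖Complex.exp w - 1‖ := by
  have hs := Real.sin_pos_of_pos_of_lt_pi hw.1 hw.2
  rw [mul_max_of_nonneg _ _ hs.le, mul_one]
  have him : (Complex.exp w - 1).im = Real.exp w.re * Real.sin w.im := by simp [Complex.exp_im]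
  have hre : (Complex.exp w - 1).re = Real.exp w.re * Real.cos w.im - 1 := by simp [Complex.exp_re]
  refine max_le ?_ ?_
  · have := (le_abs_self _).trans (Complex.abs_im_le_norm (Complex.exp w - 1))
    rw [him] at this
    linarith
  · refine le_of_sq_le_sq ?_ (norm_nonneg _) 
    rw [Complex.sq_norm, Complex.normSq_apply, him, hre]
    nlinarith [Real.sin_sq_add_cos_sq w.im, sq_nonneg (Real.exp w.re - Real.cos w.im)]

theorem max_le_norm_exp_sub_one {w : ℂ} (hw : w ∈ strip) (h : Real.pi / 2 ≤ w.im) :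
    max (Real.exp w.re) 1 ≤ ‖Complex.exp w - 1‖ := by
  have hc : Real.cos w.im ≤ 0 :=
    Real.cos_nonpos_of_pi_div_two_le_of_le h (by linarith [hw.2, Real.pi_pos])
  have him : (Complex.exp w - 1).im = Real.exp w.re * Real.sin w.im := by simp [Complex.exp_im]
  have hre : (Complex.exp w - 1).re = Real.exp w.re * Real.cos w.im - 1 := by simp [Complex.exp_re]
  have he := Real.exp_pos w.re
  have hsq : ‖Complex.exp w - 1‖ ^ 2 =
      Real.exp w.re ^ 2 + 1 - 2 * (Real.exp w.re * Real.cos w.im) := by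
    rw [Complex.sq_norm, Complex.normSq_apply, him, hre]
    linear_combination Real.exp w.re ^ 2 * Real.sin_sq_add_cos_sq w.im
  have h2 : Real.exp w.re * Real.cos w.im ≤ 0 := mul_nonpos_of_nonneg_of_nonpos he.le hc
  refine max_le ?_ ?_ <;> refine le_of_sq_le_sq ?_ (norm_nonneg _) <;> rw [hsq] <;> nlinarith

theorem abs_exp_re_sub_one_le (w : ℂ) : |Real.exp w.re - 1| ≤ ‖Complex.exp w - 1‖ := by
  have := abs_norm_sub_norm_le (Complex.exp w) 1
  rwa [Complex.norm_exp, norm_one] at this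

theorem exp_div_max_sq_le (x : ℝ) :
    Real.exp x / max (Real.exp x) 1 ^ 2 ≤ Real.exp (-|x|) := by
  have he := Real.exp_pos x
  rw [div_le_iff₀ (by positivity)]
  rcases le_total 0 x with hx | hx
  · rw [abs_of_nonneg hx, max_eq_left (Real.one_le_exp hx), sq, ← Real.exp_add, ← Real.exp_add]
    simp
  · rw [abs_of_nonpos hx, max_eq_right (Real.exp_le_one_iff.2 hx)]
    simp

theorem summable_exp_neg_abs {τ : ℝ} (hτ : 0 < τ) :
    Summable fun k : ℤ => Real.exp (-|k * τ|) := by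
  have key : Summable fun n : ℕ => Real.exp (-|(n : ℤ) * τ|) := by
    have h1 : ‖Real.exp (-τ)‖ < 1 := by
      rw [Real.norm_of_nonneg (Real.exp_pos _).le, Real.exp_lt_one_iff]
      linarith
    refine (summable_geometric_of_norm_lt_one h1).congr fun n => ?_
    rw [← Real.exp_nat_mul, abs_of_nonneg (by positivity)]
    congr 1
    push_cast
    ring
  refine Summable.of_nat_of_neg key (key.congr fun n => ?_)
  push_cast
  rw [neg_mul, abs_neg]

theorem exp_add_int (z : ℂ) (k : ℤ) (τ : ℝ) :
    Complex.exp (z + k * τ) = Complex.exp z * Real.exp (k * τ) := by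
  rw [Complex.exp_add]; push_cast; rfl

theorem exp_sub_one_ne_zero {w : ℂ} (hw : w ∈ strip) : Complex.exp w - 1 ≠ 0 := by
  have h := exp_mem_upperHalf hw
  intro h0
  rw [sub_eq_zero] at h0
  rw [h0] at h
  simp at h

/-- Geometric bound for the terms of the kernel. -/
theorem exists_norm_kernelTerm_le {τ c : ℝ} (hτ : 0 < τ) (hc0 : c ≠ 0)
    (hc : ∀ k : ℤ, c * Real.exp (k * τ) ≠ 1) :
    ∃ κ > 0, ∀ z ∈ strip, ∀ k : ℤ, ‖kernelTerm τ c z k‖ ≤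
      (|c| + Real.exp z.re) / (κ * (Real.sin z.im * min (Real.exp z.re) 1)) *
        Real.exp (-|k * τ|) := by
  obtain ⟨κ, hκ, hk⟩ := exists_le_abs_mul_exp_sub_one hτ hc0 hc
  refine ⟨κ, hκ, fun z hz k => ?_⟩
  have hw := add_int_mul_mem_strip hz k τ
  have hs := Real.sin_pos_of_pos_of_lt_pi hz.1 hz.2
  have h1 := sin_mul_max_le_norm_exp_sub_one hw
  have him : (z + k * τ).im = z.im := by simp
  have hre : (z + k * τ).re = z.re + k * τ := by simp
  rw [him, hre, Real.exp_add] at h1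
  have he := Real.exp_pos (k * τ)
  have h2 : Real.sin z.im * (min (Real.exp z.re) 1 * max (Real.exp (k * τ)) 1) ≤
      ‖Complex.exp (z + k * τ) - 1‖ :=
    (mul_le_mul_of_nonneg_left (min_mul_max_le he) hs.le).trans h1
  have h3 := hk k
  have hne : (c * Real.exp (k * τ) - 1 : ℝ) ≠ 0 := sub_ne_zero.2 (hc k)
  have e : kernelTerm τ c z k = Real.exp (k * τ) * (c - Complex.exp z) /
      ((Complex.exp (z + k * τ) - 1) * (c * Real.exp (k * τ) - 1 : ℝ)) := by
    have n1 := exp_sub_one_ne_zero hw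
    have n2 : ((c * Real.exp (k * τ) - 1 : ℝ) : ℂ) ≠ 0 := by exact_mod_cast hne
    rw [kernelTerm, div_sub_div _ _ n1 n2]
    congr 1
    rw [exp_add_int]
    push_cast
    ring
  have hmin : 0 < min (Real.exp z.re) 1 := lt_min (Real.exp_pos _) one_pos
  have hmax : 0 < max (Real.exp (k * τ)) 1 := lt_max_of_lt_right one_pos
  rw [e, norm_div, norm_mul, norm_mul, Complex.norm_real, Complex.norm_real, Real.norm_of_nonneg he.le,
    Real.norm_eq_abs]
  have h4 : ‖(c : ℂ) - Complex.exp z‖ ≤ |c| + Real.exp z.re := by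
    refine (norm_sub_le _ _).trans ?_
    rw [Complex.norm_real, Complex.norm_exp, Real.norm_eq_abs]
  calc _ ≤ Real.exp (k * τ) * (|c| + Real.exp z.re) /
        ((Real.sin z.im * (min (Real.exp z.re) 1 * max (Real.exp (k * τ)) 1)) *
          (κ * max (Real.exp (k * τ)) 1)) := by gcongr
    _ = (|c| + Real.exp z.re) / (κ * (Real.sin z.im * min (Real.exp z.re) 1)) *
        (Real.exp (k * τ) / max (Real.exp (k * τ)) 1 ^ 2) := by
      field_simp
    _ ≤ _ := by
      gcongr
      exact exp_div_max_sq_le _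

theorem summable_kernelTerm {τ c : ℝ} (hτ : 0 < τ) (hc0 : c ≠ 0)
    (hc : ∀ k : ℤ, c * Real.exp (k * τ) ≠ 1) {z : ℂ} (hz : z ∈ strip) :
    Summable (kernelTerm τ c z) := by
  obtain ⟨κ, -, h⟩ := exists_norm_kernelTerm_le hτ hc0 hc
  exact Summable.of_norm_bounded ((summable_exp_neg_abs hτ).mul_left _) (h z hz)

theorem differentiableOn_stripKernel {τ c : ℝ} (hτ : 0 < τ) (hc0 : c ≠ 0)
    (hc : ∀ k : ℤ, c * Real.exp (k * τ) ≠ 1) : DifferentiableOn ℂ (stripKernel τ c) strip := by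
  intro z₀ hz₀
  obtain ⟨κ, hκ, h⟩ := exists_norm_kernelTerm_le hτ hc0 hc
  -- the geometric bound is locally uniform
  set B : ℂ → ℝ := fun z => (|c| + Real.exp z.re) / (κ * (Real.sin z.im * min (Real.exp z.re) 1))
  have hB : ContinuousOn B strip := by
    refine ContinuousOn.div (by fun_prop) (by fun_prop) fun z hz => ?_
    have hs := Real.sin_pos_of_pos_of_lt_pi hz.1 hz.2
    have hmin : 0 < min (Real.exp z.re) 1 := lt_min (Real.exp_pos _) one_pos
    positivity
  have hU : IsOpen (strip ∩ B ⁻¹' Iio (B z₀ + 1)) := hB.isOpen_inter_preimage isOpen_strip isOpen_Iio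
  have hd : DifferentiableOn ℂ (fun z => ∑' k : ℤ, kernelTerm τ c z k)
      (strip ∩ B ⁻¹' Iio (B z₀ + 1)) :=
    Complex.differentiableOn_tsum_of_summable_norm
      ((summable_exp_neg_abs hτ).mul_left (B z₀ + 1)) (fun k => by
        intro z hz
        have n1 := exp_sub_one_ne_zero (add_int_mul_mem_strip hz.1 k τ)
        have hd : DifferentiableAt ℂ (fun z => Complex.exp (z + k * τ) - 1) z := by fun_prop
        exact (((differentiableAt_const (1 : ℂ)).fun_div hd n1).sub_const
          _).differentiableWithinAt) hU fun k z hz =>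
        (h z hz.1 k).trans (mul_le_mul_of_nonneg_right (le_of_lt hz.2) (Real.exp_pos _).le)
  exact ((hd.differentiableAt (hU.mem_nhds ⟨hz₀, by simp⟩)).neg).differentiableWithinAt

/-- A telescoping series over the integers. -/
theorem hasSum_int_telescope {g : ℤ → ℂ} {a b : ℂ} (hs : Summable fun k : ℤ => g (k + 1) - g k)
    (htop : Tendsto (fun n : ℕ => g n) atTop (𝓝 a))
    (hbot : Tendsto (fun n : ℕ => g (-n)) atTop (𝓝 b)) :
    HasSum (fun k : ℤ => g (k + 1) - g k) (a - b) := by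
  have h1 := hs.hasSum.comp (Finset.tendsto_Ico_neg (R := ℤ))
  have h3 : ∀ n : ℕ, ∑ k ∈ Finset.Ico (-n : ℤ) n, (g (k + 1) - g k) = g n - g (-n) := by
    intro n
    induction n with
    | zero => simp
    | succ n ih =>
      have hI : Finset.Ico (-((n + 1 : ℕ) : ℤ)) ((n + 1 : ℕ) : ℤ) =
          insert (-((n + 1 : ℕ) : ℤ)) (insert (n : ℤ) (Finset.Ico (-n : ℤ) n)) := by
        ext k
        simp only [Finset.mem_Ico, Finset.mem_insert]
        push_cast
        omega
      rw [hI, Finset.sum_insert (by simp), Finset.sum_insert (by simp), ih]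
      push_cast
      rw [show -((n : ℤ) + 1) + 1 = -(n : ℤ) by ring]
      ring
  have h4 := tendsto_nhds_unique (h1.congr h3) (htop.sub hbot)
  rw [← h4]
  exact hs.hasSum

theorem tendsto_exp_nat_mul {τ : ℝ} (hτ : 0 < τ) :
    Tendsto (fun n : ℕ => Real.exp (n * τ)) atTop atTop :=
  Real.tendsto_exp_atTop.comp (tendsto_natCast_atTop_atTop.atTop_mul_const hτ)

theorem hasSum_reciprocal_sub {τ c : ℝ} (hτ : 0 < τ) (hc0 : c ≠ 0) {g : ℤ → ℂ}
    (hg : ∀ k : ℤ, g k = ((1 / (c * Real.exp (k * τ) - 1) : ℝ) : ℂ))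
    (hsg : Summable fun k : ℤ => g (k + 1) - g k) : HasSum (fun k : ℤ => g (k + 1) - g k) 1 := by
  have htop : Tendsto (fun n : ℕ => g n) atTop (𝓝 0) := by
    have h2 : Tendsto (fun n : ℕ => |c * Real.exp (n * τ) - 1|) atTop atTop := by
      refine tendsto_atTop_mono (f := fun n : ℕ => |c| * Real.exp (n * τ) - 1) (fun n => ?_)
        (tendsto_atTop_add_const_right _ _
          ((tendsto_exp_nat_mul hτ).const_mul_atTop (abs_pos.2 hc0)))
      have := abs_sub_abs_le_abs_sub (c * Real.exp (n * τ)) 1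
      rwa [abs_mul, abs_of_pos (Real.exp_pos _), abs_one] at this
    refine tendsto_zero_iff_norm_tendsto_zero.2 (h2.inv_tendsto_atTop.congr fun n => ?_)
    rw [hg, Complex.norm_real, Real.norm_eq_abs, one_div, abs_inv, Int.cast_natCast]
    rfl
  have hbot : Tendsto (fun n : ℕ => g (-n)) atTop (𝓝 (-1)) := by
    have h1 : Tendsto (fun n : ℕ => (Real.exp (n * τ))⁻¹) atTop (𝓝 0) :=
      (tendsto_exp_nat_mul hτ).inv_tendsto_atTop
    have h2 : Tendsto (fun n : ℕ => (1 / (c * (Real.exp (n * τ))⁻¹ - 1) : ℝ)) atTop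
        (𝓝 (1 / (c * 0 - 1))) :=
      tendsto_const_nhds.div ((h1.const_mul c).sub_const 1) (by norm_num)
    have h3 := (Complex.continuous_ofReal.tendsto _).comp h2
    have h4 : (((1 / (c * 0 - 1) : ℝ)) : ℂ) = -1 := by norm_num
    rw [h4] at h3
    refine h3.congr fun n => ?_
    rw [hg, Function.comp_apply, ← Real.exp_neg, Int.cast_neg, Int.cast_natCast, neg_mul]
  have hsum := hasSum_int_telescope hsg htop hbot
  rwa [zero_sub, neg_neg] at hsum

/-- The reciprocals telescope: the kernel drops by one over a period. -/
theorem stripKernel_add {τ c : ℝ} (hτ : 0 < τ) (hc0 : c ≠ 0)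
    (hc : ∀ k : ℤ, c * Real.exp (k * τ) ≠ 1) {z : ℂ} (hz : z ∈ strip) :
    stripKernel τ c (z + τ) = stripKernel τ c z - 1 := by
  obtain ⟨g, hg⟩ : ∃ g : ℤ → ℂ, ∀ k : ℤ, g k = ((1 / (c * Real.exp (k * τ) - 1) : ℝ) : ℂ) :=
    ⟨_, fun _ => rfl⟩
  have e : ∀ k : ℤ, kernelTerm τ c (z + τ) k = kernelTerm τ c z (k + 1) + (g (k + 1) - g k) := by
    intro k
    rw [kernelTerm, kernelTerm, hg, hg]
    have : z + τ + k * τ = z + ((k + 1 : ℤ) : ℂ) * τ := by push_cast; ring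
    rw [this]
    push_cast
    ring
  have hs1 := summable_kernelTerm hτ hc0 hc hz
  have hs2 := summable_kernelTerm hτ hc0 hc (add_mem_strip hz τ)
  have hs1' : HasSum (fun k : ℤ => kernelTerm τ c z (k + 1)) (∑' k : ℤ, kernelTerm τ c z k) :=
    (Equiv.addRight (1 : ℤ)).hasSum_iff.2 hs1.hasSum
  have hsg : Summable fun k : ℤ => g (k + 1) - g k := by
    refine (hs2.sub hs1'.summable).congr fun k => ?_
    rw [e k]; ring
  have h6 := hs1'.add (hasSum_reciprocal_sub hτ hc0 hg hsg)
  have h7 := (h6.congr_fun e).tsum_eq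
  rw [stripKernel, h7, stripKernel]
  ring

end AnnulusLoewner

/-! ### Boundary values of the kernel -/

namespace AnnulusLoewner

variable {τ c : ℝ}

/-- The imaginary part of a term of the kernel is a Poisson kernel: the real constant drops out. -/
theorem im_kernelTerm (τ c : ℝ) (z : ℂ) (k : ℤ) :
    (kernelTerm τ c z k).im =
      -(Real.exp (z.re + k * τ) * Real.sin z.im / ‖Complex.exp (z + k * τ) - 1‖ ^ 2) := by
  rw [kernelTerm, Complex.sub_im, one_div, Complex.inv_im, ← Complex.normSq_eq_norm_sq]
  have h1 : ((1 : ℂ) / (c * Real.exp (k * τ) - 1 : ℝ)).im = 0 := by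
    rw [← Complex.ofReal_one, ← Complex.ofReal_div, Complex.ofReal_im]
  have h2 : (Complex.exp (z + k * τ) - 1).im = Real.exp (z.re + k * τ) * Real.sin z.im := by
    simp [Complex.exp_im]
  rw [h1, h2, sub_zero, neg_div]

theorem hasSum_im_stripKernel (hτ : 0 < τ) (hc0 : c ≠ 0)
    (hc : ∀ k : ℤ, c * Real.exp (k * τ) ≠ 1) {z : ℂ} (hz : z ∈ strip) :
    HasSum (fun k : ℤ => Real.exp (z.re + k * τ) * Real.sin z.im /
      ‖Complex.exp (z + k * τ) - 1‖ ^ 2) (stripKernel τ c z).im := by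
  have h := (Complex.hasSum_im (summable_kernelTerm hτ hc0 hc hz).hasSum).neg
  rw [← Complex.neg_im] at h
  refine h.congr_fun fun k => ?_
  rw [im_kernelTerm, neg_neg]

theorem im_stripKernel_nonneg (hτ : 0 < τ) (hc0 : c ≠ 0)
    (hc : ∀ k : ℤ, c * Real.exp (k * τ) ≠ 1) {z : ℂ} (hz : z ∈ strip) :
    0 ≤ (stripKernel τ c z).im := by
  have hs := Real.sin_pos_of_pos_of_lt_pi hz.1 hz.2
  exact (hasSum_im_stripKernel hτ hc0 hc hz).nonneg fun k => by positivity

theorem stripKernel_add_int (hτ : 0 < τ) (hc0 : c ≠ 0)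
    (hc : ∀ k : ℤ, c * Real.exp (k * τ) ≠ 1) {z : ℂ} (hz : z ∈ strip) (k : ℤ) :
    (stripKernel τ c (z + k * τ)).im = (stripKernel τ c z).im := by
  have h := (map_add_int_mul (F := stripKernel τ c) (σ := -1) (fun z hz => add_mem_strip hz τ)
    (fun z hz => by simpa [sub_eq_add_neg] using add_mem_strip hz (-τ))
    (fun z hz => by rw [stripKernel_add hτ hc0 hc hz]; push_cast; ring) hz k).2
  rw [h]
  simp

/-- The Poisson kernel is small where the distance to its poles is comparable to the size of the
point and the sine of the angle is small. -/
theorem im_stripKernel_le (hτ : 0 < τ) (hc0 : c ≠ 0)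
    (hc : ∀ k : ℤ, c * Real.exp (k * τ) ≠ 1) {z : ℂ} (hz : z ∈ strip) {κ : ℝ} (hκ : 0 < κ)
    (h : ∀ k : ℤ, κ * max (Real.exp (z.re + k * τ)) 1 ≤ ‖Complex.exp (z + k * τ) - 1‖) :
    (stripKernel τ c z).im ≤
      Real.sin z.im / κ ^ 2 * (Real.exp τ * ∑' k : ℤ, Real.exp (-|k * τ|)) := by
  obtain ⟨m, hm0, hm1⟩ := exists_int_re_mem hτ z
  have hms := add_int_mul_mem_strip hz m τ
  rw [← stripKernel_add_int hτ hc0 hc hz m]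
  have hre : (z + m * τ).re = z.re + m * τ := by simp
  have him : (z + m * τ).im = z.im := by simp
  have hs := Real.sin_pos_of_pos_of_lt_pi hz.1 hz.2
  rw [hre] at hm0 hm1
  refine hasSum_le (fun k => ?_) (hasSum_im_stripKernel hτ hc0 hc hms)
    (((summable_exp_neg_abs hτ).hasSum.mul_left (Real.exp τ)).mul_left (Real.sin z.im / κ ^ 2))
  have h1 := h (m + k)
  have e1 : z.re + ((m + k : ℤ) : ℝ) * τ = (z + m * τ).re + k * τ := by
    rw [hre]; push_cast; ring
  have e2 : z + ((m + k : ℤ) : ℂ) * τ = z + m * τ + k * τ := by push_cast; ring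
  rw [e1, e2] at h1
  set x := (z + m * τ).re + k * τ with hx
  have hmax : 0 < max (Real.exp x) 1 := lt_max_of_lt_right one_pos
  rw [him]
  calc _ ≤ Real.exp x * Real.sin z.im / (κ * max (Real.exp x) 1) ^ 2 := by gcongr
    _ = Real.sin z.im / κ ^ 2 * (Real.exp x / max (Real.exp x) 1 ^ 2) := by field_simp
    _ ≤ Real.sin z.im / κ ^ 2 * Real.exp (-|x|) := by
      gcongr
      exact exp_div_max_sq_le x
    _ ≤ _ := by
      rw [← Real.exp_add]
      gcongr
      have : |(k : ℝ) * τ| ≤ |x| + τ := by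
        have h3 := abs_sub_abs_le_abs_sub ((k : ℝ) * τ) (-(z + m * τ).re)
        rw [abs_neg, sub_neg_eq_add, add_comm ((k : ℝ) * τ), ← hx, hre,
          abs_of_nonneg hm0] at h3
        linarith
      linarith

/-- The boundary behaviour of the kernel: it is concentrated at its poles. -/
theorem hasStripBoundary_stripKernel (hτ : 0 < τ) (hc0 : c ≠ 0)
    (hc : ∀ k : ℤ, c * Real.exp (k * τ) ≠ 1) (x₀ : ℝ) {η : ℝ} (hη : 0 < η) :
    HasStripBoundary τ x₀ η 1 fun z => τ * stripKernel τ c (z - x₀) := by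
  have hmem : ∀ z ∈ strip, z - x₀ ∈ strip := fun z hz => by
    simpa [sub_eq_add_neg] using add_mem_strip hz (-x₀)
  have him : ∀ z : ℂ, (τ * stripKernel τ c (z - x₀)).im = τ * (stripKernel τ c (z - x₀)).im :=
    fun z => Complex.im_ofReal_mul _ _
  have hzim : ∀ z : ℂ, (z - x₀).im = z.im := fun z => by simp
  set B := Real.exp τ * ∑' k : ℤ, Real.exp (-|k * τ|) with hB
  have hB0 : 0 ≤ B := mul_nonneg (Real.exp_pos _).le (tsum_nonneg fun k => (Real.exp_pos _).le)
  -- a uniform bound, given the distance to the poles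
  have key : ∀ κ > 0, ∀ ε > 0, ∃ δ > 0, ∀ z ∈ strip, Real.sin z.im < δ →
      (∀ k : ℤ, κ * max (Real.exp ((z - x₀).re + k * τ)) 1 ≤
        ‖Complex.exp (z - x₀ + k * τ) - 1‖) → |(τ * stripKernel τ c (z - x₀)).im| ≤ ε := by
    intro κ hκ ε hε
    refine ⟨ε * κ ^ 2 / (τ * (B + 1)), by positivity, fun z hz hzs h => ?_⟩
    have h1 := im_stripKernel_le hτ hc0 hc (hmem z hz) hκ h
    have h0 := im_stripKernel_nonneg hτ hc0 hc (hmem z hz)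
    rw [him, abs_of_nonneg (by positivity)]
    rw [hzim, ← hB] at h1
    have hs := Real.sin_pos_of_pos_of_lt_pi hz.1 hz.2
    calc _ ≤ τ * (Real.sin z.im / κ ^ 2 * B) := by gcongr
      _ ≤ τ * ((ε * κ ^ 2 / (τ * (B + 1))) / κ ^ 2 * (B + 1)) := by
        gcongr
        linarith
      _ = ε := by field_simp
  refine ⟨?_, fun z hz => ?_, fun ε hε => ?_, fun ε hε => ?_, fun ε hε => ?_⟩
  · exact ((differentiableOn_stripKernel hτ hc0 hc).comp (by fun_prop) hmem).const_mul _
  · have e : z + τ - x₀ = z - x₀ + τ := by ring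
    rw [e, stripKernel_add hτ hc0 hc (hmem z hz)]
    push_cast
    ring
  · obtain ⟨δ, hδ, hd⟩ := key 1 one_pos ε hε
    refine ⟨min δ (Real.pi / 2), lt_min hδ (by positivity), fun z hz hzi => hd z hz ?_ fun k => ?_⟩
    · rw [← Real.sin_pi_sub]
      refine (Real.sin_lt (by linarith [hz.2])).trans ?_
      linarith [min_le_left δ (Real.pi / 2)]
    · rw [one_mul]
      have := max_le_norm_exp_sub_one (add_int_mul_mem_strip (hmem z hz) k τ) (by
        have := min_le_right δ (Real.pi / 2)
        simp
        linarith)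
      simpa using this
  · refine ⟨1, one_pos, fun z hz _ => ?_⟩
    have h0 := im_stripKernel_nonneg hτ hc0 hc (hmem z hz)
    rw [him]
    have : 0 ≤ τ * (stripKernel τ c (z - x₀)).im := by positivity
    linarith
  · have hκ : 0 < 1 - Real.exp (-η) := by
      have : Real.exp (-η) < 1 := Real.exp_lt_one_iff.2 (by linarith)
      linarith
    obtain ⟨δ, hδ, hd⟩ := key _ hκ ε hε
    refine ⟨δ, hδ, fun z hz hzi hzo => hd z hz ((Real.sin_lt hz.1).trans hzi) fun k => ?_⟩
    have h1 := hzo (-k)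
    have e : z.re - x₀ - ((-k : ℤ) : ℝ) * τ = (z - x₀ + k * τ).re := by
      simp
    have e2 : (z - x₀).re + k * τ = (z - x₀ + k * τ).re := by simp
    rw [e] at h1
    rw [e2]
    -- away from the poles `e^w` keeps a distance to `1` already in modulus
    exact (mul_max_exp_le_abs_exp_sub_one h1).trans (abs_exp_re_sub_one_le _)

/-- The terms of the vector field in the upper half-plane are those of the kernel of the strip. -/
theorem fieldTerm_eq {τ' ξ c : ℝ} (hξ : 0 < ξ) (z : ℂ) (hz : z ≠ 0) (k : ℤ) :
    fieldTerm τ τ' ξ c z k =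
      τ' * z * kernelTerm τ (c / ξ) (Complex.log z - Real.log ξ) k := by
  have hξc : (ξ : ℂ) ≠ 0 := by exact_mod_cast hξ.ne'
  have e1 : Complex.exp (Complex.log z - Real.log ξ + k * τ) = z / ξ * Real.exp (k * τ) := by
    rw [exp_add_int, Complex.exp_sub, Complex.exp_log hz, ← Complex.ofReal_exp, Real.exp_log hξ]
  have e2 : z / ξ * (Real.exp (k * τ) : ℂ) - 1 = (Real.exp (k * τ) * z - ξ) / ξ := by
    field_simp
  have e3 : ((c / ξ * Real.exp (k * τ) - 1 : ℝ) : ℂ) = (Real.exp (k * τ) * c - ξ) / ξ := by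
    push_cast
    field_simp
  rw [fieldTerm, kernelTerm, e1, e2, e3, one_div_div, one_div_div]
  ring

theorem field_eq {lam τ' ξ c : ℝ} (hξ : 0 < ξ) (z : ℂ) (hz : z ≠ 0) :
    field lam τ τ' ξ c z =
      z * (lam + τ' * stripKernel τ (c / ξ) (Complex.log z - Real.log ξ)) := by
  rw [field, stripKernel]
  simp_rw [fieldTerm_eq hξ z hz]
  rw [tsum_mul_left]
  ring

end AnnulusLoewner

/-! ### The velocity of the transition maps -/

namespace AnnulusLoewner

/-- If the transition maps of a family of strip maps have a left derivative in time, this derivative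
is a multiple of the kernel of the strip plus a real constant. -/
theorem eq_const_add_stripKernel_of_tendsto {τ₀ T t x₀ c : ℝ} {l : ℝ → ℂ} {σ : ℝ → ℝ}
    {F G : ℝ → ℂ → ℂ} {V : ℂ → ℂ} (hl : IsLogSlit τ₀ T l) (hτ₀ : 0 < τ₀) (ht : t ∈ Ioc 0 T)
    (h : ∀ s ∈ Icc 0 T, IsStripMap τ₀ (σ s) (logDomain τ₀ l s) (F s) (G s))
    (htip : Tendsto (G t) (𝓝[logDomain τ₀ l t] (l t)) (𝓝 (x₀ : ℂ)))
    (hσ : DifferentiableAt ℝ σ t) (hc0 : c ≠ 0) (hc : ∀ k : ℤ, c * Real.exp (k * σ t) ≠ 1)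
    (hV : ∀ z ∈ strip, Tendsto (fun s : ℝ => (G s (F t z) - z) / (t - s : ℝ)) (𝓝[<] t) (𝓝 (V z))) :
    ∃ lam : ℝ, ∀ z ∈ strip, V z = lam + deriv σ t * stripKernel (σ t) c (z - x₀) := by
  have htm : t ∈ Icc 0 T := ⟨ht.1.le, ht.2⟩
  have hF := h t htm
  have hpos := hF.pos
  set E : ℂ → ℂ := fun z => σ t * stripKernel (σ t) c (z - x₀) with hE
  set b : ℝ → ℝ := fun s => 1 - σ s / σ t with hb
  set β := deriv σ t / σ t with hβ
  have hbl : Tendsto (fun s => b s / (t - s)) (𝓝[<] t) (𝓝 β) := by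
    have h1 : Tendsto (slope σ t) (𝓝[<] t) (𝓝 (deriv σ t)) :=
      (hasDerivAt_iff_tendsto_slope.1 hσ.hasDerivAt).mono_left
        (nhdsWithin_mono _ fun s hs => ne_of_lt hs)
    refine (h1.div_const (σ t)).congr' ?_
    filter_upwards [self_mem_nhdsWithin] with s hs
    have h2 : t - s ≠ 0 := sub_ne_zero.2 (ne_of_gt hs)
    have h3 : s - t ≠ 0 := sub_ne_zero.2 (ne_of_lt hs)
    simp only [hb, slope_def_field]
    field_simp
    ring
  have hσc : Tendsto σ (𝓝[<] t) (𝓝 (σ t)) := hσ.continuousAt.tendsto.mono_left nhdsWithin_le_nhds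
  have hbhalf : ∀ᶠ s in 𝓝[<] t, b s < 1 / 2 := by
    have : Tendsto b (𝓝[<] t) (𝓝 (1 - σ t / σ t)) := tendsto_const_nhds.sub (hσc.div_const _)
    rw [div_self hpos.ne', sub_self] at this
    exact this.eventually_lt_const (by norm_num)
  -- the claim is that `W`, the limit of the difference quotients `D s`, is a real constant
  set W : ℂ → ℂ := fun z => V z - β * E z with hW
  set D : ℝ → ℂ → ℂ := fun s z => (G s (F t z) - z) / (t - s : ℝ) - (b s / (t - s) : ℝ) * E z with hD
  have hDW : ∀ z ∈ strip, Tendsto (fun s => D s z) (𝓝[<] t) (𝓝 (W z)) := fun z hz =>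
    (hV z hz).sub (((Complex.continuous_ofReal.tendsto _).comp hbl).mul_const _)
  -- the comparison estimate, divided by the elapsed time
  have hest : ∀ η > 0, 8 * η < σ t → ∀ᶠ s in 𝓝[<] t, ∃ lam : ℝ, ∀ z ∈ strip,
      ‖D s z - lam‖ ≤ HasStripBoundary.comparisonConst (σ t) z.im * (b s / (t - s) * η) := by
    intro η hη hητ
    obtain ⟨s₀, hs₀, hs⟩ := hF.transition_near_boundary hl hτ₀ ht htip hη
    filter_upwards [hbhalf, Ioo_mem_nhdsLT (max_lt hs₀ ht.1)] with s hsb hst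
    have hs1 : s ∈ Ico s₀ t := ⟨(le_max_left _ _).trans hst.1.le, hst.2⟩
    have hs2 : 0 ≤ s := (le_max_right _ _).trans hst.1.le
    have hFs := h s ⟨hs2, hst.2.le.trans ht.2⟩
    have hsub : logDomain τ₀ l t ⊆ logDomain τ₀ l s := logDomain_anti hst.2.le
    have hQ := hasStripBoundary_sub_id hpos hFs.pos hsb hη hητ
      (hF.transition_differentiableOn hFs hsub) (hF.transition_mapsTo hFs hsub)
      (fun z hz => hF.transition_add hFs hsub hz) (hs s hs1 hs2 _ _ _ hFs)
    obtain ⟨lam, hlam⟩ := hQ.exists_norm_sub_le hpos hη.le (E := E)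
      fun η hη => hasStripBoundary_stripKernel hpos hc0 hc x₀ hη
    have hts : 0 < t - s := sub_pos.2 hst.2
    have htsc : ((t - s : ℝ) : ℂ) ≠ 0 := by exact_mod_cast hts.ne'
    refine ⟨lam / (t - s), fun z hz => ?_⟩
    have h1 := hlam z hz
    have e : D s z - (lam / (t - s) : ℝ) =
        (G s (F t z) - z - (1 - σ s / σ t : ℝ) * E z - lam) / (t - s : ℝ) := by
      simp only [hD, hb]
      push_cast
      push_cast at htsc
      field_simp
    rw [e, norm_div, Complex.norm_real, Real.norm_of_nonneg hts.le, div_le_iff₀ hts]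
    refine h1.trans_eq ?_
    simp only [hb]
    field_simp
  have hsmall : ∀ C : ℝ, Tendsto (fun η : ℝ => C * (β * η)) (𝓝[>] 0) (𝓝 0) := fun C => by
    have : Continuous fun η : ℝ => C * (β * η) := by fun_prop
    have h1 := (this.tendsto 0).mono_left (nhdsWithin_le_nhds (s := Ioi 0))
    simpa using h1
  have hev : ∀ᶠ η in 𝓝[>] (0 : ℝ), 0 < η ∧ 8 * η < σ t := by
    filter_upwards [Ioo_mem_nhdsGT (show 0 < σ t / 8 by positivity)] with η hη
    exact ⟨hη.1, by linarith [hη.2]⟩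
  have hlimC : ∀ C η : ℝ, Tendsto (fun s => C * (b s / (t - s) * η)) (𝓝[<] t)
      (𝓝 (C * (β * η))) := fun C η => (hbl.mul_const η).const_mul C
  have him : ∀ z ∈ strip, (W z).im = 0 := by
    intro z hz
    refine abs_nonpos_iff.1 (ge_of_tendsto (hsmall (HasStripBoundary.comparisonConst (σ t) z.im)) ?_)
    filter_upwards [hev] with η hη
    refine le_of_tendsto_of_tendsto (((Complex.continuous_im.tendsto _).comp (hDW z hz)).abs)
      (hlimC _ η) ?_
    filter_upwards [hest η hη.1 hη.2] with s ⟨lam, hs⟩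
    refine le_trans ?_ (hs z hz)
    have := Complex.abs_im_le_norm (D s z - lam)
    simpa using this
  -- first let `s` tend to `t` for fixed `η`, then let `η` tend to `0`
  have hconst : ∀ z ∈ strip, ∀ w ∈ strip, W z = W w := by
    intro z hz w hw
    rw [← sub_eq_zero, ← norm_le_zero_iff]
    refine ge_of_tendsto (hsmall (HasStripBoundary.comparisonConst (σ t) z.im +
      HasStripBoundary.comparisonConst (σ t) w.im)) ?_
    filter_upwards [hev] with η hη
    refine le_of_tendsto_of_tendsto ((hDW z hz).sub (hDW w hw)).norm (hlimC _ η) ?_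
    filter_upwards [hest η hη.1 hη.2] with s ⟨lam, hs⟩
    rw [add_mul]
    have e : D s z - D s w = (D s z - lam) - (D s w - lam) := by ring
    rw [e]
    exact (norm_sub_le _ _).trans (add_le_add (hs z hz) (hs w hw))
  have hz₀ : (Real.pi / 2 : ℝ) * Complex.I ∈ strip := by
    simpa using mem_strip_of_Ioo half_pi_mem 0
  refine ⟨(W ((Real.pi / 2 : ℝ) * Complex.I)).re, fun z hz => ?_⟩
  have h1 : W z = ((W ((Real.pi / 2 : ℝ) * Complex.I)).re : ℂ) := by
    rw [hconst z hz _ hz₀]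
    exact Complex.ext (by simp) (by simpa using him _ hz₀)
  rw [← h1]
  have h2 : (σ t : ℂ) ≠ 0 := by exact_mod_cast hpos.ne'
  simp only [hW, hE, hβ]
  push_cast
  field_simp
  ring

end AnnulusLoewner

/-! ### Convergence of univalent maps and implicit derivatives -/

namespace AnnulusLoewner

/-- Continuity of the Cauchy integrals `∮ g (ζ) (ζ - w)⁻ⁿ dζ` jointly in `w` and in the function,
for pointwise bounded convergence of the functions. -/
theorem tendsto_cauchyIntegral {ι : Type*} {L : Filter ι} [L.IsCountablyGenerated]
    {g : ι → ℂ → ℂ} {g₀ : ℂ → ℂ} {z : ℂ} {R : ℝ} (hR : 0 < R) (n : ℕ)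
    (hc : ∀ᶠ s in L, ContinuousOn (g s) (Metric.sphere z R))
    (hb : ∀ᶠ s in L, ∀ ζ ∈ Metric.sphere z R, ‖g s ζ‖ ≤ 1)
    (hlim : ∀ ζ ∈ Metric.sphere z R, Tendsto (fun s => g s ζ) L (𝓝 (g₀ ζ))) :
    Tendsto (fun p : ι × ℂ => ∮ ζ in C(z, R), ((ζ - p.2) ^ n)⁻¹ • g p.1 ζ) (L ×ˢ 𝓝 z)
      (𝓝 (∮ ζ in C(z, R), ((ζ - z) ^ n)⁻¹ • g₀ ζ)) := by
  have hball : ∀ᶠ w in 𝓝 z, dist w z < R / 2 := Metric.ball_mem_nhds z (by positivity)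
  have hdist : ∀ w, dist w z < R / 2 → ∀ ζ ∈ Metric.sphere z R, R / 2 ≤ ‖ζ - w‖ := by
    intro w hw ζ hζ
    have h1 := dist_triangle ζ w z
    rw [Metric.mem_sphere.1 hζ, dist_eq_norm ζ w] at h1
    linarith
  have hmem : ∀ θ, circleMap z R θ ∈ Metric.sphere z R := fun θ => circleMap_mem_sphere z hR.le θ
  simp only [circleIntegral]
  refine intervalIntegral.tendsto_integral_filter_of_dominated_convergence
    (fun _ => R * (((R / 2) ^ n)⁻¹ * 1)) ?_ ?_ intervalIntegrable_const ?_
  · filter_upwards [hc.prod_mk hball] with p hp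
    refine (Continuous.aestronglyMeasurable ?_)
    have h1 : Continuous fun θ => g p.1 (circleMap z R θ) :=
      hp.1.comp_continuous (continuous_circleMap z R) hmem
    have h2 : Continuous fun θ => ((circleMap z R θ - p.2) ^ n)⁻¹ := by
      refine Continuous.inv₀ (((continuous_circleMap z R).sub continuous_const).pow n) fun θ => ?_
      refine pow_ne_zero _ (norm_pos_iff.1 (lt_of_lt_of_le ?_ (hdist _ hp.2 _ (hmem θ))))
      positivity
    simp only [deriv_circleMap]
    exact ((continuous_circleMap 0 R).mul continuous_const).smul (h2.smul h1)
  · filter_upwards [hb.prod_mk hball] with p hp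
    refine Eventually.of_forall fun θ _ => ?_
    rw [norm_smul, norm_smul, deriv_circleMap, norm_mul, norm_circleMap_zero, Complex.norm_I, mul_one,
      abs_of_pos hR, norm_inv, norm_pow]
    have := hdist _ hp.2 _ (hmem θ)
    gcongr
    exact hp.1 _ (hmem θ)
  · refine Eventually.of_forall fun θ _ => ?_
    refine Tendsto.smul tendsto_const_nhds (Tendsto.smul (Tendsto.inv₀ ?_ ?_) ?_)
    · exact (tendsto_const_nhds.sub tendsto_snd).pow n
    · refine pow_ne_zero _ (norm_pos_iff.1 (lt_of_lt_of_le ?_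
        (hdist z (by simpa using hR) _ (hmem θ))))
      positivity
    · exact (hlim _ (hmem θ)).comp tendsto_fst

/-- Pointwise convergence of holomorphic self-maps of the upper half-plane gives locally uniform
convergence of the derivatives. -/
theorem tendsto_deriv_of_tendsto {ι : Type*} {L : Filter ι} [L.IsCountablyGenerated]
    {f : ι → ℂ → ℂ} {f₀ : ℂ → ℂ} (hd : ∀ᶠ s in L, DifferentiableOn ℂ (f s) upperHalf)
    (hm : ∀ᶠ s in L, MapsTo (f s) upperHalf upperHalf) (hd₀ : DifferentiableOn ℂ f₀ upperHalf)
    (hm₀ : MapsTo f₀ upperHalf upperHalf)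
    (hlim : ∀ z ∈ upperHalf, Tendsto (fun s => f s z) L (𝓝 (f₀ z))) {z : ℂ} (hz : z ∈ upperHalf) :
    Tendsto (fun p : ι × ℂ => deriv (f p.1) p.2) (L ×ˢ 𝓝 z) (𝓝 (deriv f₀ z)) := by
  have hne : ∀ {w : ℂ}, w ∈ upperHalf → w + Complex.I ≠ 0 := fun hw =>
    norm_pos_iff.1 (one_pos.trans_le (one_le_norm_add_I hw))
  -- the bounded functions `1 / (f + i)`
  obtain ⟨g, hg'⟩ : ∃ g : (ℂ → ℂ) → ℂ → ℂ, ∀ f, g f = fun w => (f w + Complex.I)⁻¹ :=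
    ⟨_, fun _ => rfl⟩
  have hg : ∀ f w, g f w = (f w + Complex.I)⁻¹ := fun f w => by rw [hg']
  have hgd : ∀ {f : ℂ → ℂ}, DifferentiableOn ℂ f upperHalf → MapsTo f upperHalf upperHalf →
      DifferentiableOn ℂ (g f) upperHalf := fun hf hfm => by
    rw [hg']
    exact (hf.add_const _).fun_inv fun w hw => hne (hfm hw)
  have hgb : ∀ {f : ℂ → ℂ}, MapsTo f upperHalf upperHalf → ∀ w ∈ upperHalf, ‖g f w‖ ≤ 1 :=
    fun hfm w hw => by
      rw [hg, norm_inv]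
      exact inv_le_one_of_one_le₀ (one_le_norm_add_I (hfm hw))
  obtain ⟨R, hR, hball⟩ := Metric.nhds_basis_closedBall.mem_iff.1 (isOpen_upperHalf.mem_nhds hz)
  have hsph : Metric.sphere z R ⊆ upperHalf := Metric.sphere_subset_closedBall.trans hball
  have key : ∀ n, Tendsto (fun p : ι × ℂ => ∮ ζ in C(z, R), ((ζ - p.2) ^ n)⁻¹ • g (f p.1) ζ)
      (L ×ˢ 𝓝 z) (𝓝 (∮ ζ in C(z, R), ((ζ - z) ^ n)⁻¹ • g f₀ ζ)) := by
    intro n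
    refine tendsto_cauchyIntegral (g := fun s => g (f s)) (g₀ := g f₀) hR n ?_ ?_ fun ζ hζ => ?_
    · filter_upwards [hd, hm] with s hs hs'
      exact (hgd hs hs').continuousOn.mono hsph
    · filter_upwards [hm] with s hs
      exact fun ζ hζ => hgb hs ζ (hsph hζ)
    · simp only [hg]
      exact ((hlim ζ (hsph hζ)).add_const _).inv₀ (hne (hm₀ (hsph hζ)))
  have hzR : z ∈ Metric.ball z R := Metric.mem_ball_self hR
  have val : ∀ {f : ℂ → ℂ}, DifferentiableOn ℂ f upperHalf → MapsTo f upperHalf upperHalf →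
      ∀ w ∈ Metric.ball z R,
        (2 * Real.pi * Complex.I : ℂ)⁻¹ • (∮ ζ in C(z, R), ((ζ - w) ^ 1)⁻¹ • g f ζ) = g f w ∧
        (2 * Real.pi * Complex.I : ℂ)⁻¹ • (∮ ζ in C(z, R), ((ζ - w) ^ 2)⁻¹ • g f ζ) =
          deriv (g f) w := by
    intro f hf hfm w hw
    constructor
    · simp only [pow_one]
      exact Complex.two_pi_I_inv_smul_circleIntegral_sub_inv_smul_of_differentiable_on_off_countable
        countable_empty hw ((hgd hf hfm).continuousOn.mono hball) fun x hx =>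
          (hgd hf hfm).differentiableAt (isOpen_upperHalf.mem_nhds
            (hball (Metric.ball_subset_closedBall hx.1)))
    · exact Complex.two_pi_I_inv_smul_circleIntegral_sub_sq_inv_smul_of_differentiable
        isOpen_upperHalf hball (hgd hf hfm) hw
  have hder : ∀ {f : ℂ → ℂ}, DifferentiableOn ℂ f upperHalf → MapsTo f upperHalf upperHalf →
      ∀ w ∈ Metric.ball z R, deriv f w = -deriv (g f) w / g f w ^ 2 := by
    intro f hf hfm w hw
    have hwH := hball (Metric.ball_subset_closedBall hw)
    have h1 := (((hf.differentiableAt (isOpen_upperHalf.mem_nhds hwH)).hasDerivAt.add_const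
      Complex.I).fun_inv (hne (hfm hwH))).deriv
    have h2 := hne (hfm hwH)
    have h3 : deriv (g f) w = -deriv f w / (f w + Complex.I) ^ 2 := by
      rw [hg']
      exact h1
    rw [h3, hg]
    field_simp
  have hev : ∀ᶠ p in L ×ˢ 𝓝 z, (DifferentiableOn ℂ (f p.1) upperHalf ∧
      MapsTo (f p.1) upperHalf upperHalf) ∧ p.2 ∈ Metric.ball z R :=
    (hd.and hm).prod_mk (Metric.ball_mem_nhds z hR)
  have lim1 : Tendsto (fun p : ι × ℂ => g (f p.1) p.2) (L ×ˢ 𝓝 z) (𝓝 (g f₀ z)) := by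
    rw [← (val hd₀ hm₀ z hzR).1]
    refine ((key 1).const_smul (2 * Real.pi * Complex.I : ℂ)⁻¹).congr' ?_
    filter_upwards [hev] with p hp
    exact (val hp.1.1 hp.1.2 p.2 hp.2).1
  have lim2 : Tendsto (fun p : ι × ℂ => deriv (g (f p.1)) p.2) (L ×ˢ 𝓝 z)
      (𝓝 (deriv (g f₀) z)) := by
    rw [← (val hd₀ hm₀ z hzR).2]
    refine ((key 2).const_smul (2 * Real.pi * Complex.I : ℂ)⁻¹).congr' ?_
    filter_upwards [hev] with p hp
    exact (val hp.1.1 hp.1.2 p.2 hp.2).2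
  rw [hder hd₀ hm₀ z hzR]
  have hg0 : g f₀ z ≠ 0 := by
    rw [hg]
    exact inv_ne_zero (hne (hm₀ hz))
  refine ((lim2.neg).div (lim1.pow 2) (pow_ne_zero 2 hg0)).congr' ?_
  filter_upwards [hev] with p hp
  exact (hder hp.1.1 hp.1.2 p.2 hp.2).symm

/-- Solutions `w` of `f s (w) = f t (z)` near `z` move with velocity `-∂ₛ f / f'`; here the
difference quotient runs backwards in time, hence the sign. -/
theorem tendsto_slope_of_comp_eq {f : ℝ → ℂ → ℂ} {t : ℝ} {z v : ℂ} {w : ℝ → ℂ}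
    (hd : ∀ᶠ s in 𝓝[<] t, DifferentiableOn ℂ (f s) upperHalf)
    (hi : ∀ᶠ s in 𝓝[<] t, InjOn (f s) upperHalf)
    (hm : ∀ᶠ s in 𝓝[<] t, MapsTo (f s) upperHalf upperHalf)
    (hd₀ : DifferentiableOn ℂ (f t) upperHalf) (hm₀ : MapsTo (f t) upperHalf upperHalf)
    (hlim : ∀ z ∈ upperHalf, Tendsto (fun s => f s z) (𝓝[<] t) (𝓝 (f t z))) (hz : z ∈ upperHalf)
    (hv : HasDerivAt (fun s => f s z) v t) (hA : deriv (f t) z ≠ 0)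
    (hw : ∀ᶠ s in 𝓝[<] t, w s ∈ upperHalf ∧ f s (w s) = f t z) :
    Tendsto (fun s : ℝ => (w s - z) / (t - s : ℝ)) (𝓝[<] t) (𝓝 (v / deriv (f t) z)) := by
  set A := deriv (f t) z with hAd
  have hder := tendsto_deriv_of_tendsto hd hm hd₀ hm₀ hlim hz
  have hA0 : 0 < ‖A‖ := norm_pos_iff.2 hA
  set q : ℝ → ℂ := fun s => (f t z - f s z) / (t - s : ℝ) with hq
  have hqlim : Tendsto q (𝓝[<] t) (𝓝 v) := by
    have h1 : Tendsto (slope (fun s => f s z) t) (𝓝[<] t) (𝓝 v) :=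
      (hasDerivAt_iff_tendsto_slope.1 hv).mono_left (nhdsWithin_mono _ fun s hs => ne_of_lt hs)
    refine h1.congr' ?_
    filter_upwards [self_mem_nhdsWithin] with s hs
    have h2 : ((s : ℂ) - t) ≠ 0 := sub_ne_zero.2 (by exact_mod_cast ne_of_lt hs)
    have h3 : ((t : ℂ) - s) ≠ 0 := sub_ne_zero.2 (by exact_mod_cast ne_of_gt hs)
    rw [slope_def_module, hq, Complex.real_smul]
    push_cast
    field_simp
    ring
  -- near `z`, the maps `f s` are close to an affine map with slope `A`
  have key : ∀ ε > 0, ε ≤ ‖A‖ / 2 → ∀ᶠ s in 𝓝[<] t,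
      ‖f t z - f s z - A * (w s - z)‖ ≤ ε * ‖w s - z‖ := by
    intro ε hε hεA
    have hev : ∀ᶠ p in 𝓝[<] t ×ˢ 𝓝 z, ‖deriv (f p.1) p.2 - A‖ ≤ ε := by
      have := hder (Metric.closedBall_mem_nhds A hε)
      filter_upwards [this] with p hp
      simpa [dist_eq_norm] using hp
    obtain ⟨P, hP, P', hP', hPP⟩ := eventually_prod_iff.1 hev
    obtain ⟨r, hr, hball⟩ := Metric.nhds_basis_closedBall.mem_iff.1
      (inter_mem (isOpen_upperHalf.mem_nhds hz) hP')
    have hsmall : ∀ᶠ s in 𝓝[<] t, dist (f t z) (f s z) ≤ (‖A‖ - ε) * r := by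
      have h1 : Tendsto (fun s => dist (f t z) (f s z)) (𝓝[<] t) (𝓝 (dist (f t z) (f t z))) :=
        tendsto_const_nhds.dist (hlim z hz)
      rw [dist_self] at h1
      have : 0 < (‖A‖ - ε) * r := mul_pos (by linarith) hr
      exact (h1.eventually_lt_const this).mono fun s hs => hs.le
    filter_upwards [hP, hd, hi, hw, hsmall] with s hPs hds his hws hss
    have happ : ApproximatesLinearOn (f s) ((ContinuousLinearMap.toSpanSingleton ℂ A : ℂ →L[ℂ] ℂ))
        (Metric.closedBall z r) ⟨ε, hε.le⟩ := by
      intro a ha b hb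
      have hdiff : ∀ x ∈ Metric.closedBall z r, DifferentiableAt ℂ (fun y => f s y - A * y) x :=
        fun x hx => (hds.differentiableAt (isOpen_upperHalf.mem_nhds (hball hx).1)).sub
          (by fun_prop)
      have h1 := (convex_closedBall z r).norm_image_sub_le_of_norm_deriv_le (C := ε) hdiff
        (fun x hx => by
          have hx' := hds.differentiableAt (isOpen_upperHalf.mem_nhds (hball hx).1)
          have h2 : deriv (fun y => f s y - A * y) x = deriv (f s) x - A := by
            have := (hx'.hasDerivAt.fun_sub ((hasDerivAt_id x).const_mul A)).deriv
            simpa using this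
          rw [h2]
          exact hPP hPs (hball hx).2) hb ha
      have e : f s a - f s b - (ContinuousLinearMap.toSpanSingleton ℂ A : ℂ →L[ℂ] ℂ) (a - b) =
          f s a - A * a - (f s b - A * b) := by
        simp only [ContinuousLinearMap.toSpanSingleton_apply, smul_eq_mul]
        ring
      rw [e]
      exact h1
    -- an approximately linear map is onto a definite disc, so the solution `w s` lies close to `z`
    set inv : ((ContinuousLinearMap.toSpanSingleton ℂ A : ℂ →L[ℂ] ℂ)).NonlinearRightInverse :=
      { toFun := fun y => y / A
        nnnorm := ‖A‖₊⁻¹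
        bound' := fun y => by
          rw [norm_div, NNReal.coe_inv, coe_nnnorm, div_eq_inv_mul]
        right_inv' := fun y => by
          simp only [ContinuousLinearMap.toSpanSingleton_apply, smul_eq_mul]
          field_simp } with hinv
    have hsurj := happ.surjOn_closedBall_of_nonlinearRightInverse inv hr.le le_rfl
    have hin : f t z ∈ Metric.closedBall (f s z) (((inv.nnnorm : ℝ)⁻¹ - ε) * r) := by
      rw [Metric.mem_closedBall, hinv]
      simpa using hss
    obtain ⟨a, ha, hfa⟩ := hsurj hin
    have haw : a = w s := his (hball ha).1 hws.1 (by rw [hfa, hws.2])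
    have h4 := happ a ha z (Metric.mem_closedBall_self hr.le)
    rw [hfa, haw] at h4
    simp only [ContinuousLinearMap.toSpanSingleton_apply, smul_eq_mul] at h4
    rw [mul_comm (w s - z) A] at h4
    exact h4
  have hAd : Tendsto (fun s : ℝ => q s - A * ((w s - z) / (t - s : ℝ))) (𝓝[<] t) (𝓝 0) := by
    rw [Metric.tendsto_nhds]
    intro ε' hε'
    set M := 2 / ‖A‖ * (‖v‖ + 1) with hM
    have hM0 : 0 < M := by positivity
    set ε := min (‖A‖ / 2) (ε' / (2 * M)) with hεd
    have hε : 0 < ε := by positivity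
    have hεA : ε ≤ ‖A‖ / 2 := min_le_left _ _
    have hεM : ε * M < ε' := by
      have : ε * M ≤ ε' / (2 * M) * M := by gcongr; exact min_le_right _ _
      have e : ε' / (2 * M) * M = ε' / 2 := by field_simp
      linarith
    filter_upwards [key ε hε hεA, hqlim.norm.eventually_lt_const (by linarith : ‖v‖ < ‖v‖ + 1),
      self_mem_nhdsWithin] with s hs hqs hst
    have hts : 0 < t - s := sub_pos.2 hst
    have htsc : ((t - s : ℝ) : ℂ) ≠ 0 := by exact_mod_cast hts.ne'
    have h1 : ‖w s - z‖ ≤ 2 / ‖A‖ * ‖f t z - f s z‖ := by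
      have h2 : ‖A * (w s - z)‖ ≤ ‖f t z - f s z‖ + ε * ‖w s - z‖ := by
        have := norm_sub_le (f t z - f s z) (f t z - f s z - A * (w s - z))
        rw [sub_sub_cancel] at this
        linarith
      rw [norm_mul] at h2
      have h3 : ε * ‖w s - z‖ ≤ ‖A‖ / 2 * ‖w s - z‖ := by gcongr
      rw [div_mul_eq_mul_div, le_div_iff₀ hA0]
      linarith
    have h4 : ‖f t z - f s z‖ = ‖q s‖ * (t - s) := by
      rw [hq, norm_div, Complex.norm_real, Real.norm_of_nonneg hts.le, div_mul_cancel₀ _ hts.ne']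
    have e : q s - A * ((w s - z) / (t - s : ℝ)) =
        (f t z - f s z - A * (w s - z)) / (t - s : ℝ) := by
      simp only [hq]
      field_simp
    rw [dist_zero_right, e, norm_div, Complex.norm_real, Real.norm_of_nonneg hts.le,
      div_lt_iff₀ hts]
    calc _ ≤ ε * ‖w s - z‖ := hs
      _ ≤ ε * (2 / ‖A‖ * (‖q s‖ * (t - s))) := by rw [← h4]; gcongr
      _ ≤ ε * (2 / ‖A‖ * ((‖v‖ + 1) * (t - s))) := by gcongr
      _ = ε * M * (t - s) := by rw [hM]; ring
      _ < ε' * (t - s) := by gcongr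
  have h1 := (hqlim.sub hAd).div_const A
  rw [sub_zero] at h1
  refine h1.congr fun s => ?_
  rw [sub_sub_cancel, mul_div_cancel_left₀ _ hA]

end AnnulusLoewner

/-! ### The evolution equation in the logarithmic coordinate -/

namespace AnnulusLoewner

variable {τ₀ T : ℝ} {l : ℝ → ℂ}

/-- At time zero the slit map is a dilation, and the foot of the slit plays the role of the tip. -/
theorem IsSlitMap.tip_zero (hl : IsLogSlit τ₀ T l) {f : ℂ → ℂ} (hf : IsSlitMap τ₀ l 0 f) :
    ∃ x : ℝ, 0 < x ∧ Tendsto (inverseMap f) (𝓝[{w | Complex.log w ∈ logDomain τ₀ l 0}]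
      (Complex.exp (l 0))) (𝓝 x) := by
  have hdom : ∀ {w : ℂ}, w ∈ upperHalf → Complex.log w ∈ logDomain τ₀ l 0 := fun hw =>
    ⟨log_mem_strip hw, fun k u hu => absurd hu (by simp)⟩
  obtain ⟨a, ha, hfa⟩ := exists_eq_mul_of_automorphism hf.differentiableOn
    (fun w hw => (hf.differentiableAt_inverse (hdom hw)).differentiableWithinAt)
    (fun z hz => hf.mapsTo hz) (fun w hw => hf.inverse_mem (hdom hw))
    (fun z hz => hf.inverse_apply hz) hf.tendsto_zero hf.tendsto_infty
  have hac : (a : ℂ) ≠ 0 := by exact_mod_cast ha.ne'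
  refine ⟨Real.exp (l 0).re / a, by positivity, ?_⟩
  have he : Complex.exp (l 0) = (Real.exp (l 0).re : ℂ) := by
    rw [Complex.ofReal_exp]
    congr 1
    exact Complex.ext (by simp) (by simpa using hl.start_im)
  have h1 : Tendsto (fun w : ℂ => w / a) (𝓝[{w | Complex.log w ∈ logDomain τ₀ l 0}]
      (Complex.exp (l 0))) (𝓝 (Complex.exp (l 0) / a)) :=
    ((continuous_id.div_const (a : ℂ)).tendsto _).mono_left nhdsWithin_le_nhds
  rw [Complex.ofReal_div, ← he]
  refine h1.congr' ?_
  filter_upwards [self_mem_nhdsWithin] with w hw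
  have h2 := hfa _ (hf.inverse_mem hw)
  rw [hf.apply_inverse hw] at h2
  rw [div_eq_iff hac, mul_comm]
  exact h2

/-- The image `ξ` of the tip, for a slit that starts on the positive axis. -/
theorem IsSlitMap.exists_tip (hl : IsLogSlit τ₀ T l) (hτ₀ : 0 < τ₀) {t : ℝ} (ht : t ∈ Icc 0 T)
    {f : ℂ → ℂ} (hf : IsSlitMap τ₀ l t f) :
    ∃ x : ℝ, 0 < x ∧ Tendsto (inverseMap f) (𝓝[{w | Complex.log w ∈ logDomain τ₀ l t}]
      (Complex.exp (l t))) (𝓝 x) := by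
  rcases ht.1.eq_or_lt with rfl | h0
  · exact hf.tip_zero hl
  · obtain ⟨x, hx, hlim⟩ := hf.exists_tendsto_inverse_tip hl hτ₀ ⟨h0, ht.2⟩
    rcases (𝓝[{w | Complex.log w ∈ logDomain τ₀ l t}] (Complex.exp (l t))).eq_or_neBot with h | h
    · exact ⟨1, one_pos, by rw [h]; exact tendsto_bot⟩
    · exact ⟨x, hf.tip_pos hl hτ₀ ⟨h0, ht.2⟩ hx hlim h, hlim⟩

theorem logDomain_ssubset (hl : IsLogSlit τ₀ T l) {s t : ℝ} (hs : s ∈ Icc 0 T) (ht : t ∈ Icc 0 T)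
    (hst : s < t) : logDomain τ₀ l t ⊂ logDomain τ₀ l s := by
  refine ⟨logDomain_anti hst.le, fun hsub => ?_⟩
  have ht0 : 0 < t := hs.1.trans_lt hst
  have h1 : l t ∈ logDomain τ₀ l s := ⟨hl.mem_strip t ⟨ht0, ht.2⟩, fun k u hu h => by
    have := hl.inj t ht u ⟨hu.1.le, hu.2.trans hs.2⟩ k h
    linarith [hu.2]⟩
  exact (hsub h1).2 0 t ⟨ht0, le_rfl⟩ (by simp)

/-- The evolution equation at a time where the chain and the period are differentiable. -/
theorem hasDerivAt_of_differentiableAt (hτ₀ : 0 < τ₀) (hl : IsLogSlit τ₀ T l) {f : ℝ → ℂ → ℂ}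
    (hf : ∀ t ∈ Icc 0 T, IsSlitMap τ₀ l t (f t)) {τ : ℝ → ℝ} (hτ : ∀ t ∈ Icc 0 T, 0 < τ t)
    (hdil : ∀ t ∈ Icc 0 T, ∀ z ∈ upperHalf,
      f t ((Real.exp (τ t) : ℂ) * z) = (Real.exp τ₀ : ℂ) * f t z) {t : ℝ} (ht : t ∈ Ioo 0 T)
    {x c : ℝ} (hx : 0 < x) (hc0 : c ≠ 0) (hc : ∀ k : ℤ, Real.exp (k * τ t) * c ≠ x)
    (htip : Tendsto (inverseMap (f t)) (𝓝[{w | Complex.log w ∈ logDomain τ₀ l t}]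
      (Complex.exp (l t))) (𝓝 x)) (hτd : DifferentiableAt ℝ τ t)
    (hfd : ∀ z ∈ upperHalf, DifferentiableAt ℝ (fun s => f s z) t) :
    ∃ lam : ℝ, ∀ z ∈ upperHalf,
      HasDerivAt (fun s => f s z) (deriv (f t) z * field lam (τ t) (deriv τ t) x c z) t := by
  have htm : t ∈ Icc 0 T := ⟨ht.1.le, ht.2.le⟩
  have hft := hf t htm
  have hev : ∀ᶠ s in 𝓝[<] t, s ∈ Icc 0 T ∧ s < t := by
    filter_upwards [Ioo_mem_nhdsLT ht.1] with s hs
    exact ⟨⟨hs.1.le, hs.2.le.trans ht.2.le⟩, hs.2⟩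
  have hdom : ∀ s, s < t → ∀ z ∈ upperHalf, Complex.log (f t z) ∈ logDomain τ₀ l s :=
    fun s hs z hz => logDomain_anti hs.le (hft.log_mem hz)
  have hA : ∀ z ∈ upperHalf, deriv (f t) z ≠ 0 := fun z hz =>
    deriv_ne_zero_of_injOn isOpen_upperHalf hft.differentiableOn hft.injOn hz
  have hslope : ∀ z ∈ upperHalf, Tendsto
      (fun s : ℝ => (Complex.log (inverseMap (f s) (f t z)) - Complex.log z) / (t - s : ℝ)) (𝓝[<] t)
      (𝓝 (deriv (fun s => f s z) t / deriv (f t) z / z)) := by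
    intro z hz
    have h1 := tendsto_slope_of_comp_eq (f := f) (t := t) (w := fun s => inverseMap (f s) (f t z))
      (hev.mono fun s hs => (hf s hs.1).differentiableOn)
      (hev.mono fun s hs => (hf s hs.1).injOn)
      (hev.mono fun s hs z hz => (hf s hs.1).mapsTo hz)
      hft.differentiableOn (fun z hz => hft.mapsTo hz)
      (fun z hz => (hfd z hz).continuousAt.tendsto.mono_left nhdsWithin_le_nhds) hz
      (hfd z hz).hasDerivAt (hA z hz)
      (hev.mono fun s hs => ⟨(hf s hs.1).inverse_mem (hdom s hs.2 z hz),
        (hf s hs.1).apply_inverse (hdom s hs.2 z hz)⟩)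
    have hwt : inverseMap (f t) (f t z) = z := hft.inverse_apply hz
    have hnot : t ∉ Iio t := lt_irrefl t
    have hsl : ∀ (g : ℝ → ℂ) (s : ℝ), slope g t s = -((g s - g t) / (t - s : ℝ)) := by
      intro g s
      rw [slope_def_module, Complex.real_smul, ← neg_sub t s]
      push_cast
      rw [inv_neg, neg_mul, inv_mul_eq_div]
    have h2 : HasDerivWithinAt (fun s => inverseMap (f s) (f t z))
        (-(deriv (fun s => f s z) t / deriv (f t) z)) (Iio t) t := by
      rw [hasDerivWithinAt_iff_tendsto_slope' hnot]
      refine h1.neg.congr fun s => ?_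
      rw [hsl, hwt]
    have h3 := (h2.clog_real (by
      rw [hwt]
      exact Complex.mem_slitPlane_iff.2 (Or.inr (ne_of_gt hz))))
    rw [hasDerivWithinAt_iff_tendsto_slope' hnot, hwt] at h3
    have h4 := h3.neg
    rw [neg_div, neg_neg] at h4
    refine h4.congr fun s => ?_
    rw [hsl, neg_neg, hwt]
  -- the velocity of the transition maps in the logarithmic coordinate
  set V : ℂ → ℂ := fun w => deriv (fun s => f s (Complex.exp w)) t / deriv (f t) (Complex.exp w) /
    Complex.exp w with hV
  obtain ⟨lam, hlam⟩ := eq_const_add_stripKernel_of_tendsto (τ₀ := τ₀) (T := T) (t := t)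
    (x₀ := Real.log x) (c := c / x) (l := l) (σ := τ)
    (F := fun s z => Complex.log (f s (Complex.exp z)))
    (G := fun s w => Complex.log (inverseMap (f s) (Complex.exp w))) (V := V) hl hτ₀ ⟨ht.1, ht.2.le⟩
    (fun s hs => (hf s hs).isStripMap hτ₀ (hτ s hs) (hdil s hs)) (IsSlitMap.tendsto_log_tip hx htip)
    hτd (div_ne_zero hc0 hx.ne') (fun k h => hc k (by
      rw [div_mul_eq_mul_div, div_eq_one_iff_eq hx.ne'] at h
      rw [mul_comm]
      exact h)) (fun w hw => by
      have hz := exp_mem_upperHalf hw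
      refine (hslope _ hz).congr fun s => ?_
      rw [Complex.exp_log (ne_zero_of_mem_upperHalf (hft.mapsTo hz)), log_exp_of_mem_strip hw])
  refine ⟨lam, fun z hz => ?_⟩
  have hz0 := ne_zero_of_mem_upperHalf hz
  have h1 := hlam _ (log_mem_strip hz)
  rw [hV] at h1
  simp only [Complex.exp_log hz0] at h1
  rw [div_eq_iff hz0, div_eq_iff (hA z hz)] at h1
  have h2 : deriv (f t) z * field lam (τ t) (deriv τ t) x c z = deriv (fun s => f s z) t := by
    rw [field_eq hx z hz0, h1]
    ring
  rw [h2]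
  exact (hfd z hz).hasDerivAt

/-- The evolution equation for a slit starting on the positive axis, in logarithmic coordinates. -/
theorem exists_evolution (hτ₀ : 0 < τ₀) (hl : IsLogSlit τ₀ T l) {f : ℝ → ℂ → ℂ}
    (hf : ∀ t ∈ Icc 0 T, IsSlitMap τ₀ l t (f t))
    (hae : ∀ᵐ t ∂(volume.restrict (Ioo 0 T)), ∀ z ∈ upperHalf,
      DifferentiableAt ℝ (fun s : ℝ => f s z) t) :
    ∃ τ ξ : ℝ → ℝ, StrictMonoOn τ (Icc 0 T) ∧
      (∀ t ∈ Icc 0 T, 0 < τ t ∧ 0 < ξ t ∧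
        (∀ z ∈ upperHalf, f t ((Real.exp (τ t) : ℂ) * z) = (Real.exp τ₀ : ℂ) * f t z) ∧
        Tendsto (inverseMap (f t)) (𝓝[{w | Complex.log w ∈ logDomain τ₀ l t}]
          (Complex.exp (l t))) (𝓝 (ξ t))) ∧
      ∀ c : ℝ, IsAdmissible T τ ξ c → ∃ lam : ℝ → ℝ, ∀ᵐ t ∂(volume.restrict (Ioo 0 T)),
        DifferentiableAt ℝ τ t ∧ ∀ z ∈ upperHalf,
          Summable (fieldTerm (τ t) (deriv τ t) (ξ t) c z) ∧
          HasDerivAt (fun s : ℝ => f s z)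
            (deriv (f t) z * field (lam t) (τ t) (deriv τ t) (ξ t) c z) t := by
  have h1 : ∀ t, ∃ τ : ℝ, t ∈ Icc 0 T → 0 < τ ∧ ∀ z ∈ upperHalf,
      f t ((Real.exp τ : ℂ) * z) = (Real.exp τ₀ : ℂ) * f t z := fun t => by
    by_cases ht : t ∈ Icc 0 T
    · obtain ⟨τ, h⟩ := (hf t ht).exists_dilation hl hτ₀ ht
      exact ⟨τ, fun _ => h⟩
    · exact ⟨0, fun h => absurd h ht⟩
  have h2 : ∀ t, ∃ ξ : ℝ, t ∈ Icc 0 T → 0 < ξ ∧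
      Tendsto (inverseMap (f t)) (𝓝[{w | Complex.log w ∈ logDomain τ₀ l t}]
          (Complex.exp (l t))) (𝓝 ξ) := fun t => by
    by_cases ht : t ∈ Icc 0 T
    · obtain ⟨x, h⟩ := (hf t ht).exists_tip hl hτ₀ ht
      exact ⟨x, fun _ => h⟩
    · exact ⟨0, fun h => absurd h ht⟩
  choose τ hτ using h1
  choose ξ hξ using h2
  have hmono : StrictMonoOn τ (Icc 0 T) := fun s hs t ht hst =>
    ((hf t ht).isStripMap hτ₀ (hτ t ht).1 (hτ t ht).2).period_lt
      ((hf s hs).isStripMap hτ₀ (hτ s hs).1 (hτ s hs).2) (logDomain_ssubset hl hs ht hst)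
  refine ⟨τ, ξ, hmono, fun t ht => ⟨(hτ t ht).1, (hξ t ht).1, (hτ t ht).2, (hξ t ht).2⟩,
    fun c hc => ?_⟩
  -- Lebesgue's theorem on monotone functions
  have hτae : ∀ᵐ t ∂(volume.restrict (Ioo 0 T)), DifferentiableAt ℝ τ t := by
    have h3 := (hmono.monotoneOn.mono Ioo_subset_Icc_self).ae_differentiableWithinAt
      measurableSet_Ioo
    filter_upwards [h3, ae_restrict_mem measurableSet_Ioo] with t ht1 ht2
    exact ht1.differentiableAt (isOpen_Ioo.mem_nhds ht2)
  have h4 : ∀ t, ∃ lam : ℝ, t ∈ Ioo 0 T → DifferentiableAt ℝ τ t →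
      (∀ z ∈ upperHalf, DifferentiableAt ℝ (fun s : ℝ => f s z) t) → ∀ z ∈ upperHalf,
        HasDerivAt (fun s => f s z)
          (deriv (f t) z * field lam (τ t) (deriv τ t) (ξ t) c z) t := fun t => by
    by_cases h : t ∈ Ioo 0 T ∧ DifferentiableAt ℝ τ t ∧
      ∀ z ∈ upperHalf, DifferentiableAt ℝ (fun s : ℝ => f s z) t
    · have htm := Ioo_subset_Icc_self h.1
      obtain ⟨lam, hlam⟩ := hasDerivAt_of_differentiableAt hτ₀ hl hf (fun t ht => (hτ t ht).1)
        (fun t ht => (hτ t ht).2) h.1 (hξ t htm).1 hc.1 (hc.2 t htm) (hξ t htm).2 h.2.1 h.2.2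
      exact ⟨lam, fun _ _ _ => hlam⟩
    · exact ⟨0, fun a b d => absurd ⟨a, b, d⟩ h⟩
  choose lam hlam using h4
  refine ⟨lam, ?_⟩
  filter_upwards [hτae, hae, ae_restrict_mem measurableSet_Ioo] with t ht1 ht2 ht3
  have htm := Ioo_subset_Icc_self ht3
  have hx := (hξ t htm).1
  refine ⟨ht1, fun z hz => ⟨?_, hlam t ht3 ht1 ht2 z hz⟩⟩
  have hs := summable_kernelTerm (hτ t htm).1 (div_ne_zero hc.1 hx.ne') (fun k h => hc.2 t htm k (by
      rw [div_mul_eq_mul_div, div_eq_one_iff_eq hx.ne'] at h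
      rw [mul_comm]
      exact h)) (z := Complex.log z - Real.log (ξ t)) (by
        simpa [sub_eq_add_neg] using add_mem_strip (log_mem_strip hz) (-Real.log (ξ t)))
  refine (hs.mul_left (deriv τ t * z : ℂ)).congr fun k => ?_
  exact (fieldTerm_eq hx z (ne_zero_of_mem_upperHalf hz) k).symm

end AnnulusLoewner

/-! ### Slits in the plane and reflection -/

namespace AnnulusLoewner

/-- Reflection in the imaginary axis. -/
noncomputable def refl (z : ℂ) : ℂ := -(starRingEnd ℂ) z

@[simp] theorem refl_refl (z : ℂ) : refl (refl z) = z := by simp [refl]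

@[simp] theorem refl_im (z : ℂ) : (refl z).im = z.im := by simp [refl]

@[simp] theorem refl_re (z : ℂ) : (refl z).re = -z.re := by simp [refl]

theorem refl_mem {z : ℂ} (hz : z ∈ upperHalf) : refl z ∈ upperHalf := by
  rw [mem_upperHalf] at hz ⊢
  simpa using hz

theorem refl_real_mul (a : ℝ) (z : ℂ) : refl (a * z) = a * refl z := by simp [refl]

theorem refl_mul (w z : ℂ) : refl (w * z) = (starRingEnd ℂ) w * refl z := by simp [refl]

@[simp] theorem norm_refl (z : ℂ) : ‖refl z‖ = ‖z‖ := by simp [refl]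

theorem continuous_refl : Continuous refl := Complex.continuous_conj.neg

theorem refl_injective : Function.Injective refl := fun z w h => by
  rw [← refl_refl z, h, refl_refl]

theorem hasDerivAt_refl_comp {f : ℂ → ℂ} {d z : ℂ} (h : HasDerivAt f d (refl z)) :
    HasDerivAt (fun w => refl (f (refl w))) ((starRingEnd ℂ) d) z := by
  have h1 : HasDerivAt (fun w => f (-w)) (-d) ((starRingEnd ℂ) z) := by
    have h2 : HasDerivAt f d (-(starRingEnd ℂ) z) := h
    have h3 := h2.comp ((starRingEnd ℂ) z) (hasDerivAt_neg ((starRingEnd ℂ) z))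
    rw [mul_neg_one] at h3
    exact h3
  have h3 := h1.conj_conj.neg
  rw [Complex.conj_conj, map_neg, neg_neg] at h3
  exact h3

/-- Reflection of a real-variable derivative. -/
theorem HasDerivAt.refl_comp {g : ℝ → ℂ} {d : ℂ} {t : ℝ} (h : HasDerivAt g d t) :
    HasDerivAt (fun s => refl (g s)) (refl d) t :=
  ((Complex.conjCLE : ℂ →L[ℝ] ℂ).hasFDerivAt.comp_hasDerivAt t h).neg

/-- A slit lifted to the closed upper half-plane, injective modulo the dilations by `e^{kτ₀}`. -/
structure IsPlaneSlit (τ₀ T : ℝ) (κ : ℝ → ℂ) : Prop where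
  continuousOn : ContinuousOn κ (Icc 0 T)
  start_im : (κ 0).im = 0
  start_ne : κ 0 ≠ 0
  im_pos : ∀ u ∈ Ioc 0 T, 0 < (κ u).im
  inj : ∀ u ∈ Icc 0 T, ∀ v ∈ Icc 0 T, ∀ k : ℤ, κ u = (Real.exp (k * τ₀) : ℂ) * κ v → u = v

/-- The upper half-plane minus the orbit of the slit `κ (0, t]` under dilations. -/
def planeDomain (τ₀ : ℝ) (κ : ℝ → ℂ) (t : ℝ) : Set ℂ :=
  {w | 0 < w.im ∧ ∀ k : ℤ, ∀ u ∈ Ioc 0 t, w ≠ (Real.exp (k * τ₀) : ℂ) * κ u}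

/-- A normalized chain of conformal maps onto the complements of a growing slit. -/
structure IsPlaneChain (τ₀ T : ℝ) (κ : ℝ → ℂ) (f : ℝ → ℂ → ℂ) : Prop where
  differentiableOn : ∀ t ∈ Icc 0 T, DifferentiableOn ℂ (f t) upperHalf
  injOn : ∀ t ∈ Icc 0 T, InjOn (f t) upperHalf
  image_eq : ∀ t ∈ Icc 0 T, f t '' upperHalf = planeDomain τ₀ κ t
  tendsto_zero : ∀ t ∈ Icc 0 T, Tendsto (f t) (𝓝[upperHalf] 0) (𝓝 0)
  tendsto_infty : ∀ t ∈ Icc 0 T,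
    Tendsto (f t) (Bornology.cobounded ℂ ⊓ 𝓟 upperHalf) (Bornology.cobounded ℂ)
  ae_differentiableAt : ∀ᵐ t ∂(volume.restrict (Ioo 0 T)), ∀ z ∈ upperHalf,
    DifferentiableAt ℝ (fun s : ℝ => f s z) t

/-- The evolution equation of a chain, together with the data that appear in it: the periods `τ`
and the images `ξ` of the tips. -/
def SatisfiesEvolution (τ₀ T : ℝ) (κ : ℝ → ℂ) (f : ℝ → ℂ → ℂ) (τ ξ : ℝ → ℝ) : Prop :=
  StrictMonoOn τ (Icc 0 T) ∧
    (∀ t ∈ Icc 0 T, 0 < τ t ∧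
      (∀ z ∈ upperHalf, f t ((Real.exp (τ t) : ℂ) * z) = (Real.exp τ₀ : ℂ) * f t z) ∧
      Tendsto (inverseMap (f t)) (𝓝[planeDomain τ₀ κ t] (κ t)) (𝓝 (ξ t))) ∧
    (∃ c : ℝ, IsAdmissible T τ ξ c) ∧
    ∀ c : ℝ, IsAdmissible T τ ξ c → ∃ lam : ℝ → ℝ, ∀ᵐ t ∂(volume.restrict (Ioo 0 T)),
      DifferentiableAt ℝ τ t ∧ ∀ z ∈ upperHalf,
        Summable (fieldTerm (τ t) (deriv τ t) (ξ t) c z) ∧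
        HasDerivAt (fun s : ℝ => f s z)
          (deriv (f t) z * field (lam t) (τ t) (deriv τ t) (ξ t) c z) t

variable {τ₀ T : ℝ} {κ : ℝ → ℂ} {f : ℝ → ℂ → ℂ}

theorem IsPlaneSlit.isLogSlit (h : IsPlaneSlit τ₀ T κ) (hpos : 0 < (κ 0).re) :
    IsLogSlit τ₀ T fun t => Complex.log (κ t) := by
  have hsl : ∀ t ∈ Icc 0 T, κ t ∈ Complex.slitPlane := fun t ht => by
    rcases ht.1.eq_or_lt with rfl | h0
    · exact Complex.mem_slitPlane_iff.2 (Or.inl hpos)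
    · exact Complex.mem_slitPlane_iff.2 (Or.inr (h.im_pos t ⟨h0, ht.2⟩).ne')
  refine ⟨h.continuousOn.clog hsl, ?_, fun u hu => log_mem_strip (h.im_pos u hu), ?_⟩
  · rw [Complex.log_im]
    exact Complex.arg_eq_zero_iff.2 ⟨hpos.le, h.start_im⟩
  · intro u hu v hv k huv
    refine h.inj u hu v hv k ?_
    have := congrArg Complex.exp huv
    rw [exp_add_int, Complex.exp_log (Complex.slitPlane_ne_zero (hsl u hu)),
      Complex.exp_log (Complex.slitPlane_ne_zero (hsl v hv)), mul_comm] at this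
    exact this

/-- The slit domain in the logarithmic coordinate. -/
theorem IsPlaneSlit.planeDomain_eq (h : IsPlaneSlit τ₀ T κ) {t : ℝ} (ht : t ≤ T) :
    planeDomain τ₀ κ t = {w | Complex.log w ∈ logDomain τ₀ (fun t => Complex.log (κ t)) t} := by
  have key : ∀ w : ℂ, 0 < w.im → ∀ k : ℤ, ∀ u ∈ Ioc 0 t,
      (w = (Real.exp (k * τ₀) : ℂ) * κ u ↔ Complex.log w = Complex.log (κ u) + k * τ₀) := by
    intro w hw k u hu
    have hu' := h.im_pos u ⟨hu.1, hu.2.trans ht⟩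
    have e := IsSlitMap.log_exp_mul (k * τ₀) (w := κ u) hu'
    push_cast at e
    constructor
    · rintro rfl
      push_cast
      exact e
    · intro h1
      have h2 := congrArg Complex.exp h1
      rw [exp_add_int, Complex.exp_log (ne_zero_of_mem_upperHalf hw),
        Complex.exp_log (ne_zero_of_mem_upperHalf hu'), mul_comm] at h2
      exact h2
  ext w
  constructor
  · rintro ⟨hw, h1⟩
    exact ⟨log_mem_strip hw, fun k u hu h2 => h1 k u hu ((key w hw k u hu).2 h2)⟩
  · rintro ⟨hw, h1⟩
    have hw' := im_pos_of_log_mem_strip hw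
    exact ⟨hw', fun k u hu h2 => h1 k u hu ((key w hw' k u hu).1 h2)⟩

/-- The evolution equation when the slit starts on the positive axis. -/
theorem IsPlaneChain.exists_evolution_of_pos (hf : IsPlaneChain τ₀ T κ f) (hτ₀ : 0 < τ₀)
    (h : IsPlaneSlit τ₀ T κ) (hpos : 0 < (κ 0).re) :
    ∃ τ ξ : ℝ → ℝ, SatisfiesEvolution τ₀ T κ f τ ξ := by
  have hl := h.isLogSlit hpos
  obtain ⟨τ, ξ, hmono, hall, hev⟩ := exists_evolution hτ₀ hl (f := f) (fun t ht =>
    { differentiableOn := hf.differentiableOn t ht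
      injOn := hf.injOn t ht
      image_eq := by rw [hf.image_eq t ht, h.planeDomain_eq ht.2]
      tendsto_zero := hf.tendsto_zero t ht
      tendsto_infty := hf.tendsto_infty t ht }) hf.ae_differentiableAt
  -- since `ξ > 0`, every negative number is admissible
  refine ⟨τ, ξ, hmono, fun t ht => ?_, ⟨-1, by norm_num, fun t ht k hk => ?_⟩, hev⟩
  · obtain ⟨h1, -, h2, h3⟩ := hall t ht
    refine ⟨h1, h2, ?_⟩
    have hne : κ t ≠ 0 := by
      rcases ht.1.eq_or_lt with rfl | h0
      · exact h.start_ne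
      · exact ne_zero_of_mem_upperHalf (h.im_pos t ⟨h0, ht.2⟩)
    rwa [Complex.exp_log hne, ← h.planeDomain_eq ht.2] at h3
  · have h1 := (hall t ht).2.1
    have h2 := Real.exp_pos (k * τ t)
    linarith

theorem IsPlaneSlit.reflect (h : IsPlaneSlit τ₀ T κ) : IsPlaneSlit τ₀ T fun t => refl (κ t) where
  continuousOn := continuous_refl.comp_continuousOn h.continuousOn
  start_im := by rw [refl_im, h.start_im]
  start_ne := by
    rw [← norm_ne_zero_iff, norm_refl, norm_ne_zero_iff]
    exact h.start_ne
  im_pos u hu := by rw [refl_im]; exact h.im_pos u hu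
  inj u hu v hv k huv := h.inj u hu v hv k (by
    rw [← refl_real_mul] at huv
    exact refl_injective huv)

theorem refl_mem_planeDomain {t : ℝ} {w : ℂ} :
    refl w ∈ planeDomain τ₀ (fun t => refl (κ t)) t ↔ w ∈ planeDomain τ₀ κ t := by
  simp only [planeDomain, mem_ofPred_eq, refl_im, ← refl_real_mul, refl_injective.ne_iff]

theorem tendsto_refl_upperHalf : Tendsto refl (𝓝[upperHalf] 0) (𝓝[upperHalf] 0) := by
  refine tendsto_nhdsWithin_iff.2 ⟨?_, by
    filter_upwards [self_mem_nhdsWithin] with z hz using refl_mem hz⟩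
  have := (continuous_refl.tendsto 0).mono_left (nhdsWithin_le_nhds (s := upperHalf))
  simpa [refl] using this

theorem tendsto_refl_cobounded : Tendsto refl (Bornology.cobounded ℂ) (Bornology.cobounded ℂ) := by
  rw [← tendsto_norm_atTop_iff_cobounded]
  simpa using tendsto_norm_cobounded_atTop (E := ℂ)

/-- The reflected chain belongs to the reflected slit. -/
theorem IsPlaneChain.reflect (hf : IsPlaneChain τ₀ T κ f) :
    IsPlaneChain τ₀ T (fun t => refl (κ t)) (fun t z => refl (f t (refl z))) where
  differentiableOn t ht z hz :=
    (hasDerivAt_refl_comp ((hf.differentiableOn t ht).differentiableAt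
      (isOpen_upperHalf.mem_nhds (refl_mem hz))).hasDerivAt).differentiableAt.differentiableWithinAt
  injOn t ht z hz w hw h :=
    refl_injective (hf.injOn t ht (refl_mem hz) (refl_mem hw) (refl_injective h))
  image_eq t ht := by
    ext w
    constructor
    · rintro ⟨z, hz, rfl⟩
      rw [refl_mem_planeDomain, ← hf.image_eq t ht]
      exact mem_image_of_mem _ (refl_mem hz)
    · intro hw
      rw [← refl_refl w, refl_mem_planeDomain, ← hf.image_eq t ht] at hw
      obtain ⟨z, hz, hzw⟩ := hw
      exact ⟨refl z, refl_mem hz, by beta_reduce; rw [refl_refl, hzw, refl_refl]⟩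
  tendsto_zero t ht := by
    have h1 := (continuous_refl.tendsto 0).comp ((hf.tendsto_zero t ht).comp tendsto_refl_upperHalf)
    have h2 : refl 0 = 0 := by simp [refl]
    rw [h2] at h1
    exact h1
  tendsto_infty t ht := by
    refine tendsto_refl_cobounded.comp ((hf.tendsto_infty t ht).comp ?_)
    exact tendsto_inf.2 ⟨tendsto_refl_cobounded.mono_left inf_le_left,
      tendsto_principal.2 (eventually_inf_principal.2 (Eventually.of_forall fun z hz =>
        refl_mem hz))⟩
  ae_differentiableAt := by
    filter_upwards [hf.ae_differentiableAt] with t ht z hz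
    exact (HasDerivAt.refl_comp (ht _ (refl_mem hz)).hasDerivAt).differentiableAt

theorem refl_fieldTerm (τ τ' ξ c : ℝ) (z : ℂ) (k : ℤ) :
    refl (fieldTerm τ τ' ξ (-c) (refl z) k) = fieldTerm τ τ' (-ξ) c z k := by
  simp only [fieldTerm, refl, map_sub, map_div₀, map_mul, map_neg, Complex.conj_ofReal,
    Complex.conj_conj]
  have e1 : (Real.exp (k * τ) : ℂ) * -z - ξ = -((Real.exp (k * τ) : ℂ) * z - (-ξ : ℝ)) := by
    push_cast; ring
  have e2 : (Real.exp (k * τ) : ℂ) * (-c : ℝ) - ξ = -((Real.exp (k * τ) : ℂ) * c - (-ξ : ℝ)) := by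
    push_cast; ring
  rw [e1, e2, div_neg, div_neg]
  push_cast
  ring

theorem refl_field (lam τ τ' ξ c : ℝ) (z : ℂ) :
    refl (field lam τ τ' ξ (-c) (refl z)) = field lam τ τ' (-ξ) c z := by
  have h1 : (starRingEnd ℂ) (∑' k : ℤ, fieldTerm τ τ' ξ (-c) (refl z) k) =
      ∑' k : ℤ, (starRingEnd ℂ) (fieldTerm τ τ' ξ (-c) (refl z) k) := Complex.conj_tsum _
  have h2 : ∀ k : ℤ, (starRingEnd ℂ) (fieldTerm τ τ' ξ (-c) (refl z) k) =
      -fieldTerm τ τ' (-ξ) c z k := fun k => by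
    rw [← refl_fieldTerm]
    exact (neg_neg _).symm
  rw [field, refl, map_sub, h1]
  simp_rw [h2]
  rw [tsum_neg, field]
  simp [refl]
  ring

/-- The evolution equation is invariant under reflection in the imaginary axis. -/
theorem SatisfiesEvolution.reflect {τ ξ : ℝ → ℝ} (hf : IsPlaneChain τ₀ T κ f)
    (h : SatisfiesEvolution τ₀ T (fun t => refl (κ t)) (fun t z => refl (f t (refl z))) τ ξ) :
    SatisfiesEvolution τ₀ T κ f τ fun t => -ξ t := by
  obtain ⟨hmono, hall, ⟨c₀, hc₀⟩, hev⟩ := h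
  have hadm : ∀ c, IsAdmissible T τ (fun t => -ξ t) c → IsAdmissible T τ ξ (-c) := fun c hc =>
    ⟨neg_ne_zero.2 hc.1, fun t ht k hk => hc.2 t ht k (by linarith)⟩
  refine ⟨hmono, fun t ht => ?_, ⟨-c₀, neg_ne_zero.2 hc₀.1, fun t ht k hk =>
    hc₀.2 t ht k (by linarith)⟩, fun c hc => ?_⟩
  · obtain ⟨h1, h2, h3⟩ := hall t ht
    refine ⟨h1, fun z hz => ?_, ?_⟩
    · have := h2 _ (refl_mem hz)
      beta_reduce at this
      rw [refl_real_mul, refl_refl, ← refl_real_mul] at this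
      exact refl_injective this
    · have hr : Tendsto refl (𝓝[planeDomain τ₀ κ t] (κ t))
          (𝓝[planeDomain τ₀ (fun t => refl (κ t)) t] (refl (κ t))) :=
        tendsto_nhdsWithin_iff.2 ⟨(continuous_refl.tendsto _).mono_left nhdsWithin_le_nhds, by
          filter_upwards [self_mem_nhdsWithin] with w hw using refl_mem_planeDomain.2 hw⟩
      have h4 := (continuous_refl.tendsto _).comp (h3.comp hr)
      have h5 : refl (ξ t : ℂ) = ((-ξ t : ℝ) : ℂ) := by simp [refl]
      rw [h5] at h4
      refine h4.congr' ?_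
      filter_upwards [self_mem_nhdsWithin] with w hw
      have hw' := refl_mem_planeDomain.2 hw
      rw [← hf.reflect.image_eq t ht] at hw'
      have hm := Function.invFunOn_mem hw'
      have he := Function.invFunOn_eq hw'
      change refl (inverseMap _ (refl w)) = _
      have h6 : f t (refl (inverseMap (fun z => refl (f t (refl z))) (refl w))) = w :=
        refl_injective he
      have h7 := (hf.injOn t ht).leftInvOn_invFunOn (refl_mem hm)
      change Function.invFunOn (f t) upperHalf _ = _ at h7
      conv_rhs => rw [← h6]
      exact h7.symm
  · obtain ⟨lam, hlam⟩ := hev _ (hadm c hc)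
    refine ⟨lam, ?_⟩
    filter_upwards [hlam, ae_restrict_mem measurableSet_Ioo] with t ht htm
    refine ⟨ht.1, fun z hz => ?_⟩
    obtain ⟨h1, h2⟩ := ht.2 _ (refl_mem hz)
    constructor
    · have := (Complex.conjCLE.summable.2 h1).neg
      refine this.congr fun k => ?_
      exact refl_fieldTerm _ _ _ _ _ _
    · have h3 := HasDerivAt.refl_comp h2
      simp only [refl_refl] at h3
      refine h3.congr_deriv ?_
      have h4 := (hasDerivAt_refl_comp (((hf.differentiableOn t
        (Ioo_subset_Icc_self htm)).differentiableAt (isOpen_upperHalf.mem_nhds hz)).hasDerivAt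
          |> (by rw [refl_refl]; exact ·) : HasDerivAt (f t) (deriv (f t) z) (refl (refl z)))).deriv
      rw [h4, refl_mul, Complex.conj_conj, refl_field]

/-- The evolution equation for slits in the plane: a slit that starts on the negative axis is
reflected in the imaginary axis. -/
theorem IsPlaneChain.exists_evolution (hf : IsPlaneChain τ₀ T κ f) (hτ₀ : 0 < τ₀)
    (h : IsPlaneSlit τ₀ T κ) : ∃ τ ξ : ℝ → ℝ, SatisfiesEvolution τ₀ T κ f τ ξ := by
  have hre : (κ 0).re ≠ 0 := fun h0 => h.start_ne (Complex.ext h0 h.start_im)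
  rcases hre.lt_or_gt with h0 | h0
  · obtain ⟨τ, ξ, hev⟩ := hf.reflect.exists_evolution_of_pos hτ₀ h.reflect (by simpa using h0)
    exact ⟨τ, _, hev.reflect hf⟩
  · exact hf.exists_evolution_of_pos hτ₀ h h0

end AnnulusLoewner

/-! ### Passage to the quotient -/

namespace AnnulusLoewner

variable {τ₀ T : ℝ} {γ : ℝ → BorderedAnnulus τ₀} {γ' : ℝ → BorderedCover} {f : ℝ → ℂ → ℂ}

theorem proj_eq_iff {z w : BorderedCover} :
    proj τ₀ z = proj τ₀ w ↔ ∃ k : ℤ, (w : ℂ) = (Real.exp (k * τ₀) : ℂ) * (z : ℂ) :=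
  Quotient.eq (r := dilationSetoid τ₀)

theorem im_real_exp_mul (a : ℝ) (z : ℂ) : ((Real.exp a : ℂ) * z).im = Real.exp a * z.im :=
  Complex.im_ofReal_mul _ _

/-- The lift of a simple slit is a slit in the closed upper half-plane: simplicity in the quotient
is injectivity modulo the dilations. -/
theorem IsLift.isPlaneSlit (hγ' : IsLift τ₀ T γ γ') (hγ : IsSimpleSlit τ₀ T γ) (hT : 0 < T) :
    IsPlaneSlit τ₀ T fun t => (γ' t : ℂ) where
  continuousOn := continuous_subtype_val.comp_continuousOn hγ'.continuousOn
  start_im := by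
    obtain ⟨z, hz, h0⟩ := hγ.start_mem
    rw [← hγ'.proj_eq 0 ⟨le_rfl, hT.le⟩, proj_eq_iff] at h0
    obtain ⟨k, hk⟩ := h0
    rw [hk, im_real_exp_mul, show (z : ℂ).im = 0 from hz, mul_zero]
  start_ne := (γ' 0).2.2
  im_pos := fun u hu => by
    obtain ⟨z, hz, h0⟩ := hγ.mem_interior u hu
    rw [← hγ'.proj_eq u (Ioc_subset_Icc_self hu), proj_eq_iff] at h0
    obtain ⟨k, hk⟩ := h0
    rw [hk, im_real_exp_mul]
    exact mul_pos (Real.exp_pos _) hz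
  inj := fun u hu v hv k huv => by
    refine hγ.injOn hu hv ?_
    rw [← hγ'.proj_eq u hu, ← hγ'.proj_eq v hv]
    exact (proj_eq_iff.2 ⟨k, huv⟩).symm

theorem IsLift.slitDomain_eq (hγ' : IsLift τ₀ T γ γ') {t : ℝ} (ht : t ≤ T) :
    slitDomain τ₀ γ t = planeDomain τ₀ (fun t => (γ' t : ℂ)) t := by
  have key : ∀ z : BorderedCover, proj τ₀ z ∈ γ '' Ioc 0 t ↔
      ∃ u ∈ Ioc 0 t, ∃ k : ℤ, (z : ℂ) = (Real.exp (k * τ₀) : ℂ) * γ' u := fun z => by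
    refine exists_congr fun u => and_congr_right fun hu => ?_
    rw [← hγ'.proj_eq u ⟨hu.1.le, hu.2.trans ht⟩, proj_eq_iff]
  ext w
  constructor
  · rintro ⟨z, ⟨hz, hn⟩, rfl⟩
    exact ⟨hz, fun k u hu h => hn ((key z).2 ⟨u, hu, k, h⟩)⟩
  · rintro ⟨hw, hn⟩
    refine ⟨⟨w, hw.le, fun h => by simp [h] at hw⟩, ⟨hw, fun h => ?_⟩, rfl⟩
    obtain ⟨u, hu, k, h⟩ := (key _).1 h
    exact hn k u hu h

theorem IsLoewnerChain.isPlaneChain (hf : IsLoewnerChain τ₀ T γ f) (hnorm : IsNormalized T f)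
    (hγ' : IsLift τ₀ T γ γ') : IsPlaneChain τ₀ T (fun t => (γ' t : ℂ)) f where
  differentiableOn := hf.differentiableOn
  injOn := hf.injOn
  image_eq := fun t ht => by rw [hf.image_eq t ht, hγ'.slitDomain_eq ht.2]
  tendsto_zero := hnorm.tendsto_zero
  tendsto_infty := hnorm.tendsto_infty
  ae_differentiableAt := hf.ae_differentiableAt

theorem coe_dilation (a : ℝ) (z : ℍ) : (dilation a z : ℂ) = (Real.exp a : ℂ) * z := by
  simp only [dilation, MulAction.toPerm_apply, UpperHalfPlane.coe_pos_real_smul]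
  exact Complex.real_smul

theorem dilation_add (a b : ℝ) : dilation (a + b) = dilation a * dilation b := by
  ext z
  rw [Equiv.Perm.mul_apply, coe_dilation, coe_dilation, coe_dilation, Real.exp_add]
  push_cast
  ring

theorem dilation_zpow (a : ℝ) (k : ℤ) : dilation a ^ k = dilation (k * a) := by
  have h := map_zpow (MonoidHom.mk' (fun x : Multiplicative ℝ => dilation x.toAdd)
    fun x y => dilation_add x.toAdd y.toAdd) (Multiplicative.ofAdd a) k
  simpa [← ofAdd_zsmul] using h.symm

/-- A map that intertwines two dilations intertwines their integer powers. -/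
theorem apply_exp_int_mul {F : ℂ → ℂ} {a b : ℝ}
    (h : ∀ z ∈ upperHalf, F ((Real.exp a : ℂ) * z) = (Real.exp b : ℂ) * F z) (k : ℤ) :
    ∀ z ∈ upperHalf, F ((Real.exp (k * a) : ℂ) * z) = (Real.exp (k * b) : ℂ) * F z := by
  have hmem : ∀ (x : ℝ), ∀ z ∈ upperHalf, (Real.exp x : ℂ) * z ∈ upperHalf := fun x z hz => by
    change 0 < ((Real.exp x : ℂ) * z).im
    rw [im_real_exp_mul]
    exact mul_pos (Real.exp_pos _) hz
  induction k using Int.induction_on with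
  | zero => simp
  | succ n ih =>
    intro z hz
    have h1 := h _ (hmem (n * a) z hz)
    have h2 := ih z hz
    push_cast at h1 h2 ⊢
    rw [h2, ← mul_assoc, ← mul_assoc, ← Complex.exp_add, ← Complex.exp_add] at h1
    rw [add_mul, add_mul, one_mul, one_mul, add_comm _ (a : ℂ), add_comm _ (b : ℂ), h1]
  | pred n ih =>
    intro z hz
    have h1 := h _ (hmem ((-n - 1) * a) z hz)
    have h2 := ih z hz
    push_cast at h1 h2 ⊢
    rw [← mul_assoc, ← Complex.exp_add, show (a : ℂ) + (-n - 1) * a = -n * a by ring, h2] at h1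
    refine mul_left_cancel₀ (Complex.exp_ne_zero (b : ℂ)) ?_
    rw [← h1, ← mul_assoc, ← Complex.exp_add]
    ring_nf

/-- A map that intertwines two dilations conjugates the groups they generate into each other. -/
theorem conjugateGroup_dilationGroup {F : ℂ → ℂ} {a b : ℝ} (hinj : InjOn F upperHalf)
    (hmaps : MapsTo F upperHalf upperHalf)
    (h : ∀ z ∈ upperHalf, F ((Real.exp a : ℂ) * z) = (Real.exp b : ℂ) * F z) :
    conjugateGroup F (dilationGroup b) = (dilationGroup a : Set (Equiv.Perm ℍ)) := by
  ext ψ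
  simp only [conjugateGroup, mem_ofPred_eq, SetLike.mem_coe, dilationGroup,
    Subgroup.mem_zpowers_iff, exists_exists_eq_and, dilation_zpow, coe_dilation]
  refine exists_congr fun k => ⟨fun hψ => ?_, ?_⟩
  · ext z
    rw [coe_dilation]
    refine hinj (dilation (k * a) z).im_pos (ψ z).im_pos ?_ |> (coe_dilation _ z ▸ ·)
    rw [coe_dilation, apply_exp_int_mul h k z z.im_pos]
    exact (hψ z ⟨F z, hmaps z.im_pos⟩ rfl).symm
  · rintro rfl z w hzw
    rw [coe_dilation, apply_exp_int_mul h k z z.im_pos, hzw]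

end AnnulusLoewner

theorem theorem5p1 (τ₀ T : ℝ) (hτ₀ : 0 < τ₀) (hT : 0 < T)
    (γ : ℝ → AnnulusLoewner.BorderedAnnulus τ₀) (hγ : AnnulusLoewner.IsSimpleSlit τ₀ T γ)
    (γ' : ℝ → AnnulusLoewner.BorderedCover) (hγ' : AnnulusLoewner.IsLift τ₀ T γ γ')
    (f : ℝ → ℂ → ℂ) (hf : AnnulusLoewner.IsLoewnerChain τ₀ T γ f)
    (hnorm : AnnulusLoewner.IsNormalized T f) :
    ∃ τ ξ : ℝ → ℝ,
      StrictMonoOn τ (Icc 0 T) ∧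
      (∀ t ∈ Icc 0 T,
        0 < τ t ∧
        (∀ z ∈ AnnulusLoewner.upperHalf,
          f t ((Real.exp (τ t) : ℂ) * z) = (Real.exp τ₀ : ℂ) * f t z) ∧
        AnnulusLoewner.conjugateGroup (f t) (AnnulusLoewner.dilationGroup τ₀)
          = (AnnulusLoewner.dilationGroup (τ t) : Set (Equiv.Perm ℍ)) ∧
        Tendsto (AnnulusLoewner.inverseMap (f t))
          (𝓝[AnnulusLoewner.slitDomain τ₀ γ t] (γ' t : ℂ)) (𝓝 (ξ t : ℂ))) ∧
      (∃ c : ℝ, AnnulusLoewner.IsAdmissible T τ ξ c) ∧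
      ∀ c : ℝ, AnnulusLoewner.IsAdmissible T τ ξ c →
        ∃ lam : ℝ → ℝ, ∀ᵐ t ∂(volume.restrict (Ioo 0 T)),
          DifferentiableAt ℝ τ t ∧
          ∀ z ∈ AnnulusLoewner.upperHalf,
            Summable (AnnulusLoewner.fieldTerm (τ t) (deriv τ t) (ξ t) c z) ∧
            HasDerivAt (fun s : ℝ => f s z)
              (deriv (f t) z *
                AnnulusLoewner.field (lam t) (τ t) (deriv τ t) (ξ t) c z) t := by
  have hc := hf.isPlaneChain hnorm hγ'
  obtain ⟨τ, ξ, hmono, hall, hadm, hev⟩ := hc.exists_evolution hτ₀ (hγ'.isPlaneSlit hγ hT)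
  refine ⟨τ, ξ, hmono, fun t ht => ?_, hadm, hev⟩
  obtain ⟨hpos, hdil, htip⟩ := hall t ht
  refine ⟨hpos, hdil, ?_, by rwa [hγ'.slitDomain_eq ht.2]⟩
  refine AnnulusLoewner.conjugateGroup_dilationGroup (hf.injOn t ht) (fun z hz => ?_) hdil
  have h1 : f t z ∈ f t '' AnnulusLoewner.upperHalf := mem_image_of_mem _ hz
  rw [hc.image_eq t ht] at h1
  exact h1.1
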